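/- Let $(M^7,g)$ be a smooth $7$-dimensional Riemannian manifold with Levi-Civita connection $\nabla^g$, and let $\tau\in\Omega^3(M)$. Let $\nabla^\tau=\nabla^g+\tau$, where $g(\tau_XY,Z)=\tau(X,Y,Z)$, and suppose that $(M,g,\tau)$ is a geometry with parallel skew torsion, i.e. $\nabla^\tau\tau=0$, which is strictly nearly parallel $\mathrm G_2$: there are a $\mathrm G_2$-structure $\varphi\in\Omega^3(M)$ with associated metric $g$ and a constant $\tau_0\neq0$ such that $\tau=\frac{\tau_0}{12}\varphi$ (then $d\varphi=\tau_0\star_\varphi\varphi$, and $\nabla^\tau$ is the canonical $\mathrm G_2$-connection). Suppose that the holonomy representation of the holonomy algebra $\mathfrak{hol}_p(\nabla^\tau)$ on $T_pM$ is reducible at every $p\in M$, as is the case whenever $\mathfrak{hol}(\nabla^\tau)\subseteq\mathfrak{so}(4)\subset\mathfrak g_2$. Then there is a constant $\alpha\neq0$ such that $(M,g)$ is locally a $3$-$(\alpha,\delta)$-Sasaki manifold with $\delta=5\alpha$, and globally so if $M$ is simply connected. That is, every point of $M$ has an open neighbourhood $U$ (and one may take $U=M$ if $M$ is simply connected) carrying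 smooth unit Killing vector fields $\xi_1,\xi_2,\xi_3$ and smooth skew-symmetric endomorphism fields $\Phi_1,\Phi_2,\Phi_3$ of $TU$ such that for every even permutation $(i,j,k)$ of $(1,2,3)$ and every $X\in TU$ \begin{align*} \xi_k&=-\Phi_i\xi_j=\Phi_j\xi_i,\\ \Phi_kX&=-\Phi_i\Phi_jX+\langle\xi_j,X\rangle\xi_i=\Phi_j\Phi_iX-\langle\xi_i,X\rangle\xi_j,\\ \Phi_i^2&=-\mathrm{Id}+\xi_i\otimes\xi_i,\\ d\xi_i&=2\alpha\Phi_i+2(\alpha-\delta)\,\xi_j\wedge\xi_k,\qquad \delta=5\alpha, \end{align*} where vectors are identified with $1$-forms by $g$ and skew endomorphisms with $2$-forms by $\Phi(X,Y)=g(\Phi X,Y)$. -/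

import Mathlib

open Bundle VectorField
open scoped Manifold ContDiff

noncomputable section

namespace SkewTorsion

section Sharp
variable (V : Type*) [NormedAddCommGroup V] [InnerProductSpace ℝ V] [FiniteDimensional ℝ V]

/-- The musical isomorphism `V* → V` of a Euclidean space: `⟨sharp f, w⟩ = f w`. -/
def sharp : (V →L[ℝ] ℝ) →L[ℝ] V :=
  ∑ i, (ContinuousLinearMap.apply ℝ ℝ (stdOrthonormalBasis ℝ V i)).smulRight
    (stdOrthonormalBasis ℝ V i)

theorem inner_sharp (f : V →L[ℝ] ℝ) (w : V) : inner ℝ (sharp V f) w = f w := by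
  conv_rhs => rw [← (stdOrthonormalBasis ℝ V).sum_repr w]
  simp [sharp, sum_inner, inner_smul_left, OrthonormalBasis.repr_apply_apply, mul_comm]

end Sharp

section LeviCivita

variable {E : Type*} [NormedAddCommGroup E] [NormedSpace ℝ E] [FiniteDimensional ℝ E]
  {H : Type*} [TopologicalSpace H] {I : ModelWithCorners ℝ E H}
  {M : Type*} [TopologicalSpace M] [ChartedSpace H M] [IsManifold I ∞ M]
  [RiemannianBundle (fun x : M ↦ TangentSpace I x)]
  [IsContMDiffRiemannianBundle I ∞ E (fun x : M ↦ TangentSpace I x)]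

instance instFiniteDimensionalTangentSpace (x : M) : FiniteDimensional ℝ (TangentSpace I x) :=
  inferInstanceAs (FiniteDimensional ℝ E)

variable (I) in
/-- The right-hand side of the Koszul formula for `⟨∇_X Y, Z⟩`. -/
def koszul (Y X Z : Π x : M, TangentSpace I x) (x : M) : ℝ :=
  (1 / 2 : ℝ) *
    (mvfderiv I (fun y ↦ inner ℝ (Y y) (Z y)) x (X x)
      + mvfderiv I (fun y ↦ inner ℝ (X y) (Z y)) x (Y x)
      - mvfderiv I (fun y ↦ inner ℝ (X y) (Y y)) x (Z x)
      + inner ℝ (mlieBracket I X Y x) (Z x)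
      - inner ℝ (mlieBracket I X Z x) (Y x)
      - inner ℝ (mlieBracket I Y Z x) (X x))

theorem mdiffAt_inner {X Z : Π x : M, TangentSpace I x} {x : M}
    (hX : MDiffAt (T% X) x) (hZ : MDiffAt (T% Z) x) :
    MDiffAt (fun y ↦ inner ℝ (X y) (Z y)) x :=
  MDifferentiableAt.inner_bundle (E := fun x : M ↦ TangentSpace I x) (b := id) hX hZ

theorem koszul_tensorial₁ {Y Z : Π x : M, TangentSpace I x} {x : M}
    (hY : MDiffAt (T% Y) x) (hZ : MDiffAt (T% Z) x) :
    TensorialAt I E (fun X ↦ koszul I Y X Z x) x where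
  smul {f X} hf hX := by
    simp [koszul, inner_smul_left, mvfderiv_fun_mul hf (mdiffAt_inner hX hZ),
      mvfderiv_fun_mul hf (mdiffAt_inner hX hY), mlieBracket_smul_left hf hX, inner_add_left,
      inner_smul_right]
    ring
  add {X X'} hX hX' := by
    simp [koszul, inner_add_left, inner_add_right,
      mvfderiv_fun_add (mdiffAt_inner hX hZ) (mdiffAt_inner hX' hZ),
      mvfderiv_fun_add (mdiffAt_inner hX hY) (mdiffAt_inner hX' hY), mlieBracket_add_left hX hX']
    ring

theorem koszul_tensorial₂ {Y X : Π x : M, TangentSpace I x} {x : M}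
    (hY : MDiffAt (T% Y) x) (hX : MDiffAt (T% X) x) :
    TensorialAt I E (fun Z ↦ koszul I Y X Z x) x where
  smul {f Z} hf hZ := by
    simp [koszul, inner_smul_left, mvfderiv_fun_mul hf (mdiffAt_inner hX hZ),
      mvfderiv_fun_mul hf (mdiffAt_inner hY hZ), mlieBracket_smul_right hf hZ, inner_add_left,
      inner_smul_right]
    rw [real_inner_comm (X x) (Z x), real_inner_comm (Y x) (Z x)]
    ring
  add {Z Z'} hZ hZ' := by
    simp [koszul, inner_add_left, inner_add_right,
      mvfderiv_fun_add (mdiffAt_inner hX hZ) (mdiffAt_inner hX hZ'),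
      mvfderiv_fun_add (mdiffAt_inner hY hZ) (mdiffAt_inner hY hZ'), mlieBracket_add_right hZ hZ']
    ring

open Classical in
variable (I) in
/-- `leviCivitaFun I Y x v` is `∇_v Y` at `x`, given by the Koszul formula. As usual for Mathlib's
covariant derivatives the value is irrelevant where `Y` is not differentiable. -/
def leviCivitaFun (Y : Π x : M, TangentSpace I x) (x : M) :
    TangentSpace I x →L[ℝ] TangentSpace I x :=
  if hY : MDiffAt (T% Y) x then
    sharp (TangentSpace I x) ∘L TensorialAt.mkHom₂ (fun X Z ↦ koszul I Y X Z x) x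
      (fun _ hZ ↦ koszul_tensorial₁ hY hZ) (fun _ hX ↦ koszul_tensorial₂ hY hX)
  else 0

theorem inner_leviCivitaFun {X Y Z : Π x : M, TangentSpace I x} {x : M}
    (hY : MDiffAt (T% Y) x) (hX : MDiffAt (T% X) x) (hZ : MDiffAt (T% Z) x) :
    inner ℝ (leviCivitaFun I Y x (X x)) (Z x) = koszul I Y X Z x := by
  rw [leviCivitaFun, dif_pos hY, ContinuousLinearMap.comp_apply, inner_sharp]
  exact TensorialAt.mkHom₂_apply (fun _ hZ ↦ koszul_tensorial₁ hY hZ)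
    (fun _ hX ↦ koszul_tensorial₂ hY hX) hX hZ

theorem clm_ext {x : M} {A B : TangentSpace I x →L[ℝ] TangentSpace I x}
    (h : ∀ X Z : Π x : M, TangentSpace I x, MDiffAt (T% X) x → MDiffAt (T% Z) x →
      inner ℝ (A (X x)) (Z x) = inner ℝ (B (X x)) (Z x)) : A = B := by
  ext v
  apply ext_inner_right ℝ
  intro w
  simpa using h (FiberBundle.extend E v) (FiberBundle.extend E w)
    (FiberBundle.mdifferentiableAt_extend ..) (FiberBundle.mdifferentiableAt_extend ..)

variable (I M) in
/-- The Levi-Civita connection `∇^g` of a Riemannian manifold; `leviCivita I M Y p v` is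
`∇^g_v Y` at `p`. -/
def leviCivita : CovariantDerivative I E (TangentSpace I : M → Type _) where
  toFun := leviCivitaFun I
  isCovariantDerivativeOnUniv :=
    { add := by
        intro Y Y' x hY hY' _
        refine clm_ext fun X Z hX hZ ↦ ?_
        have hs : MDiffAt (T% (Y + Y')) x := mdifferentiableAt_add_section hY hY'
        rw [inner_leviCivitaFun hs hX hZ, add_apply, inner_add_left,
          inner_leviCivitaFun hY hX hZ, inner_leviCivitaFun hY' hX hZ]
        simp [koszul, inner_add_left, inner_add_right,
          mvfderiv_fun_add (mdiffAt_inner hY hZ) (mdiffAt_inner hY' hZ),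
          mvfderiv_fun_add (mdiffAt_inner hX hY) (mdiffAt_inner hX hY'),
          mlieBracket_add_right hY hY', mlieBracket_add_left hY hY']
        ring
      leibniz := by
        intro Y f x hY hf _
        refine clm_ext fun X Z hX hZ ↦ ?_
        have hs : MDiffAt (T% (f • Y)) x := hf.smul_section hY
        rw [inner_leviCivitaFun hs hX hZ, add_apply, inner_add_left,
          smul_apply, inner_smul_left, inner_leviCivitaFun hY hX hZ]
        simp [koszul, inner_smul_left, inner_smul_right,
          mvfderiv_fun_mul hf (mdiffAt_inner hY hZ), mvfderiv_fun_mul hf (mdiffAt_inner hX hY),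
          mlieBracket_smul_left hf hY, mlieBracket_smul_right hf hY, inner_add_left]
        rw [real_inner_comm (X x) (Y x)]
        ring }

/-- `∇^g` is torsion-free. -/
theorem leviCivita_torsion : (leviCivita I M).torsion = 0 := by
  rw [CovariantDerivative.torsion_eq_zero_iff]
  intro X Y x hX hY
  apply ext_inner_right ℝ
  intro w
  have hw := FiberBundle.extend_apply_self (F := E) w
  have hZ : MDiffAt (T% (FiberBundle.extend E w)) x := FiberBundle.mdifferentiableAt_extend ..
  set Z := FiberBundle.extend E w
  rw [← hw, inner_sub_left]
  change inner ℝ (leviCivitaFun I Y x (X x)) (Z x) - inner ℝ (leviCivitaFun I X x (Y x)) (Z x) = _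
  rw [inner_leviCivitaFun hY hX hZ, inner_leviCivitaFun hX hY hZ, koszul, koszul,
    mlieBracket_swap_apply (V := Y) (W := X)]
  simp only [real_inner_comm (X _) (Y _), inner_neg_left]
  ring

/-- `∇^g` is metric. -/
theorem leviCivita_metric {X Y Z : Π x : M, TangentSpace I x} {x : M}
    (hX : MDiffAt (T% X) x) (hY : MDiffAt (T% Y) x) (hZ : MDiffAt (T% Z) x) :
    mvfderiv I (fun y ↦ inner ℝ (Y y) (Z y)) x (X x) =
      inner ℝ (leviCivita I M Y x (X x)) (Z x) + inner ℝ (Y x) (leviCivita I M Z x (X x)) := by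
  change _ = inner ℝ (leviCivitaFun I Y x (X x)) (Z x) + inner ℝ (Y x) (leviCivitaFun I Z x (X x))
  rw [real_inner_comm _ (Y x)]
  rw [inner_leviCivitaFun hY hX hZ, inner_leviCivitaFun hZ hX hY, koszul, koszul,
    mlieBracket_swap_apply (V := Z) (W := Y)]
  simp only [real_inner_comm (Y _) (Z _), inner_neg_left]
  ring

end LeviCivita

section Torsion

variable {E : Type*} [NormedAddCommGroup E] [NormedSpace ℝ E] [FiniteDimensional ℝ E]
  {H : Type*} [TopologicalSpace H] {I : ModelWithCorners ℝ E H}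
  {M : Type*} [TopologicalSpace M] [ChartedSpace H M] [IsManifold I ∞ M]

variable (I M) in
/-- A smooth differential 3-form on `M`, written as `τ p X Y Z`. Smoothness is smoothness of
`τ(X, Y, Z)` for (locally) smooth vector fields `X`, `Y`, `Z`. -/
structure ThreeForm where
  /-- the trilinear form at each point -/
  toFun : Π p : M, TangentSpace I p →L[ℝ] TangentSpace I p →L[ℝ] TangentSpace I p →L[ℝ] ℝ
  alt_left : ∀ p (X Z : TangentSpace I p), toFun p X X Z = 0
  alt_right : ∀ p (X Y : TangentSpace I p), toFun p X Y Y = 0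
  smooth : ∀ (p : M) (X Y Z : Π q : M, TangentSpace I q),
    CMDiffAt ∞ (T% X) p → CMDiffAt ∞ (T% Y) p → CMDiffAt ∞ (T% Z) p →
      CMDiffAt ∞ (fun q ↦ toFun q (X q) (Y q) (Z q)) p

instance : CoeFun (ThreeForm I M)
    (fun _ ↦ Π p : M, TangentSpace I p →L[ℝ] TangentSpace I p →L[ℝ] TangentSpace I p →L[ℝ] ℝ) :=
  ⟨ThreeForm.toFun⟩

/-- `D θ = 0`, i.e. `v (θ(X, Y, Z)) = θ(D_v X, Y, Z) + θ(X, D_v Y, Z) + θ(X, Y, D_v Z)`. -/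
def ThreeForm.IsParallel (D : CovariantDerivative I E (TangentSpace I : M → Type _))
    (θ : ThreeForm I M) : Prop :=
  ∀ (p : M) (X Y Z : Π q : M, TangentSpace I q),
    MDiffAt (T% X) p → MDiffAt (T% Y) p → MDiffAt (T% Z) p → ∀ v : TangentSpace I p,
      mvfderiv I (fun q ↦ θ q (X q) (Y q) (Z q)) p v =
        θ p (D X p v) (Y p) (Z p) + θ p (X p) (D Y p v) (Z p) + θ p (X p) (Y p) (D Z p v)

variable [RiemannianBundle (fun x : M ↦ TangentSpace I x)]
  [IsContMDiffRiemannianBundle I ∞ E (fun x : M ↦ TangentSpace I x)]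

/-- The connection `∇^τ = ∇^g + τ`, where `g(τ_X Y, Z) = τ(X, Y, Z)`. -/
def skewConnection (τ : ThreeForm I M) :
    CovariantDerivative I E (TangentSpace I : M → Type _) :=
  (leviCivita I M).addOneForm fun p ↦
    (ContinuousLinearMap.compL ℝ (TangentSpace I p) (TangentSpace I p →L[ℝ] ℝ)
      (TangentSpace I p) (sharp (TangentSpace I p))) ∘L (τ p).flip

/-- `⟨∇^τ_v Y, w⟩ = ⟨∇^g_v Y, w⟩ + τ(v, Y, w)`. -/
theorem inner_skewConnection (τ : ThreeForm I M) (p : M) (Y : Π q : M, TangentSpace I q)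
    (v w : TangentSpace I p) :
    inner ℝ (skewConnection τ Y p v) w =
      inner ℝ (leviCivita I M Y p v) w + τ p v (Y p) w := by
  change inner ℝ (leviCivita I M Y p v + sharp _ (τ p v (Y p))) w = _
  rw [inner_add_left, inner_sharp]

/-- `(M, g, τ)` is a geometry with parallel skew torsion: `∇^τ τ = 0`. -/
def HasParallelSkewTorsion (τ : ThreeForm I M) : Prop :=
  τ.IsParallel (skewConnection τ)

end Torsion

section Holonomy

variable {E : Type*} [NormedAddCommGroup E] [NormedSpace ℝ E]
  {H : Type*} [TopologicalSpace H] {I : ModelWithCorners ℝ E H}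
  {M : Type*} [TopologicalSpace M] [ChartedSpace H M] [IsManifold I ∞ M]
  [RiemannianBundle (fun x : M ↦ TangentSpace I x)]

/-- The vector field `V` along the curve `γ` is parallel for the metric connection `D`. For a
metric connection the covariant derivative `DV/dt` along `γ` is determined by
`d/dt ⟨V, Y⟩ = ⟨DV/dt, Y⟩ + ⟨V, D_{γ'} Y⟩` for all smooth vector fields `Y` on `M`; parallel means
that the first term on the right vanishes. -/
def IsParallelAlong (D : CovariantDerivative I E (TangentSpace I : M → Type _))
    (γ : ℝ → M) (V : Π t : ℝ, TangentSpace I (γ t)) : Prop :=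
  ∀ (t : ℝ) (Y : Π q : M, TangentSpace I q), CMDiffAt ∞ (T% Y) (γ t) →
    HasDerivAt (fun s ↦ inner ℝ (V s) (Y (γ s)))
      (inner ℝ (V t) (D Y (γ t) (mfderiv 𝓘(ℝ, ℝ) I γ t (1 : ℝ)))) t

/-- `P : T_p M → T_q M` is the parallel transport of the metric connection `D` along some piecewise
smooth path from `p` to `q`: either along a smooth path `γ` from `γ 0` to `γ 1`, or along a
concatenation. -/
inductive IsParallelTransport (D : CovariantDerivative I E (TangentSpace I : M → Type _)) :
    ∀ p q : M, (TangentSpace I p →L[ℝ] TangentSpace I q) → Prop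
  | smooth (γ : ℝ → M) (hγ : ContMDiff 𝓘(ℝ, ℝ) I ∞ γ)
      (P : TangentSpace I (γ 0) →L[ℝ] TangentSpace I (γ 1))
      (hP : ∀ v, ∃ V : Π t : ℝ, TangentSpace I (γ t),
        IsParallelAlong D γ V ∧ V 0 = v ∧ V 1 = P v) :
      IsParallelTransport D (γ 0) (γ 1) P
  | comp {p q r : M} {P : TangentSpace I p →L[ℝ] TangentSpace I q}
      {Q : TangentSpace I q →L[ℝ] TangentSpace I r} :
      IsParallelTransport D p q P → IsParallelTransport D q r Q →
        IsParallelTransport D p r (Q ∘L P)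

/-- The holonomy group `Hol_p(D)`: parallel transports along piecewise smooth loops at `p`. -/
def holonomyGroup (D : CovariantDerivative I E (TangentSpace I : M → Type _)) (p : M) :
    Set (TangentSpace I p →L[ℝ] TangentSpace I p) :=
  {P | IsParallelTransport D p p P}

/-- The holonomy algebra `hol_p(D)`, the Lie algebra of the holonomy group: the velocities at the
identity of the `C¹` curves in `Hol_p(D)`. -/
def holonomyAlgebra (D : CovariantDerivative I E (TangentSpace I : M → Type _)) (p : M) :
    Set (TangentSpace I p →L[ℝ] TangentSpace I p) :=
  {A | ∃ c : ℝ → (TangentSpace I p →L[ℝ] TangentSpace I p), ContDiff ℝ 1 c ∧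
    c 0 = ContinuousLinearMap.id ℝ (TangentSpace I p) ∧ (∀ t, c t ∈ holonomyGroup D p) ∧
    HasDerivAt c A 0}

/-- The holonomy representation of `hol_p(D)` on `T_p M` is reducible, at every point `p`: it leaves
invariant a subspace other than `0` and `T_p M`. (If the holonomy algebra is contained in a maximal
subalgebra `so(4)` of `g₂`, such a subspace is the 3-dimensional one preserved by `so(4)`.) -/
def HasReducibleHolonomy (D : CovariantDerivative I E (TangentSpace I : M → Type _)) : Prop :=
  ∀ p : M, ∃ W : Submodule ℝ (TangentSpace I p), W ≠ ⊥ ∧ W ≠ ⊤ ∧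
    ∀ A ∈ holonomyAlgebra D p, ∀ w ∈ W, A w ∈ W

end Holonomy

section G2

/-- The 3-form `φ` on the Euclidean space `V` is a `G₂`-form whose associated metric is the given
inner product: in some orthonormal basis, `φ = ∑ i, eⁱ ∧ eⁱ⁺¹ ∧ eⁱ⁺³` (indices modulo 7). -/
def IsG2Form {V : Type*} [NormedAddCommGroup V] [InnerProductSpace ℝ V]
    (φ : V →L[ℝ] V →L[ℝ] V →L[ℝ] ℝ) : Prop :=
  ∃ e : OrthonormalBasis (Fin 7) ℝ V, ∀ X Y Z : V,
    φ X Y Z = ∑ i : Fin 7, Matrix.det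
      !![inner ℝ (e i) X, inner ℝ (e i) Y, inner ℝ (e i) Z;
         inner ℝ (e (i + 1)) X, inner ℝ (e (i + 1)) Y, inner ℝ (e (i + 1)) Z;
         inner ℝ (e (i + 3)) X, inner ℝ (e (i + 3)) Y, inner ℝ (e (i + 3)) Z]

variable {E : Type*} [NormedAddCommGroup E] [NormedSpace ℝ E] [FiniteDimensional ℝ E]
  {H : Type*} [TopologicalSpace H] {I : ModelWithCorners ℝ E H}
  {M : Type*} [TopologicalSpace M] [ChartedSpace H M] [IsManifold I ∞ M]
  [RiemannianBundle (fun x : M ↦ TangentSpace I x)]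
  [IsContMDiffRiemannianBundle I ∞ E (fun x : M ↦ TangentSpace I x)]

/-- The geometry with parallel skew torsion `(M⁷, g, τ)` is strictly nearly parallel `G₂`: there
are a `G₂`-structure `φ` with associated metric `g` and a constant `τ₀ ≠ 0` such that
`τ = (τ₀ / 12) φ`. The connection `∇^τ` is then the canonical `G₂`-connection. The equation
`dφ = τ₀ ⋆ φ` is not listed because it follows from `∇^τ τ = 0`. A metric that is a constant
multiple of the one associated with `φ` is covered by rescaling `φ` and `τ₀`. -/
structure IsStrictlyNearlyParallelG2 (τ : ThreeForm I M) : Prop where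
  parallel : HasParallelSkewTorsion τ
  exists_g2 : ∃ (φ : ThreeForm I M) (τ₀ : ℝ), τ₀ ≠ 0 ∧ (∀ p, IsG2Form (φ p)) ∧
    ∀ (p : M) (X Y Z : TangentSpace I p), τ p X Y Z = τ₀ / 12 * φ p X Y Z

end G2

section Sasaki

variable {E : Type*} [NormedAddCommGroup E] [NormedSpace ℝ E]
  {H : Type*} [TopologicalSpace H] {I : ModelWithCorners ℝ E H}
  {M : Type*} [TopologicalSpace M] [ChartedSpace H M] [IsManifold I ∞ M]
  [RiemannianBundle (fun x : M ↦ TangentSpace I x)]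

/-- The value at `p` of the Lie derivative `(L_ξ g)(X, Y)`. -/
def lieDerivMetric (ξ X Y : Π q : M, TangentSpace I q) (p : M) : ℝ :=
  mvfderiv I (fun q ↦ inner ℝ (X q) (Y q)) p (ξ p)
    - inner ℝ (mlieBracket I ξ X p) (Y p) - inner ℝ (X p) (mlieBracket I ξ Y p)

/-- The value at `p` of `dξ(X, Y) = X⟨ξ, Y⟩ - Y⟨ξ, X⟩ - ⟨ξ, [X, Y]⟩`, the exterior derivative of the
1-form dual to `ξ`. -/
def extDerivDual (ξ X Y : Π q : M, TangentSpace I q) (p : M) : ℝ :=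
  mvfderiv I (fun q ↦ inner ℝ (ξ q) (Y q)) p (X p)
    - mvfderiv I (fun q ↦ inner ℝ (ξ q) (X q)) p (Y p)
    - inner ℝ (ξ p) (mlieBracket I X Y p)

/-- `(ξ₁, ξ₂, ξ₃)`, `(Φ₁, Φ₂, Φ₃)` are the structure tensors of a 3-(α,δ)-Sasaki structure on the
open set `U` for the given metric. The even permutations of the indices are `(i, i + 1, i + 2)`,
and 2-forms and skew endomorphisms are identified by `Φ(X, Y) = ⟨Φ X, Y⟩`. -/
structure IsThreeAlphaDeltaSasakiOn (U : Set M) (α δ : ℝ)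
    (ξ : Fin 3 → Π p : M, TangentSpace I p)
    (Φ : Fin 3 → Π p : M, TangentSpace I p →L[ℝ] TangentSpace I p) : Prop where
  alpha_ne_zero : α ≠ 0
  smooth_xi : ∀ i, ∀ p ∈ U, CMDiffAt ∞ (T% (ξ i)) p
  smooth_Phi : ∀ i, ∀ p ∈ U, ∀ X : Π q : M, TangentSpace I q, CMDiffAt ∞ (T% X) p →
    CMDiffAt ∞ (T% (fun q ↦ Φ i q (X q))) p
  unit : ∀ i, ∀ p ∈ U, ‖ξ i p‖ = 1
  killing : ∀ i, ∀ p ∈ U, ∀ X Y : Π q : M, TangentSpace I q,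
    MDiffAt (T% X) p → MDiffAt (T% Y) p → lieDerivMetric (ξ i) X Y p = 0
  skew : ∀ i, ∀ p ∈ U, ∀ X Y : TangentSpace I p,
    inner ℝ (Φ i p X) Y = - inner ℝ X (Φ i p Y)
  Phi_xi : ∀ i, ∀ p ∈ U,
    ξ (i + 2) p = - Φ i p (ξ (i + 1) p) ∧ ξ (i + 2) p = Φ (i + 1) p (ξ i p)
  Phi_comp : ∀ i, ∀ p ∈ U, ∀ X : TangentSpace I p,
    Φ (i + 2) p X = - Φ i p (Φ (i + 1) p X) + inner ℝ (ξ (i + 1) p) X • ξ i p ∧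
    Φ (i + 2) p X = Φ (i + 1) p (Φ i p X) - inner ℝ (ξ i p) X • ξ (i + 1) p
  Phi_sq : ∀ i, ∀ p ∈ U, ∀ X : TangentSpace I p,
    Φ i p (Φ i p X) = - X + inner ℝ (ξ i p) X • ξ i p
  d_xi : ∀ i, ∀ p ∈ U, ∀ X Y : Π q : M, TangentSpace I q,
    MDiffAt (T% X) p → MDiffAt (T% Y) p →
      extDerivDual (ξ i) X Y p =
        2 * α * inner ℝ (Φ i p (X p)) (Y p) +
        2 * (α - δ) *
          (inner ℝ (ξ (i + 1) p) (X p) * inner ℝ (ξ (i + 2) p) (Y p) -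
            inner ℝ (ξ (i + 2) p) (X p) * inner ℝ (ξ (i + 1) p) (Y p))

end Sasaki

end SkewTorsion

end

/-! Put `c = τ₀ / 12` and let `×` be the cross product dual to `φ`, so that `∇^τ` is a metric
connection with torsion `2c X × Y` that preserves `×`. Parallel transport along the rays from `p`
gives a frame in which `∇^τ` has a connection form. Transport around small triangles shows that, up
to nonzero factors, the values of this form lie in the holonomy algebra
(`exists_mem_holonomyAlgebra`). Hence the invariant subspace given by reducibility is preserved by
the connection form, whose values are skew derivations of `×`.

Linear algebra improves this subspace: there is either a fixed nonzero vector or an invariant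
associative 3-plane `V` (`exists_fixed_or_associative`). A fixed vector contradicts the first
Bianchi identity, whose right side is `4c²` times the Jacobi sum of `×` (`not_fixed`). On the
parallel distribution `V`, with orthogonal projection `π`, the pair symmetry, the Bianchi identity
and the derivation property determine the curvature (`apply_associative`): `R(a,b)ζ = 12c² π(a × b)
× ζ - 36c² (πa × πb) × ζ`. This is exactly what makes the connection `∇_v ξ - 6c π(v) × ξ` on `V`
flat (`reducedForm_flat`).

A flat gauge therefore yields local oriented orthonormal frames `ξ₁, ξ₂, ξ₃` of `V` with `∇_v ξᵢ =
6c π(v) × ξᵢ`. With `Φᵢ X = ξᵢ × X - 2 ξᵢ × πX` the structure equations become identities for the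
cross product, with `α = c` and `δ = 5c`.

For the global statement, `V` is the only curvature-invariant subspace of dimension three
(`associative_unique`). Two local flat frames thus span the same distribution, and their transition
matrices are locally constant since both are flat for the same metric connection. They form a local
system, which has a global section when `M` is simply connected. -/

noncomputable section

namespace SkewTorsion

/-! ### Cross products and subspaces invariant under skew derivations -/

section CrossProduct

variable {F : Type*} [NormedAddCommGroup F] [InnerProductSpace ℝ F]

/-- The bilinear map `B` is a vector cross product on the Euclidean space `F`. -/
structure IsCrossProduct (B : F →L[ℝ] F →L[ℝ] F) : Prop where
  self : ∀ x, B x x = 0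
  inner_left : ∀ x y, inner ℝ (B x y) x = 0
  cross_cross_self : ∀ x y, B x (B x y) = inner ℝ x y • x - inner ℝ x x • y

/-- The endomorphism `N` is skew and a derivation of the product `B`. -/
structure IsSkewDerivation (B : F →L[ℝ] F →L[ℝ] F) (N : F →L[ℝ] F) : Prop where
  skew : ∀ a b, inner ℝ (N a) b = - inner ℝ a (N b)
  leibniz : ∀ a b, N (B a b) = B (N a) b + B a (N b)

namespace IsCrossProduct

variable {B : F →L[ℝ] F →L[ℝ] F} (hB : IsCrossProduct B)

include hB

theorem anti (x y : F) : B x y = - B y x := by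
  have h := hB.self (x + y)
  simp only [map_add, add_apply, hB.self, zero_add, add_zero] at h
  exact eq_neg_of_add_eq_zero_right h

theorem inner_swap (x y z : F) : inner ℝ (B x y) z = - inner ℝ (B z y) x := by
  have h := hB.inner_left (x + z) y
  simp only [map_add, add_apply, inner_add_left, inner_add_right, hB.inner_left, zero_add,
    add_zero] at h
  linarith

theorem inner_rotate (x y z : F) : inner ℝ (B x y) z = inner ℝ (B y z) x := by
  rw [hB.inner_swap x y z, hB.anti y z, inner_neg_left]

theorem inner_right (x y : F) : inner ℝ (B x y) y = 0 := by
  rw [hB.inner_rotate, hB.self, inner_zero_left]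

/-- Polarization of `cross_cross_self` in its repeated argument. -/
theorem cross_cross (x y z : F) :
    B x (B y z) = - B y (B x z) + inner ℝ x z • y + inner ℝ y z • x - (2 * inner ℝ x y) • z := by
  have h := hB.cross_cross_self (x + y) z
  simp only [map_add, add_apply, inner_add_left, inner_add_right, hB.cross_cross_self] at h
  rw [real_inner_comm x y] at h
  linear_combination (norm := module) h

theorem inner_cross_cross (x y : F) :
    inner ℝ (B x y) (B x y) = inner ℝ x x * inner ℝ y y - inner ℝ x y ^ 2 := by
  have h : inner ℝ (B x y) (B x y) = - inner ℝ (B x (B x y)) y := by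
    rw [hB.anti x (B x y), inner_neg_left, neg_neg, hB.inner_rotate (B x y) x y]
  rw [h, hB.cross_cross_self, inner_sub_left, inner_smul_left, inner_smul_left]
  simp
  ring

end IsCrossProduct

theorem IsSkewDerivation.inner_self {B : F →L[ℝ] F →L[ℝ] F} {N : F →L[ℝ] F}
    (hN : IsSkewDerivation B N) (a : F) : inner ℝ (N a) a = 0 := by
  have h := hN.skew a a
  rw [real_inner_comm] at h ⊢
  linarith

theorem inner_coe_basis {ι : Type*} [Fintype ι] [DecidableEq ι] {W : Submodule ℝ F}
    (b : OrthonormalBasis ι ℝ W) (i j : ι) :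
    inner ℝ (b i : F) (b j : F) = if i = j then (1 : ℝ) else 0 :=
  orthonormal_iff_ite.mp b.orthonormal i j

theorem eq_sum_of_mem {ι : Type*} [Fintype ι] {W : Submodule ℝ F} (b : OrthonormalBasis ι ℝ W)
    {w : F} (hw : w ∈ W) : w = ∑ i, inner ℝ (b i : F) w • (b i : F) := by
  have h := congrArg Subtype.val (b.sum_repr' ⟨w, hw⟩)
  simpa using h.symm

section Invariant

variable {B : F →L[ℝ] F →L[ℝ] F} (hB : IsCrossProduct B) {S : Set (F →L[ℝ] F)}
  (hS : ∀ N ∈ S, IsSkewDerivation B N)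

include hB hS

/-- A skew map kills the vector spanning an invariant line. On an invariant plane it is an
infinitesimal rotation, so as a derivation it kills the product of two orthonormal vectors, which is
nonzero by `inner_cross_cross`. -/
theorem exists_fixed_of_finrank_le_two {W : Submodule ℝ F} [FiniteDimensional ℝ W]
    (hW : W ≠ ⊥) (h2 : Module.finrank ℝ W ≤ 2) (hinv : ∀ N ∈ S, ∀ w ∈ W, N w ∈ W) :
    ∃ u : F, u ≠ 0 ∧ ∀ N ∈ S, N u = 0 := by
  have hpos : 0 < Module.finrank ℝ W := by
    rw [Module.finrank_pos_iff, Submodule.nontrivial_iff_ne_bot]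
    exact hW
  obtain h1 | h2 : Module.finrank ℝ W = 1 ∨ Module.finrank ℝ W = 2 := by omega
  · let b := (stdOrthonormalBasis ℝ W).reindex (finCongr h1)
    refine ⟨b 0, fun h => ?_, fun N hN => ?_⟩
    · simpa [h] using inner_coe_basis b 0 0
    · rw [eq_sum_of_mem b (hinv N hN _ (b 0).2), Fin.sum_univ_one, real_inner_comm,
        (hS N hN).inner_self, zero_smul]
  · let b := (stdOrthonormalBasis ℝ W).reindex (finCongr h2)
    have h0 : inner ℝ (b 0 : F) (b 0 : F) = 1 := by
      rw [inner_coe_basis]; simp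
    have h1 : inner ℝ (b 1 : F) (b 1 : F) = 1 := by
      rw [inner_coe_basis]; simp
    have h01 : inner ℝ (b 0 : F) (b 1 : F) = 0 := by
      rw [inner_coe_basis]; simp
    refine ⟨B (b 0) (b 1), fun h => ?_, fun N hN => ?_⟩
    · have := hB.inner_cross_cross (b 0) (b 1)
      rw [h, h0, h1, h01] at this
      simp at this
    · have e0 : N (b 0) = inner ℝ (b 1 : F) (N (b 0)) • (b 1 : F) := by
        conv_lhs => rw [eq_sum_of_mem b (hinv N hN _ (b 0).2)]
        rw [Fin.sum_univ_two, real_inner_comm, (hS N hN).inner_self, zero_smul, zero_add]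
      have e1 : N (b 1) = inner ℝ (b 0 : F) (N (b 1)) • (b 0 : F) := by
        conv_lhs => rw [eq_sum_of_mem b (hinv N hN _ (b 1).2)]
        rw [Fin.sum_univ_two, real_inner_comm _ (b 1 : F), (hS N hN).inner_self, zero_smul,
          add_zero]
      rw [(hS N hN).leibniz, e0, e1]
      simp [hB.self]

/-- For an orthonormal basis `u, v, w` of `W` the vector `u × (v × w)` decides. Every skew
derivation preserving `W` annihilates it, and if it vanishes then `v × w = ±u` and `W` is closed
under the product. -/
theorem exists_fixed_or_closed_of_finrank_eq_three {W : Submodule ℝ F} [FiniteDimensional ℝ W]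
    (h3 : Module.finrank ℝ W = 3) (hinv : ∀ N ∈ S, ∀ w ∈ W, N w ∈ W) :
    (∃ u : F, u ≠ 0 ∧ ∀ N ∈ S, N u = 0) ∨ ∀ a ∈ W, ∀ b ∈ W, B a b ∈ W := by
  let b := (stdOrthonormalBasis ℝ W).reindex (finCongr h3)
  have hb : ∀ i j, inner ℝ (b i : F) (b j : F) = if i = j then 1 else 0 := inner_coe_basis b
  set u : F := ((b 0 : W) : F) with hu
  set v : F := ((b 1 : W) : F) with hv
  set w : F := ((b 2 : W) : F) with hw
  have huu : inner ℝ u u = (1 : ℝ) := by rw [hu, hb]; simp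
  have hvv : inner ℝ v v = (1 : ℝ) := by rw [hv, hb]; simp
  have hww : inner ℝ w w = (1 : ℝ) := by rw [hw, hb]; simp
  have huv : inner ℝ u v = (0 : ℝ) := by rw [hu, hv, hb]; simp
  have huw : inner ℝ u w = (0 : ℝ) := by rw [hu, hw, hb]; simp
  have hvw : inner ℝ v w = (0 : ℝ) := by rw [hv, hw, hb]; simp
  have hex : ∀ x ∈ W, x = inner ℝ u x • u + inner ℝ v x • v + inner ℝ w x • w := fun x hx => by
    conv_lhs => rw [eq_sum_of_mem b hx, Fin.sum_univ_three]
  by_cases hχ : B u (B v w) = 0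
  · right
    -- The vanishing of `u × (v × w)` is the equality case of Cauchy–Schwarz for the unit vectors
    -- `u` and `v × w`.
    have hf : inner ℝ u (B v w) ^ 2 = 1 := by
      have h1 := hB.inner_cross_cross u (B v w)
      have h2 := hB.inner_cross_cross v w
      rw [hχ, huu, h2, hvv, hww, hvw] at h1
      simp at h1
      linarith
    have key : ∀ x y z : F, inner ℝ x x = 1 → inner ℝ y y = 1 → inner ℝ z z = 1 →
        inner ℝ x y = 0 → inner ℝ z (B x y) ^ 2 = 1 → B x y = inner ℝ z (B x y) • z := by
      intro x y z hx hy hz hxy hf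
      have : inner ℝ (B x y - inner ℝ z (B x y) • z) (B x y - inner ℝ z (B x y) • z) = (0 : ℝ) := by
        rw [inner_sub_left, inner_sub_right, inner_sub_right, hB.inner_cross_cross]
        simp only [inner_smul_left, inner_smul_right, hx, hy, hz, hxy, real_inner_comm z (B x y)]
        simp
        nlinarith
      rw [inner_self_eq_zero, sub_eq_zero] at this
      exact this
    have memv : ∀ x y z : F, z ∈ W → inner ℝ x x = 1 → inner ℝ y y = 1 → inner ℝ z z = 1 →
        inner ℝ x y = 0 → inner ℝ z (B x y) ^ 2 = 1 → B x y ∈ W := by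
      intro x y z hz h1 h2 h3 h4 h5
      rw [key x y z h1 h2 h3 h4 h5]
      exact W.smul_mem _ hz
    have mu : u ∈ W := (b 0).2
    have mv : v ∈ W := (b 1).2
    have mw : w ∈ W := (b 2).2
    have mvw : B v w ∈ W := memv v w u mu hvv hww huu hvw hf
    have mwu : B w u ∈ W := memv w u v mv hww huu hvv (by rw [real_inner_comm, huw]) (by
      rw [real_inner_comm, hB.inner_rotate, hB.inner_rotate, real_inner_comm, hf])
    have muv : B u v ∈ W := memv u v w mw huu hvv hww huv (by
      rw [real_inner_comm, hB.inner_rotate, real_inner_comm, hf])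
    have mvu : B v u ∈ W := by rw [hB.anti]; exact W.neg_mem muv
    have mwv : B w v ∈ W := by rw [hB.anti]; exact W.neg_mem mvw
    have muw : B u w ∈ W := by rw [hB.anti]; exact W.neg_mem mwu
    intro x hx y hy
    rw [hex x hx, hex y hy]
    simp only [map_add, map_smul, add_apply, smul_apply, hB.self, smul_zero, zero_add, add_zero]
    repeat' first
      | apply W.add_mem
      | apply W.smul_mem
      | assumption
  · left
    -- The matrix of `N` on `W` is skew with entries `r₁, r₂, r₃`. The terms with `r₁` and `r₂`
    -- cancel by `c1`–`c4`; those with `r₃` contain `w × w` or `v × v`.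
    refine ⟨B u (B v w), hχ, fun N hN => ?_⟩
    have hN' := hS N hN
    have eu := hex _ (hinv N hN _ (b 0).2)
    have ev := hex _ (hinv N hN _ (b 1).2)
    have ew := hex _ (hinv N hN _ (b 2).2)
    rw [← hu] at eu
    rw [← hv] at ev
    rw [← hw] at ew
    rw [real_inner_comm, hN'.inner_self] at eu
    rw [real_inner_comm _ v, hN'.inner_self] at ev
    rw [real_inner_comm _ w, hN'.inner_self] at ew
    have e1 : inner ℝ u (N v) = - inner ℝ v (N u) := by
      rw [real_inner_comm, hN'.skew, real_inner_comm]
    have e2 : inner ℝ u (N w) = - inner ℝ w (N u) := by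
      rw [real_inner_comm, hN'.skew, real_inner_comm]
    have e3 : inner ℝ v (N w) = - inner ℝ w (N v) := by
      rw [real_inner_comm, hN'.skew, real_inner_comm]
    rw [e1] at ev
    rw [e2, e3] at ew
    rw [hN'.leibniz, hN'.leibniz]
    generalize inner ℝ v (N u) = r₁ at eu ev
    generalize inner ℝ w (N u) = r₂ at eu ew
    generalize inner ℝ w (N v) = r₃ at ev ew
    rw [eu, ev, ew]
    have c1 : B v (B v w) = - w := by rw [hB.cross_cross_self, hvw, hvv]; module
    have c2 : B w (B v w) = v := by
      rw [hB.anti v w, map_neg, hB.cross_cross_self, hww, real_inner_comm, hvw]; module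
    have c3 : B u (B u w) = - w := by rw [hB.cross_cross_self, huu, huw]; module
    have c4 : B u (B v u) = v := by
      rw [hB.anti v u, map_neg, hB.cross_cross_self, huu, huv]; module
    simp only [map_add, map_smul, add_apply, smul_apply, hB.self, smul_zero, map_zero, c1, c2,
      c3, c4, zero_smul, zero_apply]
    module

/-- A skew map preserving `W` preserves `Wᗮ`, and in dimension seven one of the two has dimension at
most three. -/
theorem exists_fixed_or_associative [FiniteDimensional ℝ F] (h7 : Module.finrank ℝ F = 7)
    {W : Submodule ℝ F} (hW : W ≠ ⊥) (hW' : W ≠ ⊤) (hinv : ∀ N ∈ S, ∀ w ∈ W, N w ∈ W) :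
    (∃ u : F, u ≠ 0 ∧ ∀ N ∈ S, N u = 0) ∨
      ∃ V : Submodule ℝ F, Module.finrank ℝ V = 3 ∧ (∀ a ∈ V, ∀ b ∈ V, B a b ∈ V) ∧
        ∀ N ∈ S, ∀ w ∈ V, N w ∈ V := by
  have main : ∀ W : Submodule ℝ F, W ≠ ⊥ → Module.finrank ℝ W ≤ 3 →
      (∀ N ∈ S, ∀ w ∈ W, N w ∈ W) → (∃ u : F, u ≠ 0 ∧ ∀ N ∈ S, N u = 0) ∨
      ∃ V : Submodule ℝ F, Module.finrank ℝ V = 3 ∧ (∀ a ∈ V, ∀ b ∈ V, B a b ∈ V) ∧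
        ∀ N ∈ S, ∀ w ∈ V, N w ∈ V := by
    intro W hW h3 hinv
    obtain h2 | h3 : Module.finrank ℝ W ≤ 2 ∨ Module.finrank ℝ W = 3 := by omega
    · exact .inl (exists_fixed_of_finrank_le_two hB hS hW h2 hinv)
    · obtain h | h := exists_fixed_or_closed_of_finrank_eq_three hB hS h3 hinv
      · exact .inl h
      · exact .inr ⟨W, h3, h, hinv⟩
  by_cases h3 : Module.finrank ℝ W ≤ 3
  · exact main W hW h3 hinv
  · refine main Wᗮ (fun h => hW' ?_) ?_ ?_
    · rwa [Submodule.orthogonal_eq_bot_iff] at h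
    · have := W.finrank_add_finrank_orthogonal
      omega
    · intro N hN w hw a ha
      rw [real_inner_comm, (hS N hN).skew, real_inner_comm, hw _ (hinv N hN a ha), neg_zero]

end Invariant

end CrossProduct

end SkewTorsion

namespace SkewTorsion

/-! ### Algebraic curvature tensors with parallel skew torsion -/

section CurvatureAlgebra

variable {F : Type*} [NormedAddCommGroup F] [InnerProductSpace ℝ F]

/-- The algebraic properties of the curvature tensor at a point of the connection with parallel
skew torsion `2 c B`. -/
structure IsCurvatureTensor (B : F →L[ℝ] F →L[ℝ] F) (c : ℝ)
    (R : F →L[ℝ] F →L[ℝ] F →L[ℝ] F) : Prop where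
  anti : ∀ a b, R a b = - R b a
  skewDer : ∀ a b, IsSkewDerivation B (R a b)
  bianchi : ∀ a b d, R a b d + R b d a + R d a b =
    (4 * c ^ 2) • (B (B a b) d + B (B b d) a + B (B d a) b)

namespace IsCurvatureTensor

variable {B : F →L[ℝ] F →L[ℝ] F} (hB : IsCrossProduct B) {c : ℝ}
  {R : F →L[ℝ] F →L[ℝ] F →L[ℝ] F} (hR : IsCurvatureTensor B c R)

include hB hR

/-- Torsion does not spoil the pair symmetry: paired with a fourth vector, the right side of the
Bianchi identity is totally antisymmetric and drops out of the classical combination of four Bianchi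
identities. -/
theorem pair_symm (a b d e : F) : inner ℝ (R a b d) e = inner ℝ (R d e a) b := by
  have q : ∀ a b d e : F, inner ℝ (B (B a b) d) e = inner ℝ (B a b) (B d e) := fun a b d e => by
    rw [hB.inner_rotate, real_inner_comm]
  have hq : ∀ a b d e : F, inner ℝ (B a b) (B d e) = - inner ℝ (B b a) (B d e) :=
    fun a b d e => by rw [hB.anti a b, inner_neg_left]
  have hq' : ∀ a b d e : F, inner ℝ (B a b) (B d e) = inner ℝ (B d e) (B a b) :=
    fun a b d e => real_inner_comm _ _
  have bi : ∀ a b d e : F, inner ℝ (R a b d) e + inner ℝ (R b d a) e + inner ℝ (R d a b) e =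
      4 * c ^ 2 * (inner ℝ (B a b) (B d e) + inner ℝ (B b d) (B a e) +
        inner ℝ (B d a) (B b e)) := fun a b d e => by
    rw [← inner_add_left, ← inner_add_left, hR.bianchi, inner_smul_left, inner_add_left,
      inner_add_left, q, q, q]
    simp
  have s1 : ∀ a b d e : F, inner ℝ (R a b d) e = - inner ℝ (R b a d) e := fun a b d e => by
    rw [hR.anti a b, neg_apply, inner_neg_left]
  have s2 : ∀ a b d e : F, inner ℝ (R a b d) e = - inner ℝ (R a b e) d := fun a b d e => by
    rw [(hR.skewDer a b).skew, real_inner_comm]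
  have S1 := bi b a e d
  have S2 := bi a e d b
  have S3 := bi e d b a
  have S4 := bi d b a e
  -- The torsion terms of `S1`, …, `S4` are plus or minus one and the same number, and cancel in `S1
  -- + S2 - S3 - S4`.
  have k : inner ℝ (B b a) (B e d) + inner ℝ (B a e) (B b d) + inner ℝ (B e b) (B a d) =
      - (inner ℝ (B a e) (B d b) + inner ℝ (B e d) (B a b) + inner ℝ (B d a) (B e b)) := by
    linarith [hq d b a e, hq' a e d b, hq' a e b d, hq a b e d, hq' e d a b, hq a d e b,
      hq' e b a d]
  have k2 : inner ℝ (B e d) (B b a) + inner ℝ (B d b) (B e a) + inner ℝ (B b e) (B d a) =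
      - (inner ℝ (B a e) (B d b) + inner ℝ (B e d) (B a b) + inner ℝ (B d a) (B e b)) := by
    linarith [hq' e d b a, hq' e d a b, hq a b e d, hq' d b e a, hq e a d b, hq b e d a,
      hq' d a e b]
  have k3 : inner ℝ (B d b) (B a e) + inner ℝ (B b a) (B d e) + inner ℝ (B a d) (B b e) =
      (inner ℝ (B a e) (B d b) + inner ℝ (B e d) (B a b) + inner ℝ (B d a) (B e b)) := by
    linarith [hq' d b a e, hq b a d e, hq' a b d e, hq d e a b, hq a d b e, hq' d a b e,
      hq b e d a, hq' e b d a]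
  rw [k] at S1
  rw [k2] at S3
  rw [k3] at S4
  linarith [s1 a b d e, s1 b a e d, s2 b a e d, s2 a e d b, s1 e d a b, s2 e d a b, s1 d e a b,
    s2 d b a e, s1 d b a e, s2 b d a e, s1 e b d a, s1 b e d a, s2 a d b e, s1 a d b e, s2 d a e b,
    s1 e a b d, s2 e a b d, s1 a e b d, s2 b e a d, s2 e b a d, s1 d a e b, s2 a b d e]

/-- By pair symmetry, `⟨R(u,a)x, y⟩ = ⟨R(x,y)u, a⟩`. -/
theorem eq_zero_of_perp {u a : F} (h : ∀ x y, inner ℝ (R x y u) a = 0) : R u a = 0 := by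
  ext x
  refine ext_inner_right ℝ fun y => ?_
  rw [hR.pair_symm hB, h, zero_apply, inner_zero_left]

/-- If the curvature kills `u`, then `R(u,·) = 0` by pair symmetry, and the Bianchi identity for `a,
b, u` says that their Jacobi sum vanishes. For suitable `a` and `b` that sum is `-3 u × (a × b)`,
which is not zero. -/
theorem not_fixed [FiniteDimensional ℝ F] (h7 : Module.finrank ℝ F = 7) (hc : c ≠ 0) {u : F}
    (hu : u ≠ 0) (h : ∀ a b, R a b u = 0) : False := by
  have ex : ∀ s : Finset F, s.card ≤ 3 → ∃ a : F, a ≠ 0 ∧ ∀ b ∈ s, inner ℝ b a = 0 := by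
    intro s hs
    have h1 : Module.finrank ℝ (Submodule.span ℝ (s : Set F)) ≤ 3 :=
      (finrank_span_finset_le_card s).trans hs
    have h2 := (Submodule.span ℝ (s : Set F)).finrank_add_finrank_orthogonal
    have h3 : (Submodule.span ℝ (s : Set F))ᗮ ≠ ⊥ := by
      intro h
      rw [h, finrank_bot] at h2
      omega
    obtain ⟨a, ha, ha'⟩ := Submodule.exists_mem_ne_zero_of_ne_bot h3
    exact ⟨a, ha', fun b hb => ha b (Submodule.subset_span hb)⟩
  classical
  obtain ⟨a, ha, hua⟩ := ex {u} (by simp)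
  -- Orthogonality of `b` to `u × a` makes `u` orthogonal to `a × b`, so that `|u × (a × b)| = |u|
  -- |a| |b|`.
  obtain ⟨b, hb, hb'⟩ := ex {u, a, B u a} Finset.card_le_three
  have hua : inner ℝ u a = 0 := hua u (by simp)
  have hub : inner ℝ u b = 0 := hb' u (by simp)
  have hab : inner ℝ a b = 0 := hb' a (by simp)
  have huab : inner ℝ (B u a) b = 0 := hb' _ (by simp)
  have h0 : ∀ x, R u x = 0 := fun x => hR.eq_zero_of_perp hB fun y z => by
    rw [h, inner_zero_left]
  have bi := hR.bianchi a b u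
  have h0' : R b u = 0 := by rw [hR.anti, h0, neg_zero]
  rw [h, h0, h0'] at bi
  have hJ : B (B a b) u + B (B b u) a + B (B u a) b = 0 := by
    simp only [zero_apply, add_zero] at bi
    exact (smul_eq_zero.mp bi.symm).resolve_left (by positivity)
  have hau : inner ℝ a u = 0 := by rw [real_inner_comm, hua]
  have hbu : inner ℝ b u = 0 := by rw [real_inner_comm, hub]
  have hba : inner ℝ b a = 0 := by rw [real_inner_comm, hab]
  have e1 : B (B a b) u = - B u (B a b) := hB.anti _ _
  have e2 : B (B b u) a = - B u (B a b) := by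
    rw [hB.anti (B b u) a, hB.anti b u, map_neg, neg_neg, hB.cross_cross a u b, hab,
      hau, hub]
    module
  have e3 : B (B u a) b = - B u (B a b) := by
    rw [hB.anti (B u a) b, hB.cross_cross b u a, hB.anti b a, hba, hbu, hua]
    simp
  rw [e1, e2, e3] at hJ
  have hz : B u (B a b) = 0 := by
    have : (3 : ℝ) • B u (B a b) = 0 := by linear_combination (norm := module) - hJ
    simpa using this
  have hn := hB.inner_cross_cross u (B a b)
  rw [hB.inner_rotate, real_inner_comm] at huab
  rw [hz, hB.inner_cross_cross a b, hab, huab] at hn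
  have := real_inner_self_pos.mpr hu
  have := real_inner_self_pos.mpr ha
  have := real_inner_self_pos.mpr hb
  have : 0 < inner ℝ u u * (inner ℝ a a * inner ℝ b b) := by positivity
  rw [inner_zero_left] at hn
  linarith

section Associative

variable (hc : c ≠ 0) {V : Submodule ℝ F} (hV : ∀ a ∈ V, ∀ b ∈ V, B a b ∈ V)
  (hinv : ∀ a b, ∀ ζ ∈ V, R a b ζ ∈ V)

omit hR in
include hV in
theorem cross_mem_orthogonal {ξ x : F} (hξ : ξ ∈ V) (hx : x ∈ Vᗮ) : B ξ x ∈ Vᗮ := by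
  intro η hη
  rw [real_inner_comm, hB.inner_rotate, hB.inner_rotate, hx _ (hV η hη ξ hξ)]

-- For `z` orthogonal to `x` and `y`, two terms of the Jacobi sum add up to twice the third. This
-- triples the constant `4c²` of the Bianchi identity to `12c²`.
omit hR in
theorem cross_cross_add {x y z : F} (hx : inner ℝ x z = 0) (hy : inner ℝ y z = 0) :
    B (B y z) x + B (B z x) y = (2 : ℝ) • B (B x y) z := by
  have hx' : inner ℝ z x = 0 := by rw [real_inner_comm, hx]
  have hy' : inner ℝ z y = 0 := by rw [real_inner_comm, hy]
  have e1 : B (B y z) x = inner ℝ x y • z + B (B x y) z := by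
    rw [hB.anti (B y z) x, hB.anti y z, map_neg, neg_neg, hB.cross_cross x z y, hB.anti (B x y) z,
      hy', hx]
    module
  have e2 : B (B z x) y = - inner ℝ x y • z + B (B x y) z := by
    rw [hB.anti (B z x) y, hB.cross_cross y z x, hB.anti (B x y) z, hB.anti y x, map_neg, hx', hy,
      real_inner_comm]
    module
  rw [e1, e2]
  module

-- By pair symmetry it suffices that every curvature operator maps `ξ` into `V`, hence orthogonally
-- to `x`.
include hinv in
theorem apply_mixed {ξ x : F} (hξ : ξ ∈ V) (hx : x ∈ Vᗮ) : R ξ x = 0 :=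
  hR.eq_zero_of_perp hB fun _ _ => hx _ (hinv _ _ _ hξ)

-- The other two curvature terms of the Bianchi identity are mixed, hence zero.
include hinv in
theorem apply_horizontal {x y ζ : F} (hx : x ∈ Vᗮ) (hy : y ∈ Vᗮ) (hζ : ζ ∈ V) :
    R x y ζ = (12 * c ^ 2) • B (B x y) ζ := by
  have bi := hR.bianchi x y ζ
  rw [hR.apply_mixed hB hinv hζ hx, hR.anti y ζ, hR.apply_mixed hB hinv hζ hy] at bi
  simp only [neg_zero, zero_apply, add_zero] at bi
  rw [bi, add_assoc, cross_cross_add hB (x := x) (y := y) (z := ζ)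
    (by rw [real_inner_comm, hx _ hζ]) (by rw [real_inner_comm, hy _ hζ])]
  module

-- Invariance of `V` and `apply_horizontal` put `(x × y) × ζ` into `V`. If `n` is the component of
-- `x × y` orthogonal to `V`, then `ζ × n` lies both in `V` and in `Vᗮ`, so it is zero, and
-- `inner_cross_cross` forces `n = 0`.
include hc hV hinv in
theorem cross_mem {x y : F} [V.HasOrthogonalProjection] (hV0 : V ≠ ⊥)
    (hx : x ∈ Vᗮ) (hy : y ∈ Vᗮ) : B x y ∈ V := by
  obtain ⟨ζ, hζ, hζ0⟩ := Submodule.exists_mem_ne_zero_of_ne_bot hV0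
  have h1 : B (B x y) ζ ∈ V := by
    have h := hinv x y ζ hζ
    rw [hR.apply_horizontal hB hinv hx hy hζ] at h
    exact (V.smul_mem_iff (by positivity)).mp h
  obtain ⟨a, ha, n, hn, e⟩ := V.exists_add_mem_mem_orthogonal (B x y)
  have h2 : B ζ n ∈ Vᗮ := cross_mem_orthogonal hB hV hζ hn
  have h3 : B ζ n ∈ V := by
    have : B ζ n = - B (B x y) ζ + B a ζ := by
      rw [e, hB.anti ζ n, map_add, add_apply]
      abel
    rw [this]
    exact V.add_mem (V.neg_mem h1) (hV _ ha _ hζ)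
  have h4 : B ζ n = 0 := by
    have := h2 _ h3
    rwa [inner_self_eq_zero] at this
  have h5 := hB.inner_cross_cross ζ n
  rw [h4, hn _ hζ] at h5
  have hζ1 : inner ℝ ζ ζ ≠ (0 : ℝ) := by rwa [ne_eq, inner_self_eq_zero]
  have h6 : n = 0 := by
    rw [← inner_self_eq_zero (𝕜 := ℝ)]
    rw [inner_zero_left] at h5
    have h7 : inner ℝ ζ ζ * inner ℝ n n = (0 : ℝ) := by linarith
    exact (mul_eq_zero.mp h7).resolve_left hζ1
  rw [e, h6, add_zero]
  exact ha

-- The Bianchi identity determines `R(ξ,η)` on `Vᗮ` only. For `ζ` in `V` one writes `|x|² ζ = - x ×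
-- (x × ζ)` with `x` in `Vᗮ`, where both factors `x` and `x × ζ` are horizontal, and uses that
-- `R(ξ,η)` is a derivation.
include hV hinv in
theorem apply_vertical [V.HasOrthogonalProjection] (hV1 : V ≠ ⊤)
    {ξ η ζ : F} (hξ : ξ ∈ V) (hη : η ∈ V) (hζ : ζ ∈ V) :
    R ξ η ζ = (-24 * c ^ 2) • B (B ξ η) ζ := by
  have horth : Vᗮ ≠ ⊥ := by rwa [ne_eq, Submodule.orthogonal_eq_bot_iff]
  have hh : ∀ x ∈ Vᗮ, R ξ η x = (12 * c ^ 2) • B (B ξ η) x := by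
    intro x hx
    have bi := hR.bianchi ξ η x
    rw [hR.apply_mixed hB hinv hη hx, hR.anti x ξ, hR.apply_mixed hB hinv hξ hx] at bi
    simp only [neg_zero, zero_apply, add_zero] at bi
    rw [bi, add_assoc, cross_cross_add hB (hx _ hξ) (hx _ hη)]
    module
  obtain ⟨x, hx, hx0⟩ := Submodule.exists_mem_ne_zero_of_ne_bot horth
  have hxx : inner ℝ x x ≠ (0 : ℝ) := by rwa [ne_eq, inner_self_eq_zero]
  set k := B ξ η with hk
  have hkV : k ∈ V := hV _ hξ _ hη
  have hxζ : inner ℝ x ζ = 0 := by rw [real_inner_comm, hx _ hζ]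
  have hxk : inner ℝ x k = 0 := by rw [real_inner_comm, hx _ hkV]
  have hxkζ : inner ℝ x (B k ζ) = 0 := by rw [real_inner_comm, hx _ (hV _ hkV _ hζ)]
  have hyV : B x ζ ∈ Vᗮ := by
    rw [hB.anti]; exact Vᗮ.neg_mem (cross_mem_orthogonal hB hV hζ hx)
  have hxxz : B x (B x ζ) = - inner ℝ x x • ζ := by
    rw [hB.cross_cross_self, hxζ]; module
  have hxxkz : B x (B x (B k ζ)) = - inner ℝ x x • B k ζ := by
    rw [hB.cross_cross_self, hxkζ]; module
  have e1 : B k (B x ζ) = inner ℝ k ζ • x - B x (B k ζ) := by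
    rw [hB.cross_cross k x ζ, hxζ, hx _ hkV]; module
  have e2 : B x (B k (B x ζ)) = inner ℝ x x • B k ζ := by
    rw [e1, map_sub, map_smul, hB.self, hxxkz]; module
  have hkx : B k x ∈ Vᗮ := cross_mem_orthogonal hB hV hkV hx
  have e3 : B (B k x) ζ = inner ℝ k ζ • x + B x (B k ζ) := by
    rw [hB.anti (B k x) ζ, hB.anti k x, map_neg, neg_neg, hB.cross_cross ζ x k, hB.anti ζ k, hxk,
      real_inner_comm x ζ, hxζ, real_inner_comm ζ k]
    simp
    module
  have e4 : B (B k x) (B x ζ) = inner ℝ x x • B k ζ := by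
    rw [hB.cross_cross (B k x) x ζ, e3, map_add, map_smul, hB.self, hxxkz, hxζ,
      real_inner_comm ζ (B k x), hkx _ hζ, hB.inner_right]
    module
  have main : - inner ℝ x x • R ξ η ζ = (24 * c ^ 2) • (inner ℝ x x • B k ζ) := by
    have h := (hR.skewDer ξ η).leibniz x (B x ζ)
    rw [hxxz, map_smul, hh x hx, hh _ hyV, map_smul, smul_apply, map_smul, e2, e4] at h
    rw [h]
    module
  have h2 : inner ℝ x x • (R ξ η ζ - (-24 * c ^ 2) • B k ζ) = 0 := by
    linear_combination (norm := module) - main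
  rw [smul_eq_zero_iff_right hxx, sub_eq_zero] at h2
  exact h2

set_option synthInstance.maxHeartbeats 200000 in
include hc hV hinv in
/-- The curvature on an invariant associative subspace. -/
theorem apply_associative [V.HasOrthogonalProjection] (hV0 : V ≠ ⊥) (hV1 : V ≠ ⊤)
    (a b : F) {ζ : F} (hζ : ζ ∈ V) :
    R a b ζ = (12 * c ^ 2) • B (V.starProjection (B a b)) ζ -
      (36 * c ^ 2) • B (B (V.starProjection a) (V.starProjection b)) ζ := by
  obtain ⟨a, ha, a', ha', rfl⟩ := V.exists_add_mem_mem_orthogonal a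
  obtain ⟨b, hb, b', hb', rfl⟩ := V.exists_add_mem_mem_orthogonal b
  have pV : ∀ x ∈ V, V.starProjection x = x := fun x hx => Submodule.starProjection_eq_self_iff.mpr hx
  have pH : ∀ x ∈ Vᗮ, V.starProjection x = 0 := fun x hx =>
    V.starProjection_apply_eq_zero_iff.mpr hx
  have h1 : V.starProjection (B a b') = 0 := pH _ (cross_mem_orthogonal hB hV ha hb')
  have h2 : V.starProjection (B a' b) = 0 := by
    rw [hB.anti, map_neg, pH _ (cross_mem_orthogonal hB hV hb ha'), neg_zero]
  have h3 := pV _ (hR.cross_mem hB hc hV hinv hV0 ha' hb')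
  have h4 := pV _ (hV _ ha _ hb)
  have h5 : R a' b = 0 := by rw [hR.anti, hR.apply_mixed hB hinv hb ha', neg_zero]
  -- Vertical pairs receive both terms, `12 - 36 = -24`, and horizontal pairs only the first. For
  -- mixed pairs the product is orthogonal to `V` and everything vanishes.
  simp only [map_add, add_apply, pV a ha, pV b hb, pH a' ha', pH b' hb', h1, h2, h3, h4,
    hR.apply_mixed hB hinv ha hb', h5, hR.apply_horizontal hB hinv ha' hb' hζ,
    hR.apply_vertical hB hV hinv hV1 ha hb hζ, add_zero, zero_add]
  module

end Associative

/-- An invariant associative subspace is unique. -/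
theorem associative_unique [FiniteDimensional ℝ F] (h7 : Module.finrank ℝ F = 7) (hc : c ≠ 0)
    {V V' : Submodule ℝ F} (h3 : Module.finrank ℝ V = 3) (h3' : Module.finrank ℝ V' = 3)
    (hinv : ∀ a b, ∀ ζ ∈ V, R a b ζ ∈ V) (hinv' : ∀ a b, ∀ ζ ∈ V', R a b ζ ∈ V') : V = V' := by
  set S : Set (F →L[ℝ] F) := {N | ∃ a b, N = R a b}
  have hS : ∀ N ∈ S, IsSkewDerivation B N := by
    rintro _ ⟨a, b, rfl⟩
    exact hR.skewDer a b
  -- An invariant line or plane would produce a fixed vector, excluded by `not_fixed`.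
  have small : ∀ W : Submodule ℝ F, W ≠ ⊥ → Module.finrank ℝ W ≤ 2 →
      (∀ a b, ∀ ζ ∈ W, R a b ζ ∈ W) → False := by
    intro W hW h2 hi
    obtain ⟨u, hu, h⟩ := exists_fixed_of_finrank_le_two hB hS hW h2 (by
      rintro _ ⟨a, b, rfl⟩
      exact hi a b)
    exact hR.not_fixed hB h7 hc hu fun a b => h _ ⟨a, b, rfl⟩
  have hsum := Submodule.finrank_sup_add_finrank_inf_eq V V'
  -- If `V` and `V'` meet trivially, their sum has dimension six and its complement is an invariant
  -- line. Otherwise the intersection is invariant, hence of dimension three.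
  by_cases hinf : V ⊓ V' = ⊥
  · exfalso
    rw [hinf, finrank_bot] at hsum
    have hperp := (V ⊔ V').finrank_add_finrank_orthogonal
    refine small (V ⊔ V')ᗮ ?_ (by omega) ?_
    · intro h
      rw [h, finrank_bot] at hperp
      omega
    · intro a b ζ hζ y hy
      obtain ⟨v, hv, v', hv', rfl⟩ := Submodule.mem_sup.mp hy
      rw [real_inner_comm, (hR.skewDer a b).skew, real_inner_comm, map_add,
        hζ _ (Submodule.add_mem_sup (hinv a b v hv) (hinv' a b v' hv')), neg_zero]
  · by_cases h2 : Module.finrank ℝ (V ⊓ V' : Submodule ℝ F) ≤ 2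
    · exact (small _ hinf h2 fun a b ζ hζ => ⟨hinv a b ζ hζ.1, hinv' a b ζ hζ.2⟩).elim
    · have e1 := Submodule.eq_of_le_of_finrank_le (inf_le_left : V ⊓ V' ≤ V) (by omega)
      have e2 := Submodule.eq_of_le_of_finrank_le (inf_le_right : V ⊓ V' ≤ V') (by omega)
      rw [← e1]
      exact e2

end IsCurvatureTensor

end CurvatureAlgebra

end SkewTorsion

namespace SkewTorsion

/-! ### Radial gauges by inversion of Volterra operators -/

section RadialGauge

set_option synthInstance.maxHeartbeats 200000

open scoped unitInterval

universe u

variable {E : Type u} [NormedAddCommGroup E] [NormedSpace ℝ E]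

section RayMap

variable {G : Type u} [NormedAddCommGroup G] [NormedSpace ℝ G]

/-- The restriction of a continuous function to the segment from `0` to `x`. -/
def rayMap (f : E → G) (hf : Continuous f) (x : E) : C(I, G) :=
  ⟨fun s ↦ f ((s : ℝ) • x), by fun_prop⟩

omit [NormedSpace ℝ G] in
theorem continuous_rayMap (f : E → G) (hf : Continuous f) : Continuous (rayMap f hf) :=
  ContinuousMap.continuous_of_continuous_uncurry _ (by
    simp only [Function.uncurry_def, rayMap, ContinuousMap.coe_mk]; fun_prop)

/-- Pointwise evaluation of a path of operators, weighted by a scalar function. -/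
def pathEval (ρ : C(I, ℝ)) : C(I, E →L[ℝ] G) →L[ℝ] E →L[ℝ] C(I, G) :=
  LinearMap.mkContinuous₂
    (LinearMap.mk₂ ℝ (fun (h : C(I, E →L[ℝ] G)) (v : E) ↦ (⟨fun s ↦ ρ s • h s v, by fun_prop⟩ : C(I, G)))
      (fun _ _ _ ↦ by ext; simp) (fun _ _ _ ↦ by ext; simp [smul_comm (ρ _)])
      (fun _ _ _ ↦ by ext; simp) (fun _ _ _ ↦ by ext; simp [smul_comm (ρ _)]))
    ‖ρ‖ (fun (h : C(I, E →L[ℝ] G)) (v : E) ↦ by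
      refine (ContinuousMap.norm_le _ (by positivity)).mpr fun s ↦ ?_
      simp only [LinearMap.mk₂_apply, ContinuousMap.coe_mk, norm_smul]
      calc ‖ρ s‖ * ‖h s v‖ ≤ ‖ρ‖ * (‖h‖ * ‖v‖) := by
            gcongr
            · exact ρ.norm_coe_le_norm s
            · exact ((h s).le_opNorm v).trans (by gcongr; exact h.norm_coe_le_norm s)
        _ = _ := by ring)

@[simp] theorem pathEval_apply (ρ : C(I, ℝ)) (h : C(I, E →L[ℝ] G)) (v : E) (s : I) :
    pathEval ρ h v s = ρ s • h s v := rfl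

/-- The inclusion of the unit interval in the real line. -/
def intervalCoe : C(I, ℝ) := ⟨fun s ↦ s, by fun_prop⟩

/-- The mean value inequality gives an estimate uniform in `s`, because the path of derivatives
along the segment depends continuously on its endpoint in the sup norm. -/
theorem hasFDerivAt_rayMap {f : E → G} (hf : ContDiff ℝ 1 f) (x : E) :
    HasFDerivAt (rayMap f hf.continuous)
      (pathEval intervalCoe (rayMap (fderiv ℝ f) (hf.continuous_fderiv one_ne_zero) x)) x := by
  rw [hasFDerivAt_iff_isLittleO, Asymptotics.isLittleO_iff]
  intro ε hε
  obtain ⟨δ, hδ, hδ'⟩ := Metric.continuousAt_iff.mp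
    ((continuous_rayMap (fderiv ℝ f) (hf.continuous_fderiv one_ne_zero)).continuousAt (x := x)) ε hε
  filter_upwards [Metric.ball_mem_nhds x hδ] with y hy
  refine (ContinuousMap.norm_le _ (by positivity)).mpr fun s ↦ ?_
  have hseg : ∀ z ∈ segment ℝ x y, ‖fderiv ℝ f ((s : ℝ) • z) - fderiv ℝ f ((s : ℝ) • x)‖ ≤ ε := by
    intro z hz
    have hz' : dist z x < δ :=
      (convex_ball x δ).segment_subset (Metric.mem_ball_self hδ) hy hz
    have := (ContinuousMap.dist_apply_le_dist (f := rayMap (fderiv ℝ f) _ z)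
      (g := rayMap (fderiv ℝ f) (hf.continuous_fderiv one_ne_zero) x) s).trans (hδ' hz').le
    rwa [dist_eq_norm] at this
  have hd := hf.differentiable one_ne_zero
  have key := (convex_segment x y).norm_image_sub_le_of_norm_hasFDerivWithin_le
    (f := fun z ↦ f ((s : ℝ) • z) - fderiv ℝ f ((s : ℝ) • x) ((s : ℝ) • z))
    (f' := fun z ↦ (s : ℝ) • (fderiv ℝ f ((s : ℝ) • z) - fderiv ℝ f ((s : ℝ) • x)))
    (C := ε) (fun z hz ↦ ?_) (fun z hz ↦ ?_) (left_mem_segment ℝ x y) (right_mem_segment ℝ x y)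
  · refine le_trans (le_of_eq ?_) key
    congr 1
    simp [rayMap, intervalCoe]
    abel
  · apply HasFDerivAt.hasFDerivWithinAt
    have h1 : HasFDerivAt (fun z : E ↦ (s : ℝ) • z) ((s : ℝ) • ContinuousLinearMap.id ℝ E) z :=
      (hasFDerivAt_id z).const_smul (s : ℝ)
    have h2 := ((hd ((s : ℝ) • z)).hasFDerivAt.comp z h1).sub
      ((fderiv ℝ f ((s : ℝ) • x)).hasFDerivAt.comp z h1)
    exact h2.congr_fderiv (by ext v; simp [smul_sub])
  · rw [norm_smul]
    have : ‖(s : ℝ)‖ ≤ 1 := by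
      rw [Real.norm_of_nonneg s.2.1]
      exact s.2.2
    calc _ ≤ 1 * ε := by gcongr; exact hseg z hz
      _ = ε := one_mul _

/-- The derivative of `rayMap f` is a fixed continuous linear map applied to `rayMap (fderiv ℝ f)`,
so the induction on `n` has to let the target `G` vary. -/
theorem contDiff_nat_rayMap (n : ℕ) : ∀ {G : Type u} [NormedAddCommGroup G] [NormedSpace ℝ G]
    {f : E → G} (hf : ContDiff ℝ n f), ContDiff ℝ n (rayMap f hf.continuous) := by
  induction n with
  | zero => exact fun hf ↦ contDiff_zero.mpr (continuous_rayMap _ _)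
  | succ n ih =>
    intro G _ _ f hf
    have hf1 : ContDiff ℝ 1 f := hf.of_le (by simp)
    have hf' : ContDiff ℝ n (fderiv ℝ f) := hf.fderiv_right (by simp)
    generalize hf.continuous = hcont
    rw [Nat.cast_succ, contDiff_succ_iff_hasFDerivAt]
    exact ⟨fun x ↦ pathEval intervalCoe (rayMap (fderiv ℝ f) hf'.continuous x),
      (ContinuousLinearMap.contDiff _).comp (ih hf'), hasFDerivAt_rayMap hf1⟩

theorem contDiff_rayMap {f : E → G} (hf : ContDiff ℝ ∞ f) :
    ContDiff ℝ ∞ (rayMap f hf.continuous) :=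
  contDiff_infty.mpr fun n ↦ contDiff_nat_rayMap n (contDiff_infty.mp hf n)

end RayMap

section Volterra

variable {A : Type u} [NormedRing A] [NormedAlgebra ℝ A] [CompleteSpace A]

/-- The value of a path, extended to be constant outside of the unit interval. -/
def pathExtend (z : C(I, A)) (s : ℝ) : A := z (Set.projIcc 0 1 zero_le_one s)

omit [NormedAlgebra ℝ A] [CompleteSpace A] in
theorem continuous_pathExtend (z : C(I, A)) : Continuous (pathExtend z) :=
  z.continuous.comp continuous_projIcc

omit [CompleteSpace A] in
/-- Integration of paths. -/
def pathIntegral : C(I, A) →L[ℝ] C(I, A) :=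
  LinearMap.mkContinuous
    { toFun z := ⟨fun t ↦ ∫ s in (0 : ℝ)..t, pathExtend z s,
        (intervalIntegral.continuous_primitive
          (fun _ _ ↦ (continuous_pathExtend z).intervalIntegrable _ _) 0).comp
          continuous_subtype_val⟩
      map_add' z w := by
        ext t
        exact intervalIntegral.integral_add ((continuous_pathExtend z).intervalIntegrable _ _)
          ((continuous_pathExtend w).intervalIntegrable _ _)
      map_smul' r z := by
        ext t
        exact intervalIntegral.integral_smul r (pathExtend z) }
    1 (fun z ↦ by
      refine (ContinuousMap.norm_le _ (by positivity)).mpr fun t ↦ ?_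
      refine (intervalIntegral.norm_integral_le_of_norm_le_const
        (C := ‖z‖) fun s _ ↦ z.norm_coe_le_norm _).trans ?_
      rw [sub_zero, abs_of_nonneg t.2.1, one_mul]
      exact mul_le_of_le_one_right (norm_nonneg z) t.2.2)

omit [CompleteSpace A] in
/-- Pointwise multiplication of paths. -/
def pathMul : C(I, A) →L[ℝ] C(I, A) →L[ℝ] C(I, A) :=
  LinearMap.mkContinuous₂ (LinearMap.mul ℝ C(I, A)) 1 (fun h y ↦ by
    rw [one_mul]
    exact norm_mul_le h y)

/-- The operator `y ↦ y + ∫ h y` of the linear differential equation `y' = - h y`. -/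
def odeOperator (h : C(I, A)) : C(I, A) →L[ℝ] C(I, A) :=
  1 + pathIntegral ∘L pathMul h

omit [CompleteSpace A] in
theorem odeOperator_apply (h y : C(I, A)) (t : I) :
    odeOperator h y t = y t + ∫ s in (0 : ℝ)..t, pathExtend (h * y) s := rfl

omit [CompleteSpace A] in
theorem contDiff_odeOperator : ContDiff ℝ ∞ (odeOperator (A := A)) := by
  have h : ContDiff ℝ ∞ (pathMul (A := A)) := by fun_prop
  exact contDiff_const.add (contDiff_const.clm_comp h)

/-- The coefficient of the parallel transport equation along the segment from `0` to `x`. -/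
def rayCoeff (κ : E → E →L[ℝ] A) (hκ : Continuous κ) (x : E) : C(I, A) :=
  pathEval 1 (rayMap κ hκ x) x

omit [CompleteSpace A] in
theorem rayCoeff_apply (κ : E → E →L[ℝ] A) (hκ : Continuous κ) (x : E) (s : I) :
    rayCoeff κ hκ x s = κ ((s : ℝ) • x) x := by
  simp [rayCoeff, rayMap]

omit [CompleteSpace A] in
theorem contDiff_rayCoeff {κ : E → E →L[ℝ] A} (hκ : ContDiff ℝ ∞ κ) :
    ContDiff ℝ ∞ (rayCoeff κ hκ.continuous) :=
  ((ContinuousLinearMap.contDiff _).comp (contDiff_rayMap hκ)).clm_apply contDiff_id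

/-- The solution of the parallel transport equation along the segment from `0` to `x`. -/
def raySolution (κ : E → E →L[ℝ] A) (hκ : Continuous κ) (x : E) : C(I, A) :=
  Ring.inverse (odeOperator (rayCoeff κ hκ x)) 1

omit [CompleteSpace A] in
theorem odeOperator_raySolution {κ : E → E →L[ℝ] A} (hκ : Continuous κ) {x : E}
    (h : IsUnit (odeOperator (rayCoeff κ hκ x))) :
    odeOperator (rayCoeff κ hκ x) (raySolution κ hκ x) = 1 :=
  congrArg (fun T : C(I, A) →L[ℝ] C(I, A) ↦ T 1) (Ring.mul_inverse_cancel _ h)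

omit [CompleteSpace A] in
theorem eq_raySolution {κ : E → E →L[ℝ] A} (hκ : Continuous κ) {x : E}
    (h : IsUnit (odeOperator (rayCoeff κ hκ x))) {y : C(I, A)}
    (hy : odeOperator (rayCoeff κ hκ x) y = 1) : y = raySolution κ hκ x := by
  rw [raySolution, ← hy]
  exact (congrArg (fun T : C(I, A) →L[ℝ] C(I, A) ↦ T y) (Ring.inverse_mul_cancel _ h)).symm

-- Since the coefficient `κ(sx)x` scales with `x`, the path `s ↦ y(ts)` solves the equation
-- belonging to `t • x`; uniqueness of solutions does the rest.
omit [CompleteSpace A] in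
theorem raySolution_smul {κ : E → E →L[ℝ] A} (hκ : Continuous κ) {x : E} (t : I)
    (h : IsUnit (odeOperator (rayCoeff κ hκ x)))
    (ht : IsUnit (odeOperator (rayCoeff κ hκ ((t : ℝ) • x)))) :
    raySolution κ hκ ((t : ℝ) • x) 1 = raySolution κ hκ x t := by
  set y := raySolution κ hκ x with hy
  have key : odeOperator (rayCoeff κ hκ ((t : ℝ) • x))
      (y.comp ⟨fun s ↦ t * s, by fun_prop⟩) = 1 := by
    ext s
    rw [odeOperator_apply]
    have h1 := congrArg (fun z : C(I, A) ↦ z (t * s)) (odeOperator_raySolution hκ h)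
    simp only [odeOperator_apply] at h1
    rw [← hy] at h1
    rw [ContinuousMap.one_apply] at h1 ⊢
    rw [← h1, ContinuousMap.comp_apply]
    congr 1
    have h2 := intervalIntegral.smul_integral_comp_mul_left (a := (0 : ℝ)) (b := s)
      (pathExtend (rayCoeff κ hκ x * y)) (t : ℝ)
    rw [mul_zero] at h2
    rw [Set.Icc.coe_mul, ← h2, ← intervalIntegral.integral_smul]
    refine intervalIntegral.integral_congr fun s₁ hs₁ ↦ ?_
    rw [Set.uIcc_of_le s.2.1] at hs₁
    have hs₁' : s₁ ∈ Set.Icc (0 : ℝ) 1 := ⟨hs₁.1, hs₁.2.trans s.2.2⟩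
    have hts₁ : (t : ℝ) * s₁ ∈ Set.Icc (0 : ℝ) 1 := unitInterval.mul_mem t.2 hs₁'
    simp only [pathExtend, Set.projIcc_of_mem _ hs₁', Set.projIcc_of_mem _ hts₁,
      ContinuousMap.mul_apply, rayCoeff_apply, ContinuousMap.comp_apply, ContinuousMap.coe_mk,
      map_smul, smul_mul_assoc, smul_smul]
    rw [mul_comm s₁]
    rfl
  rw [← eq_raySolution hκ ht key, ContinuousMap.comp_apply]
  simp

/-- Written as an integral equation, transport along the ray to `x` is inversion of an operator that
depends smoothly on `x` and equals `1` at `x = 0`. Smooth dependence on the endpoint thus follows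
from openness of the units and smoothness of inversion; `g x` is the solution at time one. -/
theorem exists_radial_gauge_of_contDiff {κ : E → E →L[ℝ] A} (hκ : ContDiff ℝ ∞ κ) :
    ∃ g : E → A, ∃ r > 0, ContDiffOn ℝ ∞ g (Metric.ball 0 r) ∧ g 0 = 1 ∧
      ∀ x ∈ Metric.ball (0 : E) r, fderiv ℝ g x x = - (κ x x * g x) := by
  set L : E → C(I, A) →L[ℝ] C(I, A) := fun x ↦ odeOperator (rayCoeff κ hκ.continuous x) with hL
  have hLs : ContDiff ℝ ∞ L := contDiff_odeOperator.comp (contDiff_rayCoeff hκ)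
  have hcoeff0 : rayCoeff κ hκ.continuous 0 = 0 := by
    ext s
    simp [rayCoeff_apply]
  have hL0 : L 0 = 1 := by
    simp [hL, odeOperator, hcoeff0]
  have hopen : L ⁻¹' {T | IsUnit T} ∈ nhds 0 :=
    hLs.continuous.continuousAt.preimage_mem_nhds
      (Units.isOpen.mem_nhds (x := L 0) (by rw [Set.mem_ofPred_eq, hL0]; exact isUnit_one))
  obtain ⟨r, hr, hball⟩ := Metric.mem_nhds_iff.mp hopen
  have hunit : ∀ x ∈ Metric.ball (0 : E) r, IsUnit (L x) := fun x hx ↦ hball hx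
  have hsmooth : ContDiffOn ℝ ∞ (fun x ↦ raySolution κ hκ.continuous x 1)
      (Metric.ball 0 r) := by
    intro x hx
    apply ContDiffAt.contDiffWithinAt
    obtain ⟨u, hu⟩ := hunit x hx
    have h1 : ContDiffAt ℝ ∞ (fun x ↦ Ring.inverse (L x)) x := by
      have := contDiffAt_ringInverse ℝ (R := C(I, A) →L[ℝ] C(I, A)) u (n := ∞)
      rw [hu] at this
      exact this.comp x hLs.contDiffAt
    have h2 : ContDiffAt ℝ ∞ (raySolution κ hκ.continuous) x := h1.clm_apply contDiffAt_const
    exact (ContinuousMap.evalCLM ℝ (1 : I)).contDiff.contDiffAt.comp x h2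
  refine ⟨fun x ↦ raySolution κ hκ.continuous x 1, r, hr, hsmooth, ?_, ?_⟩
  · have h0 : IsUnit (L 0) := hunit 0 (Metric.mem_ball_self hr)
    have : (1 : C(I, A)) = raySolution κ hκ.continuous 0 :=
      eq_raySolution hκ.continuous h0 (by
        change L 0 1 = 1
        rw [hL0]; rfl)
    change raySolution κ hκ.continuous 0 1 = 1
    rw [← this]
    rfl
  · intro x hx
    have hdiff : DifferentiableAt ℝ (fun x ↦ raySolution κ hκ.continuous x 1) x :=
      ((hsmooth x hx).contDiffAt (Metric.isOpen_ball.mem_nhds hx)).differentiableAt (by simp)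
    have h1 : HasDerivAt (fun t : ℝ ↦ raySolution κ hκ.continuous (t • x) 1)
        (fderiv ℝ (fun x ↦ raySolution κ hκ.continuous x 1) x x) 1 := by
      have hline : HasDerivAt (fun t : ℝ ↦ t • x) x 1 := by
        simpa using (hasDerivAt_id (1 : ℝ)).smul_const x
      have hd' : HasFDerivAt (fun x ↦ raySolution κ hκ.continuous x 1)
          (fderiv ℝ (fun x ↦ raySolution κ hκ.continuous x 1) x) ((1 : ℝ) • x) := by
        rw [one_smul]; exact hdiff.hasFDerivAt
      exact hd'.comp_hasDerivAt (1 : ℝ) hline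
    set z := rayCoeff κ hκ.continuous x * raySolution κ hκ.continuous x with hz
    have h2 : HasDerivAt (fun t : ℝ ↦ (1 : A) - ∫ s in (0 : ℝ)..t, pathExtend z s)
        (- pathExtend z 1) 1 := by
      have := (continuous_pathExtend z).integral_hasStrictDerivAt 0 1
      simpa using this.hasDerivAt.const_sub (1 : A)
    have heq : ∀ t ∈ Set.Icc (0 : ℝ) 1, raySolution κ hκ.continuous (t • x) 1 =
        (1 : A) - ∫ s in (0 : ℝ)..t, pathExtend z s := by
      intro t ht
      have htx : t • x ∈ Metric.ball (0 : E) r := by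
        rw [mem_ball_zero_iff] at hx ⊢
        rw [norm_smul, Real.norm_of_nonneg ht.1]
        exact (mul_le_of_le_one_left (norm_nonneg x) ht.2).trans_lt hx
      rw [raySolution_smul hκ.continuous ⟨t, ht⟩ (hunit x hx) (hunit _ htx), eq_sub_iff_add_eq]
      exact congrArg (fun w : C(I, A) ↦ w ⟨t, ht⟩)
        (odeOperator_raySolution hκ.continuous (hunit x hx))
    -- The integral formula holds for `t` in `[0, 1]` only. At the endpoint `1` the one-sided
    -- derivative suffices, since `h1` already supplies a two-sided one.
    have h3 : HasDerivWithinAt (fun t : ℝ ↦ raySolution κ hκ.continuous (t • x) 1)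
        (- pathExtend z 1) (Set.Icc 0 1) 1 :=
      h2.hasDerivWithinAt.congr heq (heq 1 (by simp))
    have h4 := UniqueDiffWithinAt.eq_deriv _ (uniqueDiffOn_Icc zero_lt_one 1 (by simp)) h1.hasDerivWithinAt h3
    rw [h4, pathExtend, Set.projIcc_right, hz, ContinuousMap.mul_apply, rayCoeff_apply]
    simp

/-- A one-form with values in a Banach algebra can be brought into radial gauge. -/
theorem exists_radial_gauge [FiniteDimensional ℝ E] {κ : E → E →L[ℝ] A} {O : Set E}
    (hO : IsOpen O) (hκ : ContDiffOn ℝ ∞ κ O) {x₀ : E} (hx₀ : x₀ ∈ O) :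
    ∃ g : E → A, ∃ r > 0, Metric.ball x₀ r ⊆ O ∧ ContDiffOn ℝ ∞ g (Metric.ball x₀ r) ∧
      g x₀ = 1 ∧ ∀ x ∈ Metric.ball x₀ r, IsUnit (g x) ∧
        fderiv ℝ g x (x - x₀) = - (κ x (x - x₀) * g x) := by
  obtain ⟨R, hR, hRO⟩ := Metric.isOpen_iff.mp hO x₀ hx₀
  -- The cutoff extends `κ` smoothly to the whole space without changing it within distance `R / 4`
  -- of `x₀`.
  let χ : ContDiffBump (0 : E) := ⟨R / 4, R / 2, by linarith, by linarith⟩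
  have hκ' : ContDiff ℝ ∞ (fun x ↦ χ x • κ (x₀ + x)) := by
    rw [contDiff_iff_contDiffAt]
    intro x
    by_cases hx : x ∈ Metric.ball (0 : E) R
    · have hmem : x₀ + x ∈ O := hRO (by simpa using hx)
      have h1 : ContDiffAt ℝ ∞ κ (x₀ + x) := hκ.contDiffAt (hO.mem_nhds hmem)
      exact χ.contDiff.contDiffAt.smul
        (h1.comp x (contDiff_const.add contDiff_id).contDiffAt)
    · have hx' : x ∉ tsupport χ := by
        rw [χ.tsupport_eq]
        intro h
        apply hx
        rw [mem_closedBall_zero_iff] at h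
        rw [mem_ball_zero_iff]
        exact h.trans_lt (by change R / 2 < R; linarith)
      have h0 : (fun x ↦ χ x • κ (x₀ + x)) =ᶠ[nhds x] fun _ ↦ 0 := by
        filter_upwards [(isClosed_tsupport χ).isOpen_compl.mem_nhds hx'] with y hy
        rw [image_eq_zero_of_notMem_tsupport hy]
        exact zero_smul ℝ (κ (x₀ + y))
      exact contDiffAt_const.congr_of_eventuallyEq h0
  obtain ⟨g, r, hr, hg, hg0, hg'⟩ := exists_radial_gauge_of_contDiff hκ'
  have hgc : ContinuousAt g 0 := (hg.contDiffAt (Metric.ball_mem_nhds _ hr)).continuousAt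
  have hun : g ⁻¹' {a | IsUnit a} ∈ nhds (0 : E) :=
    hgc.preimage_mem_nhds (Units.isOpen.mem_nhds (by
      rw [Set.mem_ofPred_eq, hg0]; exact isUnit_one))
  obtain ⟨r', hr', hunit⟩ := Metric.mem_nhds_iff.mp hun
  set ρ := min (min r r') (R / 4) with hρ
  have hρ0 : 0 < ρ := by positivity
  have hsub : ∀ x ∈ Metric.ball x₀ ρ, x - x₀ ∈ Metric.ball (0 : E) ρ := fun x hx ↦ by
    rwa [mem_ball_zero_iff, ← dist_eq_norm]
  have l1 : ρ ≤ r := (min_le_left _ _).trans (min_le_left _ _)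
  have l2 : ρ ≤ r' := (min_le_left _ _).trans (min_le_right _ _)
  have l3 : ρ ≤ R / 4 := min_le_right _ _
  refine ⟨fun x ↦ g (x - x₀), ρ, hρ0, (Metric.ball_subset_ball (by linarith)).trans hRO, ?_, ?_, ?_⟩
  · exact hg.comp (contDiff_id.sub contDiff_const).contDiffOn
      fun x hx ↦ Metric.ball_subset_ball l1 (hsub x hx)
  · simpa using hg0
  · intro x hx
    refine ⟨hunit (Metric.ball_subset_ball l2 (hsub x hx)), ?_⟩
    rw [fderiv_comp_sub, hg' _ (Metric.ball_subset_ball l1 (hsub x hx)),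
      χ.one_of_mem_closedBall (Metric.ball_subset_closedBall
        (Metric.ball_subset_ball l3 (hsub x hx)))]
    simp

end Volterra

end RadialGauge

end SkewTorsion

namespace SkewTorsion

theorem two_le_infty : (2 : WithTop ℕ∞) ≤ ∞ :=
  WithTop.coe_le_coe.mpr (le_top : (2 : ℕ∞) ≤ ⊤)

/-! ### Flat connection forms are locally pure gauge -/

section FlatGauge

universe u

variable {E : Type u} [NormedAddCommGroup E] [NormedSpace ℝ E] [FiniteDimensional ℝ E]
  {A : Type u} [NormedRing A] [NormedAlgebra ℝ A] [CompleteSpace A]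

/-- A flat one-form with values in a Banach algebra is locally pure gauge. -/
theorem exists_flat_gauge {κ : E → E →L[ℝ] A} {O : Set E} (hO : IsOpen O)
    (hκ : ContDiffOn ℝ ∞ κ O)
    (hflat : ∀ x ∈ O, ∀ u v, fderiv ℝ κ x u v - fderiv ℝ κ x v u
      + κ x u * κ x v - κ x v * κ x u = 0) {x₀ : E} (hx₀ : x₀ ∈ O) :
    ∃ g : E → A, ∃ r > 0, Metric.ball x₀ r ⊆ O ∧ ContDiffOn ℝ ∞ g (Metric.ball x₀ r) ∧
      g x₀ = 1 ∧ ∀ x ∈ Metric.ball x₀ r, ∀ v, fderiv ℝ g x v = - (κ x v * g x) := by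
  obtain ⟨g, r, hr, hrO, hg, hg0, hg'⟩ := exists_radial_gauge hO hκ hx₀
  refine ⟨g, r, hr, hrO, hg, hg0, fun x hx v ↦ ?_⟩
  have hgs : ∀ z ∈ Metric.ball x₀ r, ContDiffAt ℝ ∞ g z := fun z hz ↦
    hg.contDiffAt (Metric.isOpen_ball.mem_nhds hz)
  have hκs : ∀ z ∈ Metric.ball x₀ r, ContDiffAt ℝ ∞ κ z := fun z hz ↦
    hκ.contDiffAt (hO.mem_nhds (hrO hz))
  have dg : ∀ z ∈ Metric.ball x₀ r, HasFDerivAt g (fderiv ℝ g z) z := fun z hz ↦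
    ((hgs z hz).differentiableAt (by simp)).hasFDerivAt
  have ddg : ∀ z ∈ Metric.ball x₀ r, HasFDerivAt (fderiv ℝ g) (fderiv ℝ (fderiv ℝ g) z) z :=
    fun z hz ↦ (((hgs z hz).fderiv_right (m := ∞) (by simp)).differentiableAt (by simp)).hasFDerivAt
  have dκ : ∀ z ∈ Metric.ball x₀ r, HasFDerivAt κ (fderiv ℝ κ z) z := fun z hz ↦
    ((hκs z hz).differentiableAt (by simp)).hasFDerivAt
  have hsymm : ∀ z ∈ Metric.ball x₀ r, ∀ u w,
      fderiv ℝ (fderiv ℝ g) z u w = fderiv ℝ (fderiv ℝ g) z w u := fun z hz u w ↦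
    (hgs z hz).isSymmSndFDerivAt (by
      rw [minSmoothness_of_isRCLikeNormedField]; exact two_le_infty) u w
  -- This is the derivative of the radial gauge equation in an arbitrary direction `w`.
  have hrad : ∀ z ∈ Metric.ball x₀ r, ∀ w,
      fderiv ℝ (fderiv ℝ g) z w (z - x₀) + fderiv ℝ g z w +
        ((fderiv ℝ κ z w (z - x₀) + κ z w) * g z + κ z (z - x₀) * fderiv ℝ g z w) = 0 := by
    intro z hz w
    have hid : HasFDerivAt (fun y : E ↦ y - x₀) (ContinuousLinearMap.id ℝ E) z :=
      (hasFDerivAt_id z).sub_const x₀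
    have h1 := ((ddg z hz).clm_apply hid).add (((dκ z hz).clm_apply hid).mul' (dg z hz))
    have h0 : HasFDerivAt (fun y ↦ fderiv ℝ g y (y - x₀) + κ y (y - x₀) * g y)
        (0 : E →L[ℝ] A) z := by
      refine (hasFDerivAt_const (0 : A) z).congr_of_eventuallyEq ?_
      filter_upwards [Metric.isOpen_ball.mem_nhds hz] with y hy
      rw [(hg' y hy).2, neg_add_cancel]
    have h2 := congrArg (fun T : E →L[ℝ] A ↦ T w) (h1.unique h0)
    simp only [add_apply, ContinuousLinearMap.comp_apply, ContinuousLinearMap.id_apply,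
      ContinuousLinearMap.flip_apply, smul_apply, zero_apply, smul_eq_mul,
      MulOpposite.smul_eq_mul_unop, MulOpposite.unop_op] at h2
    rw [← h2, add_mul, add_mul]
    abel
  set γ : ℝ → E := fun t ↦ x₀ + t • (x - x₀) with hγ
  have hγb : ∀ t ∈ Set.Icc (0 : ℝ) 1, γ t ∈ Metric.ball x₀ r := fun t ht ↦ by
    rw [Metric.mem_ball, dist_eq_norm] at hx ⊢
    rw [hγ, add_sub_cancel_left, norm_smul, Real.norm_of_nonneg ht.1]
    exact (mul_le_of_le_one_left (norm_nonneg _) ht.2).trans_lt hx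
  have hγd : ∀ t, HasDerivAt γ (x - x₀) t := fun t ↦ by
    have h := ((hasDerivAt_id t).smul_const (x - x₀)).const_add x₀
    rwa [one_smul] at h
  -- The defect of the gauge equation in direction `v`, scaled by `t`. By flatness and `hrad` it
  -- solves a homogeneous linear equation along the ray, and the factor `t`, which is the length of
  -- `γ t - x₀` relative to `x - x₀`, gives the initial value zero.
  set f : ℝ → A := fun t ↦ t • (fderiv ℝ g (γ t) v + κ (γ t) v * g (γ t)) with hf
  have hfd : ∀ t ∈ Set.Icc (0 : ℝ) 1, HasDerivAt f (- (κ (γ t) (x - x₀) * f t)) t := by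
    intro t ht
    have hz := hγb t ht
    have h1 := (ddg _ hz).comp_hasDerivAt t (hγd t)
    have h2 := (dκ _ hz).comp_hasDerivAt t (hγd t)
    have h3 := (dg _ hz).comp_hasDerivAt t (hγd t)
    have h4 := (hasDerivAt_id t).smul ((h1.clm_apply (hasDerivAt_const t v)).add
      ((h2.clm_apply (hasDerivAt_const t v)).mul h3))
    refine h4.congr_deriv ?_
    have hu : γ t - x₀ = t • (x - x₀) := by simp [hγ]
    have e1 := hrad _ hz v
    have e2 := (hg' _ hz).2
    have e3 := hflat _ (hrO hz) (γ t - x₀) v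
    rw [hsymm _ hz v] at e1
    rw [hu] at e1 e2 e3
    simp only [map_smul, smul_apply, smul_mul_assoc, mul_smul_comm] at e1 e2 e3
    simp only [id_eq, map_zero, add_zero, Function.comp_apply, one_smul, Pi.add_apply, Pi.mul_apply, smul_add,
      ← mul_smul_comm, hf]
    simp only [mul_smul_comm]
    generalize fderiv ℝ (fderiv ℝ g) (γ t) (x - x₀) v = S at *
    generalize fderiv ℝ g (γ t) v = gv at *
    generalize fderiv ℝ g (γ t) (x - x₀) = gu at *
    generalize fderiv ℝ κ (γ t) (x - x₀) v = kuv at *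
    generalize fderiv ℝ κ (γ t) v (x - x₀) = kvu at *
    generalize κ (γ t) (x - x₀) = ku at *
    generalize κ (γ t) v = kv at *
    generalize g (γ t) = G at *
    have e3' := congrArg (fun a ↦ a * G) e3
    have e2' := congrArg (fun a ↦ kv * a) e2
    simp only [sub_mul, add_mul, mul_add, zero_mul, smul_mul_assoc, mul_smul_comm, mul_assoc,
      mul_neg] at e1 e2' e3' ⊢
    linear_combination (norm := module) e1 + e3' + e2'
  have hcont : ContinuousOn f (Set.Icc 0 1) := fun t ht ↦ (hfd t ht).continuousAt.continuousWithinAt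
  have hκc : ContinuousOn (fun t ↦ κ (γ t) (x - x₀)) (Set.Icc 0 1) := fun t ht ↦
    ((((dκ _ (hγb t ht)).comp_hasDerivAt t (hγd t)).clm_apply
      (hasDerivAt_const t (x - x₀))).continuousAt).continuousWithinAt
  obtain ⟨C, hC⟩ := isCompact_Icc.exists_bound_of_continuousOn hκc
  -- Grönwall: a homogeneous linear equation with zero initial value.
  have hzero := eq_zero_of_abs_deriv_le_mul_abs_self_of_eq_zero_right (K := C) hcont
    (fun t ht ↦ (hfd t (Set.Ico_subset_Icc_self ht)).hasDerivWithinAt) (by simp [hf])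
    (fun t ht ↦ by
      rw [norm_neg]
      exact (norm_mul_le _ _).trans (by
        gcongr
        exact hC t (Set.Ico_subset_Icc_self ht))) 1 (by simp)
  have h1 : γ 1 = x := by simp [hγ]
  simp only [hf, h1, one_smul] at hzero
  exact eq_neg_of_add_eq_zero_left hzero

end FlatGauge

end SkewTorsion

namespace SkewTorsion

/-! ### Oriented orthonormal frames of associative 3-planes -/

section AssociativeFrame

variable {F : Type*} [NormedAddCommGroup F] [InnerProductSpace ℝ F]

/-- An orthonormal frame of an associative subspace that is positively oriented. -/
structure IsAssociativeFrame (B : F →L[ℝ] F →L[ℝ] F) (s : Fin 3 → F) : Prop where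
  orthonormal : Orthonormal ℝ s
  cross : ∀ i, B (s i) (s (i + 1)) = s (i + 2)

/-- The curvature one-form acting on an associative frame. -/
def frameRotation (s : Fin 3 → F) (i : Fin 3) (v : F) : F :=
  inner ℝ (s (i + 2)) v • s (i + 1) - inner ℝ (s (i + 1)) v • s (i + 2)

namespace IsAssociativeFrame

variable {B : F →L[ℝ] F →L[ℝ] F} {s : Fin 3 → F} (hs : IsAssociativeFrame B s)

include hs

theorem inner_eq (i j : Fin 3) : inner ℝ (s i) (s j) = if i = j then (1 : ℝ) else 0 :=
  orthonormal_iff_ite.mp hs.orthonormal i j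

theorem cross_two (hB : IsCrossProduct B) (i : Fin 3) : B (s i) (s (i + 2)) = - s (i + 1) := by
  have h := hs.cross (i + 2)
  rw [show i + 2 + 1 = i by omega, show i + 2 + 2 = i + 1 by omega] at h
  rw [hB.anti, h]

/-- Identifies `frameRotation` with `π(v) × sᵢ`, for `π` the orthogonal projection to the span of
the frame. The explicit form can be differentiated without mentioning `π`. -/
theorem sum_cross (hB : IsCrossProduct B) (i : Fin 3) (v : F) :
    B (∑ j, inner ℝ (s j) v • s j) (s i) = frameRotation s i v := by
  have h : ∑ j, inner ℝ (s j) v • s j = inner ℝ (s i) v • s i +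
      inner ℝ (s (i + 1)) v • s (i + 1) + inner ℝ (s (i + 2)) v • s (i + 2) := by
    rw [Fin.sum_univ_three]
    fin_cases i
    · rfl
    · change _ = inner ℝ (s 1) v • s 1 + inner ℝ (s 2) v • s 2 + inner ℝ (s 0) v • s 0
      abel
    · change _ = inner ℝ (s 2) v • s 2 + inner ℝ (s 0) v • s 0 + inner ℝ (s 1) v • s 1
      abel
  rw [h, hB.anti, map_add, map_add, map_smul, map_smul, map_smul, hB.self, hs.cross,
    hs.cross_two hB, frameRotation]
  module

end IsAssociativeFrame

/-- Taking the third vector to be the product of the first two fixes the orientation; the remaining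
products follow from `cross_cross_self`. -/
theorem exists_associativeFrame {B : F →L[ℝ] F →L[ℝ] F} (hB : IsCrossProduct B)
    {V : Submodule ℝ F} [FiniteDimensional ℝ V] (h3 : Module.finrank ℝ V = 3)
    (hV : ∀ a ∈ V, ∀ b ∈ V, B a b ∈ V) :
    ∃ s : Fin 3 → F, IsAssociativeFrame B s ∧ ∀ i, s i ∈ V := by
  let b := (stdOrthonormalBasis ℝ V).reindex (finCongr h3)
  set u : F := ((b 0 : V) : F) with hu
  set v : F := ((b 1 : V) : F) with hv
  have huu : inner ℝ u u = (1 : ℝ) := by rw [hu, inner_coe_basis]; simp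
  have hvv : inner ℝ v v = (1 : ℝ) := by rw [hv, inner_coe_basis]; simp
  have huv : inner ℝ u v = (0 : ℝ) := by rw [hu, hv, inner_coe_basis]; simp
  have hvu : inner ℝ v u = (0 : ℝ) := by rw [real_inner_comm, huv]
  have hww : inner ℝ (B u v) (B u v) = (1 : ℝ) := by
    rw [hB.inner_cross_cross, huu, hvv, huv]; norm_num
  have hwu := hB.inner_left u v
  have hwv := hB.inner_right u v
  have huw : inner ℝ u (B u v) = 0 := by rw [real_inner_comm, hwu]
  have hvw : inner ℝ v (B u v) = 0 := by rw [real_inner_comm, hwv]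
  refine ⟨![u, v, B u v], ⟨?_, ?_⟩, ?_⟩
  · rw [orthonormal_iff_ite]
    intro i j
    fin_cases i <;> fin_cases j <;> simp [huv, hvu, hwu, hwv, huw, hvw, -inner_self_eq_norm_sq_to_K] <;> assumption
  · intro i
    fin_cases i
    · rfl
    · change B v (B u v) = u
      rw [hB.anti u v, map_neg, hB.cross_cross_self, hvv, hvu]
      module
    · change B (B u v) u = v
      rw [hB.anti, hB.cross_cross_self, huu, huv]
      module
  · intro i
    fin_cases i
    · exact (b 0).2
    · exact (b 1).2
    · exact hV _ (b 0).2 _ (b 1).2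

theorem span_eq_of_orthonormal {V : Submodule ℝ F} [FiniteDimensional ℝ V]
    (h3 : Module.finrank ℝ V = 3) {s : Fin 3 → F} (hs : Orthonormal ℝ s) (hsV : ∀ i, s i ∈ V) :
    Submodule.span ℝ (Set.range s) = V := by
  refine Submodule.eq_of_le_of_finrank_eq (Submodule.span_le.mpr ?_) ?_
  · rintro _ ⟨i, rfl⟩
    exact hsV i
  · rw [finrank_span_eq_card hs.linearIndependent, h3, Fintype.card_fin]

theorem eq_sum_of_mem_span {s : Fin 3 → F} (hs : Orthonormal ℝ s) {x : F}
    (hx : x ∈ Submodule.span ℝ (Set.range s)) : x = ∑ i, inner ℝ (s i) x • s i := by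
  obtain ⟨c, rfl⟩ := (Submodule.mem_span_range_iff_exists_fun ℝ).mp hx
  refine Finset.sum_congr rfl fun i _ ↦ ?_
  rw [hs.inner_right_fintype]

theorem starProjection_eq_sum {V : Submodule ℝ F} [FiniteDimensional ℝ V]
    (h3 : Module.finrank ℝ V = 3) {s : Fin 3 → F} (hs : Orthonormal ℝ s) (hsV : ∀ i, s i ∈ V)
    (x : F) : V.starProjection x = ∑ i, inner ℝ (s i) x • s i := by
  refine (eq_sum_of_mem_span hs (by
    rw [span_eq_of_orthonormal h3 hs hsV]; exact V.starProjection_apply_mem x)).trans ?_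
  refine Finset.sum_congr rfl fun i _ ↦ ?_
  rw [← Submodule.inner_starProjection_left_eq_right,
    Submodule.starProjection_eq_self_iff.mpr (hsV i)]

/-- The Jacobi identity on an associative subspace. -/
theorem cross_cross_of_associative {B : F →L[ℝ] F →L[ℝ] F} (hB : IsCrossProduct B)
    {V : Submodule ℝ F} [FiniteDimensional ℝ V] (h3 : Module.finrank ℝ V = 3)
    (hV : ∀ a ∈ V, ∀ b ∈ V, B a b ∈ V) {a b d : F} (ha : a ∈ V) (hb : b ∈ V) (hd : d ∈ V) :
    B a (B b d) = inner ℝ a d • b - inner ℝ a b • d := by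
  obtain ⟨s, hs, hsV⟩ := exists_associativeFrame hB h3 hV
  have hsp := span_eq_of_orthonormal h3 hs.orthonormal hsV
  have ex : ∀ x ∈ V, ∃ x₀ x₁ x₂ : ℝ, x = x₀ • s 0 + x₁ • s 1 + x₂ • s 2 := fun x hx ↦ by
    rw [← hsp] at hx
    have h := eq_sum_of_mem_span hs.orthonormal hx
    rw [Fin.sum_univ_three] at h
    exact ⟨_, _, _, h⟩
  obtain ⟨a₀, a₁, a₂, rfl⟩ := ex a ha
  obtain ⟨b₀, b₁, b₂, rfl⟩ := ex b hb
  obtain ⟨d₀, d₁, d₂, rfl⟩ := ex d hd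
  have c01 : B (s 0) (s 1) = s 2 := hs.cross 0
  have c12 : B (s 1) (s 2) = s 0 := hs.cross 1
  have c20 : B (s 2) (s 0) = s 1 := hs.cross 2
  have c10 : B (s 1) (s 0) = - s 2 := by rw [hB.anti, c01]
  have c21 : B (s 2) (s 1) = - s 0 := by rw [hB.anti, c12]
  have c02 : B (s 0) (s 2) = - s 1 := by rw [hB.anti, c20]
  simp only [map_add, map_smul, add_apply, smul_apply, hB.self, c01, c12, c20, c10, c21, c02,
    map_neg, smul_zero, map_zero, inner_add_left, inner_add_right, inner_smul_left,
    inner_smul_right, hs.inner_eq]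
  simp
  module

end AssociativeFrame

/-! ### Cartan's structure equations and the Bianchi identity -/

section CartanGauge

set_option synthInstance.maxHeartbeats 200000

universe u

variable {E : Type u} [NormedAddCommGroup E] [NormedSpace ℝ E]
  {F : Type u} [NormedAddCommGroup F] [InnerProductSpace ℝ F]

/-- Otherwise a linear functional vanishing on `S` would separate the derivative from `S`, although
its composition with `f` vanishes near `x`. -/
theorem fderiv_mem_submodule {G : Type*} [NormedAddCommGroup G] [NormedSpace ℝ G]
    [FiniteDimensional ℝ G] (S : Submodule ℝ G) {f : E → G} {x : E}
    (hf : DifferentiableAt ℝ f x) (h : ∀ᶠ y in nhds x, f y ∈ S) (w : E) : fderiv ℝ f x w ∈ S := by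
  by_contra hw
  obtain ⟨l, hl, hS⟩ := Submodule.exists_le_ker_of_notMem hw
  have h1 := (LinearMap.toContinuousLinearMap l).hasFDerivAt.comp x hf.hasFDerivAt
  have h2 : HasFDerivAt (LinearMap.toContinuousLinearMap l ∘ f) (0 : E →L[ℝ] ℝ) x := by
    refine (hasFDerivAt_const (0 : ℝ) x).congr_of_eventuallyEq ?_
    filter_upwards [h] with y hy
    exact hS hy
  exact hl (congrArg (fun T : E →L[ℝ] ℝ ↦ T w) (h1.unique h2))

/-- A solution of Cartan's structure equations for the connection with parallel skew torsion
`2 c B`: the soldering form `θ`, whose inverse is the frame `K`, and the connection form `κ`. -/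
structure IsCartanGauge (B : F →L[ℝ] F →L[ℝ] F) (c : ℝ) (U : Set E) (K : E → F →L[ℝ] E)
    (θ : E → E →L[ℝ] F) (κ : E → E →L[ℝ] F →L[ℝ] F) : Prop where
  isOpen : IsOpen U
  smooth_solder : ContDiffOn ℝ ∞ θ U
  smooth_conn : ContDiffOn ℝ ∞ κ U
  solder_frame : ∀ x ∈ U, ∀ a, θ x (K x a) = a
  frame_solder : ∀ x ∈ U, ∀ v, K x (θ x v) = v
  skewDer : ∀ x ∈ U, ∀ v, IsSkewDerivation B (κ x v)
  torsion : ∀ x ∈ U, ∀ u v, fderiv ℝ θ x u v - fderiv ℝ θ x v u + κ x u (θ x v) - κ x v (θ x u) =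
    (2 * c) • B (θ x u) (θ x v)

/-- The curvature two-form `dκ + κ ∧ κ`. -/
def curvatureForm (κ : E → E →L[ℝ] F →L[ℝ] F) (x : E) : E →L[ℝ] E →L[ℝ] F →L[ℝ] F :=
  fderiv ℝ κ x - (fderiv ℝ κ x).flip +
    (ContinuousLinearMap.compL ℝ F F F).bilinearComp (κ x) (κ x) -
    ((ContinuousLinearMap.compL ℝ F F F).bilinearComp (κ x) (κ x)).flip

theorem curvatureForm_apply (κ : E → E →L[ℝ] F →L[ℝ] F) (x u v : E) (a : F) :
    curvatureForm κ x u v a = fderiv ℝ κ x u v a - fderiv ℝ κ x v u a +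
      κ x u (κ x v a) - κ x v (κ x u a) := rfl

/-- The skew derivations form a linear subspace. -/
def skewDerivations (B : F →L[ℝ] F →L[ℝ] F) : Submodule ℝ (F →L[ℝ] F) where
  carrier := {N | IsSkewDerivation B N}
  add_mem' hM hN := ⟨fun a b ↦ by
      simp only [add_apply, inner_add_left, inner_add_right, hM.skew a b, hN.skew a b]; ring,
    fun a b ↦ by simp only [add_apply, map_add, hM.leibniz a b, hN.leibniz a b]; abel⟩
  zero_mem' := ⟨fun a b ↦ by simp, fun a b ↦ by simp⟩
  smul_mem' r N hN := ⟨fun a b ↦ by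
      simp only [smul_apply, inner_smul_left, inner_smul_right, hN.skew a b]; simp,
    fun a b ↦ by simp only [smul_apply, map_smul, hN.leibniz a b, smul_add]⟩

theorem IsSkewDerivation.commutator {B : F →L[ℝ] F →L[ℝ] F} {M N : F →L[ℝ] F}
    (hM : IsSkewDerivation B M) (hN : IsSkewDerivation B N) :
    IsSkewDerivation B (M ∘L N - N ∘L M) where
  skew a b := by
    simp only [sub_apply, ContinuousLinearMap.comp_apply, inner_sub_left, inner_sub_right,
      hM.skew, hN.skew]
    ring
  leibniz a b := by
    simp only [sub_apply, ContinuousLinearMap.comp_apply, hM.leibniz, hN.leibniz, map_add, map_sub]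
    abel

namespace IsCartanGauge

variable {B : F →L[ℝ] F →L[ℝ] F} {c : ℝ} {U : Set E} {K : E → F →L[ℝ] E}
  {θ : E → E →L[ℝ] F} {κ : E → E →L[ℝ] F →L[ℝ] F} (h : IsCartanGauge B c U K θ κ)

include h

theorem hasFDerivAt_conn {x : E} (hx : x ∈ U) : HasFDerivAt κ (fderiv ℝ κ x) x :=
  ((h.smooth_conn.contDiffAt (h.isOpen.mem_nhds hx)).differentiableAt (by simp)).hasFDerivAt

theorem hasFDerivAt_solder {x : E} (hx : x ∈ U) : HasFDerivAt θ (fderiv ℝ θ x) x :=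
  ((h.smooth_solder.contDiffAt (h.isOpen.mem_nhds hx)).differentiableAt (by simp)).hasFDerivAt

variable [FiniteDimensional ℝ F]

/-- If the connection form takes values in a linear subspace, so does its derivative. -/
theorem fderiv_conn_mem (S : Submodule ℝ (F →L[ℝ] F)) (hS : ∀ x ∈ U, ∀ v, κ x v ∈ S)
    {x : E} (hx : x ∈ U) (u v : E) : fderiv ℝ κ x u v ∈ S := by
  have h1 : HasFDerivAt (fun y ↦ κ y v) ((fderiv ℝ κ x).flip v) x := by
    have := (h.hasFDerivAt_conn hx).clm_apply (hasFDerivAt_const v x)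
    exact this.congr_fderiv (by ext; simp)
  have h2 := fderiv_mem_submodule S h1.differentiableAt
    (Filter.mem_of_superset (h.isOpen.mem_nhds hx) fun y hy ↦ hS y hy v) u
  rwa [h1.fderiv] at h2

/-- The skew derivations form a Lie algebra, and the curvature is built from derivatives and
commutators of a form with values in it. -/
theorem curvature_skewDer {x : E} (hx : x ∈ U) (u v : E) :
    IsSkewDerivation B (curvatureForm κ x u v) := by
  have hd : ∀ u v, fderiv ℝ κ x u v ∈ skewDerivations B :=
    h.fderiv_conn_mem (skewDerivations B) h.skewDer hx
  have h1 : κ x u ∘L κ x v - κ x v ∘L κ x u ∈ skewDerivations B :=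
    (h.skewDer x hx u).commutator (h.skewDer x hx v)
  have h2 := (skewDerivations B).add_mem ((skewDerivations B).sub_mem (hd u v) (hd v u)) h1
  have e : curvatureForm κ x u v =
      fderiv ℝ κ x u v - fderiv ℝ κ x v u + (κ x u ∘L κ x v - κ x v ∘L κ x u) := by
    ext a
    simp only [curvatureForm_apply, add_apply, sub_apply, ContinuousLinearMap.comp_apply]
    abel
  rw [e]
  exact h2

omit [FiniteDimensional ℝ F] in
/-- The first Bianchi identity. -/
theorem bianchi (hB : IsCrossProduct B) {x : E} (hx : x ∈ U) (u v w : E) :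
    curvatureForm κ x u v (θ x w) + curvatureForm κ x v w (θ x u) + curvatureForm κ x w u (θ x v) =
      (4 * c ^ 2) • (B (B (θ x u) (θ x v)) (θ x w) + B (B (θ x v) (θ x w)) (θ x u) +
        B (B (θ x w) (θ x u)) (θ x v)) := by
  have dθ := h.hasFDerivAt_solder hx
  have dκ := h.hasFDerivAt_conn hx
  have hs := h.smooth_solder.contDiffAt (h.isOpen.mem_nhds hx)
  have ddθ : HasFDerivAt (fderiv ℝ θ) (fderiv ℝ (fderiv ℝ θ) x) x :=
    ((hs.fderiv_right (m := ∞) (by simp)).differentiableAt (by simp)).hasFDerivAt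
  have hsymm : ∀ u v, fderiv ℝ (fderiv ℝ θ) x u v = fderiv ℝ (fderiv ℝ θ) x v u :=
    hs.isSymmSndFDerivAt (by rw [minSmoothness_of_isRCLikeNormedField]; exact two_le_infty)
  -- The torsion equation differentiated in the direction `w`.
  have key : ∀ u v w, fderiv ℝ (fderiv ℝ θ) x w u v - fderiv ℝ (fderiv ℝ θ) x w v u +
      (fderiv ℝ κ x w u (θ x v) + κ x u (fderiv ℝ θ x w v)) -
      (fderiv ℝ κ x w v (θ x u) + κ x v (fderiv ℝ θ x w u)) =
      (2 * c) • (B (fderiv ℝ θ x w u) (θ x v) + B (θ x u) (fderiv ℝ θ x w v)) := by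
    intro u v w
    have cu := hasFDerivAt_const (𝕜 := ℝ) u x
    have cv := hasFDerivAt_const (𝕜 := ℝ) v x
    have h1 := ((((ddθ.clm_apply cu).clm_apply cv).sub ((ddθ.clm_apply cv).clm_apply cu)).add
      ((dκ.clm_apply cu).clm_apply (dθ.clm_apply cv))).sub
      ((dκ.clm_apply cv).clm_apply (dθ.clm_apply cu))
    have h2 := (((hasFDerivAt_const B x).clm_apply (dθ.clm_apply cu)).clm_apply
      (dθ.clm_apply cv)).const_smul (2 * c)
    have h3 := h1.congr_of_eventuallyEq (f₁ := fun y ↦ (2 * c) • B (θ y u) (θ y v)) (by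
      filter_upwards [h.isOpen.mem_nhds hx] with y hy
      exact (h.torsion y hy u v).symm)
    have h4 := congrArg (fun T : E →L[ℝ] F ↦ T w) (h3.unique h2)
    simp only [add_apply, sub_apply, smul_apply, ContinuousLinearMap.comp_apply,
      ContinuousLinearMap.flip_apply, zero_apply, map_zero, zero_add, add_zero] at h4
    rw [add_comm (κ x u _), add_comm (κ x v _), add_comm (B (θ x u) _)] at h4
    exact h4
  have t := h.torsion x hx
  have k1 := key u v w
  have k2 := key v w u
  have k3 := key w u v
  rw [hsymm w u, hsymm w v] at k1
  rw [hsymm u v] at k2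
  simp only [curvatureForm_apply]
  -- A second use of the torsion equation, inside the product. The two factors `2c` make the
  -- constant `4c²`.
  have tB : ∀ u v w, B (fderiv ℝ θ x u v) (θ x w) - B (fderiv ℝ θ x v u) (θ x w) +
      B (κ x u (θ x v)) (θ x w) - B (κ x v (θ x u)) (θ x w) =
      (2 * c) • B (B (θ x u) (θ x v)) (θ x w) := fun u v w ↦ by
    have e := congrArg (fun a ↦ B a (θ x w)) (t u v)
    simpa only [map_add, map_sub, map_smul, add_apply, sub_apply, smul_apply] using e
  have tκ : ∀ u v w, κ x w (fderiv ℝ θ x u v) - κ x w (fderiv ℝ θ x v u) +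
      κ x w (κ x u (θ x v)) - κ x w (κ x v (θ x u)) =
      (2 * c) • (B (κ x w (θ x u)) (θ x v) - B (κ x w (θ x v)) (θ x u)) := fun u v w ↦ by
    have e := congrArg (fun a ↦ κ x w a) (t u v)
    simp only [map_add, map_sub, map_smul, (h.skewDer x hx w).leibniz] at e
    rw [hB.anti (θ x u) (κ x w (θ x v)), ← sub_eq_add_neg] at e
    exact e
  rw [hB.anti (θ x u)] at k1
  rw [hB.anti (θ x v)] at k2
  rw [hB.anti (θ x w)] at k3
  -- In the cyclic sum the second derivatives of `θ` cancel by symmetry, and `tκ` moves the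
  -- connection form past the product by the derivation property.
  linear_combination (norm := module) k1 + k2 + k3 + tκ u v w + tκ v w u + tκ w u v +
    (2 * c) • tB u v w + (2 * c) • tB v w u + (2 * c) • tB w u v

end IsCartanGauge

end CartanGauge

end SkewTorsion

namespace SkewTorsion

/-! ### Uniqueness of the span of a flat frame -/

section CoordinateFrame

set_option synthInstance.maxHeartbeats 200000

universe u

variable {E : Type u} [NormedAddCommGroup E] [NormedSpace ℝ E]
  {F : Type u} [NormedAddCommGroup F] [InnerProductSpace ℝ F] [FiniteDimensional ℝ F]
  {B : F →L[ℝ] F →L[ℝ] F} {c : ℝ} {U : Set E} {K : E → F →L[ℝ] E}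
  {θ : E → E →L[ℝ] F} {κ : E → E →L[ℝ] F →L[ℝ] F}

omit [FiniteDimensional ℝ F] in
/-- The curvature tensor at the point `x` in terms of the frame `K`. -/
def curvatureTensor (K : E → F →L[ℝ] E) (κ : E → E →L[ℝ] F →L[ℝ] F) (x : E) :
    F →L[ℝ] F →L[ℝ] F →L[ℝ] F :=
  (curvatureForm κ x).bilinearComp (K x) (K x)

omit [FiniteDimensional ℝ F] in
theorem curvatureTensor_apply (K : E → F →L[ℝ] E) (κ : E → E →L[ℝ] F →L[ℝ] F) (x : E) (a b : F) :
    curvatureTensor K κ x a b = curvatureForm κ x (K x a) (K x b) := rfl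

/-- The frame `s` of sections is flat for the connection `∇_v ξ - 6 c π(v) × ξ`. -/
def IsFlatCoordFrameAt (c : ℝ) (θ : E → E →L[ℝ] F) (κ : E → E →L[ℝ] F →L[ℝ] F)
    (s : Fin 3 → E → F) (x : E) : Prop :=
  ∀ i v, fderiv ℝ (s i) x v + κ x v (s i x) = (6 * c) • frameRotation (fun j ↦ s j x) i (θ x v)

namespace IsCartanGauge

variable (h : IsCartanGauge B c U K θ κ)

include h

theorem isCurvatureTensor (hB : IsCrossProduct B) {x : E} (hx : x ∈ U) :
    IsCurvatureTensor B c (curvatureTensor K κ x) where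
  anti a b := by
    ext d
    simp only [curvatureTensor_apply, curvatureForm_apply, neg_apply]
    abel
  skewDer a b := h.curvature_skewDer hx _ _
  bianchi a b d := by
    have := h.bianchi hB hx (K x a) (K x b) (K x d)
    simp only [h.solder_frame x hx] at this
    exact this

omit [FiniteDimensional ℝ F] in
theorem curvatureForm_eq {x : E} (hx : x ∈ U) (u v : E) :
    curvatureForm κ x u v = curvatureTensor K κ x (θ x u) (θ x v) := by
  rw [curvatureTensor_apply, h.frame_solder x hx, h.frame_solder x hx]

theorem curvature_mem {V : Submodule ℝ F} (hV : ∀ x ∈ U, ∀ v, ∀ a ∈ V, κ x v a ∈ V)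
    {x : E} (hx : x ∈ U) (u v : E) {a : F} (ha : a ∈ V) : curvatureForm κ x u v a ∈ V := by
  let S : Submodule ℝ (F →L[ℝ] F) :=
    { carrier := {N | ∀ a ∈ V, N a ∈ V}
      add_mem' := fun hM hN a ha ↦ V.add_mem (hM a ha) (hN a ha)
      zero_mem' := fun a _ ↦ V.zero_mem
      smul_mem' := fun r N hN a ha ↦ V.smul_mem r (hN a ha) }
  have hd : ∀ u v, fderiv ℝ κ x u v ∈ S := h.fderiv_conn_mem S hV hx
  rw [curvatureForm_apply]
  exact V.sub_mem (V.add_mem (V.sub_mem (hd u v a ha) (hd v u a ha))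
    (hV x hx u _ (hV x hx v a ha))) (hV x hx v _ (hV x hx u a ha))

omit [FiniteDimensional ℝ F] in
/-- The span of a flat frame is invariant under the curvature. -/
theorem curvature_mem_span {s : Fin 3 → E → F} {x : E} (hx : x ∈ U)
    (hs : ∀ i, ContDiffAt ℝ ∞ (s i) x) (hflat : ∀ᶠ y in nhds x, IsFlatCoordFrameAt c θ κ s y)
    (u v : E) (i : Fin 3) :
    curvatureForm κ x u v (s i x) ∈ Submodule.span ℝ (Set.range fun j ↦ s j x) := by
  have dθ := h.hasFDerivAt_solder hx
  have dκ := h.hasFDerivAt_conn hx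
  have ds : ∀ i, HasFDerivAt (s i) (fderiv ℝ (s i) x) x := fun i ↦
    ((hs i).differentiableAt (by simp)).hasFDerivAt
  have dds : HasFDerivAt (fderiv ℝ (s i)) (fderiv ℝ (fderiv ℝ (s i)) x) x :=
    (((hs i).fderiv_right (m := ∞) (by simp)).differentiableAt (by simp)).hasFDerivAt
  have hsymm : fderiv ℝ (fderiv ℝ (s i)) x u v = fderiv ℝ (fderiv ℝ (s i)) x v u :=
    (hs i).isSymmSndFDerivAt (by rw [minSmoothness_of_isRCLikeNormedField]; exact two_le_infty) u v
  -- The flatness equation, differentiated. The numbers `p` and `q` are derivatives of the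
  -- coefficients `⟨s j, θ v⟩`; their values are irrelevant for membership in the span.
  have key : ∀ u v, ∃ p q : ℝ, fderiv ℝ (fderiv ℝ (s i)) x u v + fderiv ℝ κ x u v (s i x) +
      κ x v (fderiv ℝ (s i) x u) = (6 * c) •
        (p • s (i + 1) x + inner ℝ (s (i + 2) x) (θ x v) • fderiv ℝ (s (i + 1)) x u -
        (q • s (i + 2) x + inner ℝ (s (i + 1) x) (θ x v) • fderiv ℝ (s (i + 2)) x u)) := by
    intro u v
    have cv := hasFDerivAt_const (𝕜 := ℝ) v x
    have h1 := (dds.clm_apply cv).add ((dκ.clm_apply cv).clm_apply (ds i))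
    have h2 := ((((ds (i + 2)).inner ℝ (dθ.clm_apply cv)).smul (ds (i + 1))).sub
      (((ds (i + 1)).inner ℝ (dθ.clm_apply cv)).smul (ds (i + 2)))).const_smul (6 * c)
    have h3 := h1.congr_of_eventuallyEq
      (f₁ := fun y ↦ (6 * c) • frameRotation (fun j ↦ s j y) i (θ y v)) (by
        filter_upwards [hflat] with y hy
        exact (hy i v).symm)
    have h4 := congrArg (fun T : E →L[ℝ] F ↦ T u) (h3.unique h2)
    simp only [add_apply, sub_apply, smul_apply, ContinuousLinearMap.comp_apply,
      ContinuousLinearMap.flip_apply, zero_apply, map_zero, zero_add,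
      ContinuousLinearMap.smulRight_apply] at h4
    refine ⟨fderivInnerCLM ℝ (s (i + 2) x, θ x v) ((fderiv ℝ (s (i + 2)) x).prod
        (θ x ∘L 0 + (fderiv ℝ θ x).flip v) u), fderivInnerCLM ℝ (s (i + 1) x, θ x v)
        ((fderiv ℝ (s (i + 1)) x).prod (θ x ∘L 0 + (fderiv ℝ θ x).flip v) u), ?_⟩
    rw [add_assoc, add_comm (fderiv ℝ κ x u v (s i x)), h4, add_comm (_ • fderiv _ _ _ _),
      add_comm (_ • fderiv _ _ _ _)]
  obtain ⟨p, q, k1⟩ := key u v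
  obtain ⟨p', q', k2⟩ := key v u
  have e : ∀ i v, fderiv ℝ (s i) x v = - κ x v (s i x) +
      (6 * c) • frameRotation (fun j ↦ s j x) i (θ x v) := fun i v ↦ by
    rw [← hflat.self_of_nhds i v]; abel
  have e0 := e i
  have e1 := e (i + 1)
  have e2 := e (i + 2)
  simp only [frameRotation, show i + 1 + 2 = i by omega, show i + 1 + 1 = i + 2 by omega,
    show i + 2 + 2 = i + 1 by omega, show i + 2 + 1 = i by omega] at e0 e1 e2
  rw [e0, e1, e2] at k1 k2
  simp only [map_add, map_sub, map_smul, map_neg] at k1 k2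
  have hm : ∀ j, s j x ∈ Submodule.span ℝ (Set.range fun j ↦ s j x) := fun j ↦
    Submodule.subset_span ⟨j, rfl⟩
  rw [curvatureForm_apply]
  generalize inner ℝ (s i x) (θ x u) = r₀ at *
  generalize inner ℝ (s (i + 1) x) (θ x u) = r₁ at *
  generalize inner ℝ (s (i + 2) x) (θ x u) = r₂ at *
  generalize inner ℝ (s i x) (θ x v) = t₀ at *
  generalize inner ℝ (s (i + 1) x) (θ x v) = t₁ at *
  generalize inner ℝ (s (i + 2) x) (θ x v) = t₂ at *
  have main : fderiv ℝ κ x u v (s i x) - fderiv ℝ κ x v u (s i x) + κ x u (κ x v (s i x)) -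
      κ x v (κ x u (s i x)) = (0 : ℝ) • s i x +
        (6 * c * (p - p') + 36 * c ^ 2 * (t₁ * r₀ - r₁ * t₀)) • s (i + 1) x +
        (6 * c * (q' - q) + 36 * c ^ 2 * (t₂ * r₀ - r₂ * t₀)) • s (i + 2) x := by
    linear_combination (norm := module) k1 - k2 - hsymm
  rw [main]
  exact Submodule.add_mem _ (Submodule.add_mem _ (Submodule.smul_mem _ _ (hm _))
    (Submodule.smul_mem _ _ (hm _))) (Submodule.smul_mem _ _ (hm _))

/-- Both spans are invariant under the curvature at `x` and have dimension three, so
`associative_unique` applies. -/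
theorem flatFrame_span_unique (hB : IsCrossProduct B) (h7 : Module.finrank ℝ F = 7) (hc : c ≠ 0)
    {s s' : Fin 3 → E → F} {x : E} (hx : x ∈ U)
    (hs : ∀ i, ContDiffAt ℝ ∞ (s i) x) (hs' : ∀ i, ContDiffAt ℝ ∞ (s' i) x)
    (hflat : ∀ᶠ y in nhds x, IsFlatCoordFrameAt c θ κ s y)
    (hflat' : ∀ᶠ y in nhds x, IsFlatCoordFrameAt c θ κ s' y)
    (hon : Orthonormal ℝ fun j ↦ s j x) (hon' : Orthonormal ℝ fun j ↦ s' j x) :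
    Submodule.span ℝ (Set.range fun j ↦ s j x) = Submodule.span ℝ (Set.range fun j ↦ s' j x) := by
  have inv : ∀ s : Fin 3 → E → F, (∀ i, ContDiffAt ℝ ∞ (s i) x) →
      (∀ᶠ y in nhds x, IsFlatCoordFrameAt c θ κ s y) → ∀ a b,
      ∀ ζ ∈ Submodule.span ℝ (Set.range fun j ↦ s j x), curvatureTensor K κ x a b ζ ∈
        Submodule.span ℝ (Set.range fun j ↦ s j x) := by
    intro s hs hflat a b ζ hζ
    induction hζ using Submodule.span_induction with
    | mem y hy =>
      obtain ⟨i, rfl⟩ := hy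
      exact h.curvature_mem_span hx hs hflat _ _ i
    | zero => rw [map_zero]; exact Submodule.zero_mem _
    | add y z _ _ hy hz => rw [map_add]; exact Submodule.add_mem _ hy hz
    | smul r y _ hy => rw [map_smul]; exact Submodule.smul_mem _ _ hy
  refine (h.isCurvatureTensor hB hx).associative_unique hB h7 hc ?_ ?_ (inv s hs hflat)
    (inv s' hs' hflat')
  · rw [finrank_span_eq_card hon.linearIndependent, Fintype.card_fin]
  · rw [finrank_span_eq_card hon'.linearIndependent, Fintype.card_fin]

end IsCartanGauge

end CoordinateFrame

end SkewTorsion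

namespace SkewTorsion

/-! ### The flat connection on the associative distribution -/

section FlatCoordFrame

set_option synthInstance.maxHeartbeats 200000

universe u

variable {E : Type u} [NormedAddCommGroup E] [NormedSpace ℝ E]
  {F : Type u} [NormedAddCommGroup F] [InnerProductSpace ℝ F] [FiniteDimensional ℝ F]
  {B : F →L[ℝ] F →L[ℝ] F} {c : ℝ} {U : Set E} {K : E → F →L[ℝ] E}
  {θ : E → E →L[ℝ] F} {κ : E → E →L[ℝ] F →L[ℝ] F}

theorem eq_center_of_hasFDerivAt_zero {G : Type*} [NormedAddCommGroup G] [NormedSpace ℝ G]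
    {x₀ : E} {r : ℝ} (hr : 0 < r) (f : E → G) (f' : E → E →L[ℝ] G)
    (hf : ∀ x ∈ Metric.ball x₀ r, HasFDerivAt f (f' x) x)
    (hf' : ∀ x ∈ Metric.ball x₀ r, ∀ v, f' x v = 0) {x : E} (hx : x ∈ Metric.ball x₀ r) :
    f x = f x₀ := by
  refine Metric.isOpen_ball.is_const_of_fderiv_eq_zero (𝕜 := ℝ)
    (convex_ball x₀ r).isPreconnected
    (fun y hy ↦ (hf y hy).differentiableAt.differentiableWithinAt) (fun y hy ↦ ?_) hx
    (Metric.mem_ball_self hr)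
  rw [(hf y hy).fderiv]
  ext v
  exact hf' y hy v

namespace IsCartanGauge

variable (h : IsCartanGauge B c U K θ κ)

include h

/-- A vector killed by all values of the connection form is also killed by their derivatives, hence
by the curvature, which `not_fixed` forbids. Only the associative alternative remains. -/
theorem exists_associative (hB : IsCrossProduct B) (h7 : Module.finrank ℝ F = 7) (hc : c ≠ 0)
    (hU : U.Nonempty) {W : Submodule ℝ F} (hW : W ≠ ⊥) (hW' : W ≠ ⊤)
    (hinv : ∀ x ∈ U, ∀ v, ∀ w ∈ W, κ x v w ∈ W) :
    ∃ V : Submodule ℝ F, Module.finrank ℝ V = 3 ∧ (∀ a ∈ V, ∀ b ∈ V, B a b ∈ V) ∧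
      ∀ x ∈ U, ∀ v, ∀ w ∈ V, κ x v w ∈ V := by
  let S : Set (F →L[ℝ] F) := {N | ∃ x ∈ U, ∃ v, N = κ x v}
  obtain ⟨u, hu, hfix⟩ | ⟨V, h3, hV, hinvV⟩ := exists_fixed_or_associative hB (S := S)
    (by rintro _ ⟨x, hx, v, rfl⟩; exact h.skewDer x hx v) h7 hW hW'
    (by rintro _ ⟨x, hx, v, rfl⟩; exact hinv x hx v)
  · exfalso
    obtain ⟨x, hx⟩ := hU
    have hκ : ∀ x ∈ U, ∀ v, κ x v u = 0 := fun x hx v ↦ hfix _ ⟨x, hx, v, rfl⟩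
    let Z : Submodule ℝ (F →L[ℝ] F) :=
      { carrier := {N | N u = 0}
        add_mem' := fun {M N} (hM : M u = 0) (hN : N u = 0) ↦ by
          change (M + N) u = 0
          rw [add_apply, hM, hN, add_zero]
        zero_mem' := rfl
        smul_mem' := fun r N (hN : N u = 0) ↦ by
          change (r • N) u = 0
          rw [smul_apply, hN, smul_zero] }
    have hd : ∀ v w, fderiv ℝ κ x v w u = 0 := h.fderiv_conn_mem Z hκ hx
    refine (h.isCurvatureTensor hB hx).not_fixed hB h7 hc hu fun a b ↦ ?_
    rw [curvatureTensor_apply, curvatureForm_apply, hd, hd, hκ x hx, hκ x hx]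
    simp
  · exact ⟨V, h3, hV, fun x hx v ↦ hinvV _ ⟨x, hx, v, rfl⟩⟩

section Reduced

variable {V : Submodule ℝ F} (h3 : Module.finrank ℝ V = 3) (hV : ∀ a ∈ V, ∀ b ∈ V, B a b ∈ V)
  (hinv : ∀ x ∈ U, ∀ v, ∀ w ∈ V, κ x v w ∈ V)

include hinv in
theorem conn_starProjection {x : E} (hx : x ∈ U) (v : E) (a : F) :
    V.starProjection (κ x v a) = κ x v (V.starProjection a) := by
  obtain ⟨b, hb, b', hb', rfl⟩ := V.exists_add_mem_mem_orthogonal a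
  have h1 : κ x v b' ∈ Vᗮ := fun y hy ↦ by
    rw [real_inner_comm, (h.skewDer x hx v).skew, real_inner_comm, hb' _ (hinv x hx v y hy),
      neg_zero]
  rw [map_add, map_add, map_add, Submodule.starProjection_eq_self_iff.mpr (hinv x hx v b hb),
    Submodule.starProjection_eq_self_iff.mpr hb, V.starProjection_apply_eq_zero_iff.mpr h1,
    V.starProjection_apply_eq_zero_iff.mpr hb', add_zero, add_zero]

omit h [FiniteDimensional ℝ F] in
/-- The connection form of the flat connection on an invariant associative subspace. -/
def reducedForm [V.HasOrthogonalProjection] (B : F →L[ℝ] F →L[ℝ] F) (c : ℝ)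
    (θ : E → E →L[ℝ] F) (κ : E → E →L[ℝ] F →L[ℝ] F) (x : E) : E →L[ℝ] F →L[ℝ] F :=
  ((ContinuousLinearMap.compL ℝ F F F V.starProjection) ∘L
    (ContinuousLinearMap.compL ℝ F F F).flip V.starProjection) ∘L
    (κ x - (6 * c) • (B ∘L V.starProjection ∘L θ x))

omit h in
theorem reducedForm_apply (B : F →L[ℝ] F →L[ℝ] F) (c : ℝ)
    (θ : E → E →L[ℝ] F) (κ : E → E →L[ℝ] F →L[ℝ] F) (x v : E) (a : F) :
    reducedForm (V := V) B c θ κ x v a = V.starProjection (κ x v (V.starProjection a) -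
      (6 * c) • B (V.starProjection (θ x v)) (V.starProjection a)) := rfl

theorem contDiffOn_reducedForm : ContDiffOn ℝ ∞ (reducedForm (V := V) B c θ κ) U :=
  contDiffOn_const.clm_comp (h.smooth_conn.sub ((contDiffOn_const.clm_comp
    (contDiffOn_const.clm_comp h.smooth_solder)).const_smul (6 * c)))

theorem fderiv_reducedForm {x : E} (hx : x ∈ U) (u v : E) (a : F) :
    fderiv ℝ (reducedForm (V := V) B c θ κ) x u v a =
      V.starProjection (fderiv ℝ κ x u v (V.starProjection a) -
      (6 * c) • B (V.starProjection (fderiv ℝ θ x u v)) (V.starProjection a)) := by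
  have hd : DifferentiableAt ℝ (reducedForm (V := V) B c θ κ) x :=
    (h.contDiffOn_reducedForm.contDiffAt (h.isOpen.mem_nhds hx)).differentiableAt (by simp)
  have cv := hasFDerivAt_const (𝕜 := ℝ) v x
  have h1 := (hd.hasFDerivAt.clm_apply cv).clm_apply (hasFDerivAt_const (𝕜 := ℝ) a x)
  have h2 := V.starProjection.hasFDerivAt.comp x
    ((((h.hasFDerivAt_conn hx).clm_apply cv).clm_apply
        (hasFDerivAt_const (𝕜 := ℝ) (V.starProjection a) x)).sub
      ((((B.flip (V.starProjection a) ∘L V.starProjection).hasFDerivAt).comp x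
        ((h.hasFDerivAt_solder hx).clm_apply cv)).const_smul (6 * c)))
  have h3 := congrArg (fun T : E →L[ℝ] F ↦ T u)
    ((h1.congr_of_eventuallyEq (Filter.Eventually.of_forall fun y ↦ rfl)).unique h2)
  simpa using h3

-- Subtracting `6c π(v) ×` changes the curvature on `V` by `-12c² π(u × v) ×`, from the torsion `2c
-- u × v`, and by the commutator `36c² [πu ×, πv ×] = 36c² (πu × πv) ×`, from the Jacobi identity on
-- `V`. By `apply_associative` the total is zero.
include h3 hV hinv in
theorem reducedForm_flat (hB : IsCrossProduct B) (h7 : Module.finrank ℝ F = 7) (hc : c ≠ 0)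
    {x : E} (hx : x ∈ U) (u v : E) :
    fderiv ℝ (reducedForm (V := V) B c θ κ) x u v - fderiv ℝ (reducedForm (V := V) B c θ κ) x v u +
      reducedForm (V := V) B c θ κ x u * reducedForm (V := V) B c θ κ x v -
      reducedForm (V := V) B c θ κ x v * reducedForm (V := V) B c θ κ x u = 0 := by
  have hV0 : V ≠ ⊥ := by
    rintro rfl
    rw [finrank_bot] at h3
    omega
  have hV1 : V ≠ ⊤ := by
    rintro rfl
    rw [finrank_top] at h3
    omega
  have pm : ∀ a, V.starProjection a ∈ V := V.starProjection_apply_mem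
  have pV : ∀ a ∈ V, V.starProjection a = a := fun a ↦ Submodule.starProjection_eq_self_iff.mpr
  ext a
  simp only [add_apply, sub_apply, mul_apply_eq_comp, zero_apply, reducedForm_apply,
    h.fderiv_reducedForm hx]
  set ζ := V.starProjection a with hζ
  have hζV : ζ ∈ V := pm a
  have hN : ∀ w, ∀ b ∈ V, κ x w b - (6 * c) • B (V.starProjection (θ x w)) b ∈ V :=
    fun w b hb ↦ V.sub_mem (hinv x hx w b hb) (V.smul_mem _ (hV _ (pm _) _ hb))
  rw [pV _ (hN v ζ hζV), pV _ (hN u ζ hζV), pV _ (hN v ζ hζV), pV _ (hN u ζ hζV),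
    pV _ (hN u _ (hN v ζ hζV)), pV _ (hN v _ (hN u ζ hζV)), ← map_sub]
  have hR := (h.isCurvatureTensor hB hx).apply_associative hB hc hV
    (fun a b ζ hζ ↦ h.curvature_mem hinv hx _ _ hζ) hV0 hV1 (θ x u) (θ x v) hζV
  rw [← h.curvatureForm_eq hx, curvatureForm_apply] at hR
  -- As the connection form commutes with the projection, projecting the torsion equation computes
  -- the exterior covariant derivative of `π`.
  have ht := congrArg (fun b ↦ B (V.starProjection b) ζ) (h.torsion x hx u v)
  simp only [map_add, map_sub, map_smul, add_apply, sub_apply, smul_apply,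
    h.conn_starProjection hinv hx] at ht
  have hdV : fderiv ℝ κ x u v ζ - fderiv ℝ κ x v u ζ ∈ V := by
    have h1 := h.curvature_mem hinv hx u v hζV
    rw [curvatureForm_apply] at h1
    have h2 := V.add_mem h1 (V.sub_mem (hinv x hx v _ (hinv x hx u ζ hζV))
      (hinv x hx u _ (hinv x hx v ζ hζV)))
    convert h2 using 1
    abel
  have hpart : V.starProjection (fderiv ℝ κ x u v ζ - (6 * c) • B (V.starProjection
        (fderiv ℝ θ x u v)) ζ - (fderiv ℝ κ x v u ζ - (6 * c) • B (V.starProjection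
        (fderiv ℝ θ x v u)) ζ)) = fderiv ℝ κ x u v ζ - (6 * c) • B (V.starProjection
        (fderiv ℝ θ x u v)) ζ - (fderiv ℝ κ x v u ζ - (6 * c) • B (V.starProjection
        (fderiv ℝ θ x v u)) ζ) := by
    apply pV
    have h2 := V.sub_mem hdV (V.smul_mem (6 * c) (V.sub_mem
      (hV _ (pm (fderiv ℝ θ x u v)) _ hζV) (hV _ (pm (fderiv ℝ θ x v u)) _ hζV)))
    convert h2 using 1
    module
  rw [hpart]
  have Lu := (h.skewDer x hx u).leibniz (V.starProjection (θ x v)) ζ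
  have Lv := (h.skewDer x hx v).leibniz (V.starProjection (θ x u)) ζ
  have J1 := cross_cross_of_associative hB h3 hV (pm (θ x u)) (pm (θ x v)) hζV
  have J2 := cross_cross_of_associative hB h3 hV (pm (θ x v)) (pm (θ x u)) hζV
  have J3 := cross_cross_of_associative hB h3 hV hζV (pm (θ x u)) (pm (θ x v))
  rw [hB.anti ζ] at J3
  rw [real_inner_comm (V.starProjection (θ x u)) (V.starProjection (θ x v))] at J2
  rw [real_inner_comm (V.starProjection (θ x u)) ζ, real_inner_comm (V.starProjection (θ x v)) ζ] at J3
  simp only [map_sub, map_smul]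
  rw [Lu, Lv]
  linear_combination (norm := module) hR - (6 * c) • ht + (36 * c ^ 2) • J1 - (36 * c ^ 2) • J2
    + (36 * c ^ 2) • J3

end Reduced

/-- A reducible connection with parallel skew torsion admits local flat frames. -/
theorem exists_flatCoordFrame [FiniteDimensional ℝ E] (hB : IsCrossProduct B)
    (h7 : Module.finrank ℝ F = 7) (hc : c ≠ 0) {W : Submodule ℝ F} (hW : W ≠ ⊥) (hW' : W ≠ ⊤)
    (hinv : ∀ x ∈ U, ∀ v, ∀ w ∈ W, κ x v w ∈ W) {x₀ : E} (hx₀ : x₀ ∈ U) :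
    ∃ s : Fin 3 → E → F, ∃ r > 0, Metric.ball x₀ r ⊆ U ∧
      (∀ i, ContDiffOn ℝ ∞ (s i) (Metric.ball x₀ r)) ∧ ∀ x ∈ Metric.ball x₀ r,
        IsAssociativeFrame B (fun j ↦ s j x) ∧ IsFlatCoordFrameAt c θ κ s x := by
  obtain ⟨V, h3, hV, hinvV⟩ := h.exists_associative hB h7 hc ⟨x₀, hx₀⟩ hW hW' hinv
  obtain ⟨g, r, hr, hrU, hg, hg0, hgd⟩ := exists_flat_gauge h.isOpen
    (h.contDiffOn_reducedForm (V := V)) (fun x hx ↦ h.reducedForm_flat h3 hV hinvV hB h7 hc hx) hx₀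
  obtain ⟨ξ, hξ, hξV⟩ := exists_associativeFrame hB h3 hV
  have hx₀r : x₀ ∈ Metric.ball x₀ r := Metric.mem_ball_self hr
  have pm : ∀ a, V.starProjection a ∈ V := V.starProjection_apply_mem
  have pV : ∀ a ∈ V, V.starProjection a = a := fun a ↦ Submodule.starProjection_eq_self_iff.mpr
  -- The flat gauge moves a fixed associative frame of `V` from the centre to `x`.
  let s : Fin 3 → E → F := fun i x ↦ g x (ξ i)
  have hs0 : ∀ i, s i x₀ = ξ i := fun i ↦ by simp [s, hg0]
  have ds : ∀ i, ∀ x ∈ Metric.ball x₀ r,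
      HasFDerivAt (s i) (- (reducedForm (V := V) B c θ κ x).flip (s i x)) x := by
    intro i x hx
    have h1 := ((hg.contDiffAt (Metric.isOpen_ball.mem_nhds hx)).differentiableAt
      (by simp)).hasFDerivAt.clm_apply (hasFDerivAt_const (𝕜 := ℝ) (ξ i) x)
    refine h1.congr_fderiv ?_
    ext v
    simp [hgd x hx, s]
  -- The reduced form has values in `V`, so the part of `s i` orthogonal to `V` is constant, and it
  -- is zero at the centre.
  have hsV : ∀ i, ∀ x ∈ Metric.ball x₀ r, s i x ∈ V := by
    intro i x hx
    have h1 := eq_center_of_hasFDerivAt_zero hr (fun x ↦ s i x - V.starProjection (s i x)) _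
      (fun x hx ↦ (ds i x hx).sub (V.starProjection.hasFDerivAt.comp x (ds i x hx)))
      (fun x hx v ↦ by
        simp only [sub_apply, neg_apply, ContinuousLinearMap.flip_apply,
          ContinuousLinearMap.comp_apply, reducedForm_apply, map_neg]
        rw [pV _ (pm _), sub_self]) hx
    simp only [hs0, pV _ (hξV i), sub_self] at h1
    rw [sub_eq_zero.mp h1]
    exact pm _
  -- The flat connection without the compression to `V`. It is skew, and by the Jacobi identity a
  -- derivation on `V`, so inner products and triple products of the frame are constant.
  let N : E → E → F →L[ℝ] F := fun x v ↦ κ x v - (6 * c) • B (V.starProjection (θ x v))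
  have hN : ∀ i, ∀ x ∈ Metric.ball x₀ r, ∀ v,
      reducedForm (V := V) B c θ κ x v (s i x) = N x v (s i x) := by
    intro i x hx v
    rw [reducedForm_apply, pV _ (hsV i x hx), pV]
    · rfl
    · exact V.sub_mem (hinvV x (hrU hx) v _ (hsV i x hx))
        (V.smul_mem _ (hV _ (pm _) _ (hsV i x hx)))
  have hNskew : ∀ x ∈ Metric.ball x₀ r, ∀ v a b,
      inner ℝ (N x v a) b = - inner ℝ a (N x v b) := by
    intro x hx v a b
    simp only [N, sub_apply, smul_apply, inner_sub_left, inner_sub_right, inner_smul_left,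
      inner_smul_right, (h.skewDer x (hrU hx) v).skew a b]
    rw [hB.anti _ a, inner_neg_left, hB.inner_rotate, real_inner_comm a]
    simp
    ring
  have hNder : ∀ x ∈ Metric.ball x₀ r, ∀ v, ∀ a ∈ V, ∀ b ∈ V,
      N x v (B a b) = B (N x v a) b + B a (N x v b) := by
    intro x hx v a ha b hb
    have hp := pm (θ x v)
    simp only [N, sub_apply, smul_apply, (h.skewDer x (hrU hx) v).leibniz a b, map_sub, map_smul]
    have J1 := cross_cross_of_associative hB h3 hV hp ha hb
    have J2 := cross_cross_of_associative hB h3 hV ha hp hb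
    have J3 := cross_cross_of_associative hB h3 hV hb hp ha
    rw [hB.anti b] at J3
    rw [real_inner_comm a b, real_inner_comm (V.starProjection (θ x v)) b] at J3
    rw [real_inner_comm (V.starProjection (θ x v)) a] at J2
    linear_combination (norm := module) (- 6 * c) • J1 - (6 * c) • J3 + (6 * c) • J2
  have hinner : ∀ i j, ∀ x ∈ Metric.ball x₀ r, inner ℝ (s i x) (s j x) = inner ℝ (ξ i) (ξ j) := by
    intro i j x hx
    have h1 := eq_center_of_hasFDerivAt_zero hr (fun x ↦ inner ℝ (s i x) (s j x)) _
      (fun x hx ↦ (ds i x hx).inner ℝ (ds j x hx))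
      (fun x hx v ↦ by simp [hN _ x hx, hNskew x hx v (s i x) (s j x)]) hx
    simpa only [hs0] using h1
  have hcross : ∀ i, ∀ x ∈ Metric.ball x₀ r,
      inner ℝ (B (s i x) (s (i + 1) x)) (s (i + 2) x) = (1 : ℝ) := by
    intro i x hx
    have h1 := eq_center_of_hasFDerivAt_zero hr (fun x ↦ inner ℝ (B (s i x) (s (i + 1) x)) (s (i + 2) x)) _
      (fun x hx ↦ ((B.hasFDerivAt.comp x (ds i x hx)).clm_apply (ds (i + 1) x hx)).inner ℝ
        (ds (i + 2) x hx))
      (fun x hx v ↦ by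
        have h2 := hNder x hx v _ (hsV i x hx) _ (hsV (i + 1) x hx)
        have h3 := hNskew x hx v (B (s i x) (s (i + 1) x)) (s (i + 2) x)
        rw [h2, inner_add_left] at h3
        simp [hN _ x hx, inner_add_left]
        linarith) hx
    simp only [hs0, hξ.cross, hξ.inner_eq] at h1
    simpa using h1
  have horth : ∀ x ∈ Metric.ball x₀ r, Orthonormal ℝ fun j ↦ s j x := fun x hx ↦ by
    rw [orthonormal_iff_ite]
    intro i j
    rw [hinner i j x hx, hξ.inner_eq]
  have hframe : ∀ x ∈ Metric.ball x₀ r, IsAssociativeFrame B fun j ↦ s j x := fun x hx ↦ by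
    refine ⟨horth x hx, fun i ↦ ?_⟩
    have hn : ∀ i, ‖s i x‖ = 1 := (horth x hx).1
    -- Unit vectors with inner product one coincide, so constancy of the triple product is enough.
    refine (inner_eq_one_iff_of_norm_eq_one (𝕜 := ℝ) ?_ (hn _)).mp (hcross i x hx)
    have h1 : ‖B (s i x) (s (i + 1) x)‖ ^ 2 = 1 := by
      rw [← real_inner_self_eq_norm_sq, hB.inner_cross_cross, hinner _ _ x hx, hinner _ _ x hx,
        hinner _ _ x hx, hξ.inner_eq, hξ.inner_eq, hξ.inner_eq]
      simp
    exact (pow_eq_one_iff_of_nonneg (norm_nonneg _) two_ne_zero).mp h1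
  refine ⟨s, r, hr, hrU, fun i ↦ hg.clm_apply contDiffOn_const, fun x hx ↦ ⟨hframe x hx, ?_⟩⟩
  intro i v
  rw [(ds i x hx).fderiv, neg_apply, ContinuousLinearMap.flip_apply, hN i x hx,
    ← (hframe x hx).sum_cross hB, ← starProjection_eq_sum h3 (horth x hx) fun i ↦ hsV i x hx]
  simp only [N, sub_apply, smul_apply]
  abel

end IsCartanGauge

end FlatCoordFrame

end SkewTorsion

namespace SkewTorsion

/-! ### Tangent vectors, derivatives and brackets in a chart -/

section Chart

universe u

variable {E : Type u} [NormedAddCommGroup E] [NormedSpace ℝ E]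
  {M : Type*} [TopologicalSpace M] [ChartedSpace E M]

/-- The inverse of the preferred chart at `p`. -/
def chartInv (p : M) : E → M := (extChartAt 𝓘(ℝ, E) p).symm

theorem chartInv_chart {p q : M} (hq : q ∈ (chartAt E p).source) :
    chartInv p (extChartAt 𝓘(ℝ, E) p q) = q :=
  (extChartAt 𝓘(ℝ, E) p).left_inv (by rwa [extChartAt_source])

theorem chartInv_mem {p : M} {x : E} (hx : x ∈ (extChartAt 𝓘(ℝ, E) p).target) :
    chartInv p x ∈ (chartAt E p).source := by
  rw [← extChartAt_source 𝓘(ℝ, E)]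
  exact (extChartAt 𝓘(ℝ, E) p).map_target hx

theorem chart_chartInv {p : M} {x : E} (hx : x ∈ (extChartAt 𝓘(ℝ, E) p).target) :
    extChartAt 𝓘(ℝ, E) p (chartInv p x) = x :=
  (extChartAt 𝓘(ℝ, E) p).right_inv hx

theorem chart_mem {p q : M} (hq : q ∈ (chartAt E p).source) :
    extChartAt 𝓘(ℝ, E) p q ∈ (extChartAt 𝓘(ℝ, E) p).target :=
  (extChartAt 𝓘(ℝ, E) p).map_source (by rwa [extChartAt_source])

theorem exists_eq_chartInv {p q : M} (hq : q ∈ (chartAt E p).source) :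
    ∃ x ∈ (extChartAt 𝓘(ℝ, E) p).target, chartInv p x = q :=
  ⟨_, chart_mem hq, chartInv_chart hq⟩

variable [IsManifold 𝓘(ℝ, E) ∞ M]

/-- The frame of the tangent space at `q` given by the chart at `p`. -/
def chartFrame (p q : M) : E →L[ℝ] TangentSpace 𝓘(ℝ, E) q :=
  (trivializationAt E (TangentSpace 𝓘(ℝ, E)) p).symmL ℝ q

/-- The coordinates of tangent vectors at `q` in the chart at `p`. -/
def chartCoord (p q : M) : TangentSpace 𝓘(ℝ, E) q →L[ℝ] E :=
  (trivializationAt E (TangentSpace 𝓘(ℝ, E)) p).continuousLinearMapAt ℝ q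

theorem chartCoord_apply {p q : M} (hq : q ∈ (chartAt E p).source) (v : TangentSpace 𝓘(ℝ, E) q) :
    chartCoord p q v = (trivializationAt E (TangentSpace 𝓘(ℝ, E)) p ⟨q, v⟩).2 :=
  congrFun ((trivializationAt E (TangentSpace 𝓘(ℝ, E)) p).coe_linearMapAt_of_mem (R := ℝ) hq) v

theorem chartCoord_frame {p q : M} (hq : q ∈ (chartAt E p).source) (v : E) :
    chartCoord p q (chartFrame p q v) = v :=
  (trivializationAt E (TangentSpace 𝓘(ℝ, E)) p).continuousLinearMapAt_symmL (R := ℝ) hq v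

theorem chartFrame_coord {p q : M} (hq : q ∈ (chartAt E p).source) (v : TangentSpace 𝓘(ℝ, E) q) :
    chartFrame p q (chartCoord p q v) = v :=
  (trivializationAt E (TangentSpace 𝓘(ℝ, E)) p).symmL_continuousLinearMapAt (R := ℝ) hq v

/-- The chart at `p` identifies the tangent space at `q` with the model space. -/
def chartEquiv {p q : M} (hq : q ∈ (chartAt E p).source) : E ≃L[ℝ] TangentSpace 𝓘(ℝ, E) q :=
  .equivOfInverse (chartFrame p q) (chartCoord p q) (chartCoord_frame hq) (chartFrame_coord hq)

theorem contMDiffAt_chartInv {p : M} {x : E} (hx : x ∈ (extChartAt 𝓘(ℝ, E) p).target) :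
    ContMDiffAt 𝓘(ℝ, E) 𝓘(ℝ, E) ∞ (chartInv p) x :=
  (contMDiffOn_extChartAt_symm p).contMDiffAt
    ((isOpen_extChartAt_target p).mem_nhds hx)

/-- Through this identification, derivatives on `M` become Fréchet derivatives in the model space.
-/
theorem hasMFDerivAt_chartInv {p : M} {x : E} (hx : x ∈ (extChartAt 𝓘(ℝ, E) p).target) :
    HasMFDerivAt 𝓘(ℝ, E) 𝓘(ℝ, E) (chartInv p) x
      (chartFrame (E := E) p (chartInv p x)) := by
  have h := ((contMDiffAt_chartInv hx).mdifferentiableAt (by simp)).hasMFDerivAt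
  have e : mfderiv 𝓘(ℝ, E) 𝓘(ℝ, E) (chartInv p) x =
      (chartFrame (E := E) p (chartInv p x)) := by
    have h2 := TangentBundle.symmL_trivializationAt (I := 𝓘(ℝ, E)) (chartInv_mem hx)
    rw [chart_chartInv hx] at h2
    change _ = (trivializationAt E (TangentSpace 𝓘(ℝ, E)) p).symmL ℝ (chartInv p x)
    rw [h2]
    simp [chartInv]
    rfl
  exact e ▸ h

variable {G : Type*} [NormedAddCommGroup G] [NormedSpace ℝ G]

theorem contMDiffAt_iff_chart {n : WithTop ℕ∞} (hn : n ≤ ∞) {f : M → G} {p q : M}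
    (hq : q ∈ (chartAt E p).source) :
    ContMDiffAt 𝓘(ℝ, E) 𝓘(ℝ, G) n f q ↔
      ContDiffAt ℝ n (f ∘ chartInv p) (extChartAt 𝓘(ℝ, E) p q) := by
  have : IsManifold 𝓘(ℝ, E) n M := IsManifold.of_le hn
  rw [← contMDiffAt_iff_contDiffAt, contMDiffAt_iff_source_of_mem_source hq]
  simp [chartInv, contMDiffWithinAt_univ]

theorem mdifferentiableAt_iff_chart {f : M → G} {p q : M} (hq : q ∈ (chartAt E p).source) :
    MDifferentiableAt 𝓘(ℝ, E) 𝓘(ℝ, G) f q ↔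
      DifferentiableAt ℝ (f ∘ chartInv p) (extChartAt 𝓘(ℝ, E) p q) := by
  have : IsManifold 𝓘(ℝ, E) 1 M := IsManifold.of_le (n := ∞) (by simp)
  rw [← mdifferentiableAt_iff_differentiableAt, mdifferentiableAt_iff_source_of_mem_source hq]
  simp [chartInv, mdifferentiableWithinAt_univ]

theorem mvfderiv_chartFrame {f : M → G} {p : M} {x : E}
    (hx : x ∈ (extChartAt 𝓘(ℝ, E) p).target)
    (hf : MDifferentiableAt 𝓘(ℝ, E) 𝓘(ℝ, G) f (chartInv p x)) (v : E) :
    mvfderiv 𝓘(ℝ, E) f (chartInv p x) (chartFrame p (chartInv p x) v) =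
      fderiv ℝ (f ∘ chartInv p) x v := by
  have h := (hf.hasMFDerivAt.comp x (hasMFDerivAt_chartInv hx)).mfderiv
  rw [mfderiv_eq_fderiv] at h
  rw [h]
  rfl

theorem contMDiffAt_section_iff_chart {Y : Π q : M, TangentSpace 𝓘(ℝ, E) q} {p q : M}
    (hq : q ∈ (chartAt E p).source) :
    ContMDiffAt 𝓘(ℝ, E) 𝓘(ℝ, E).tangent ∞ (fun q ↦ (⟨q, Y q⟩ : TangentBundle 𝓘(ℝ, E) M)) q ↔
      ContDiffAt ℝ ∞ (fun x ↦ chartCoord p (chartInv p x) (Y (chartInv p x)))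
        (extChartAt 𝓘(ℝ, E) p q) := by
  rw [(trivializationAt E (TangentSpace 𝓘(ℝ, E)) p).contMDiffAt_section_iff (IB := 𝓘(ℝ, E)) hq,
    contMDiffAt_iff_chart le_rfl hq]
  have e : (fun q ↦ (trivializationAt E (TangentSpace 𝓘(ℝ, E)) p ⟨q, Y q⟩).2) ∘ chartInv p
      =ᶠ[nhds (extChartAt 𝓘(ℝ, E) p q)]
      fun x ↦ chartCoord p (chartInv p x) (Y (chartInv p x)) := by
    filter_upwards [(isOpen_extChartAt_target p).mem_nhds (chart_mem hq)] with x hx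
    exact (chartCoord_apply (chartInv_mem hx) _).symm
  exact ⟨fun h ↦ h.congr_of_eventuallyEq e.symm, fun h ↦ h.congr_of_eventuallyEq e⟩

theorem mdiffAt_section_iff_chart {Y : Π q : M, TangentSpace 𝓘(ℝ, E) q} {p q : M}
    (hq : q ∈ (chartAt E p).source) :
    MDiffAt (T% Y) q ↔
      DifferentiableAt ℝ (fun x ↦ chartCoord p (chartInv p x) (Y (chartInv p x)))
        (extChartAt 𝓘(ℝ, E) p q) := by
  rw [(trivializationAt E (TangentSpace 𝓘(ℝ, E)) p).mdifferentiableAt_section_iff 𝓘(ℝ, E) _ hq,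
    mdifferentiableAt_iff_chart hq]
  refine Filter.EventuallyEq.differentiableAt_iff ?_
  filter_upwards [(isOpen_extChartAt_target p).mem_nhds (chart_mem hq)] with x hx
  exact (chartCoord_apply (chartInv_mem hx) _).symm

theorem contMDiffAt_chartFrame {p q : M} (hq : q ∈ (chartAt E p).source) {f : M → E}
    (hf : ContMDiffAt 𝓘(ℝ, E) 𝓘(ℝ, E) ∞ f q) :
    CMDiffAt ∞ (T% fun q ↦ chartFrame p q (f q)) q := by
  rw [contMDiffAt_section_iff_chart hq]
  refine ((contMDiffAt_iff_chart le_rfl hq).mp hf).congr_of_eventuallyEq ?_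
  filter_upwards [(isOpen_extChartAt_target p).mem_nhds (chart_mem hq)] with x hx
  exact chartCoord_frame (chartInv_mem hx) _

/-- The inverse chart pulls coordinate fields back to constant fields, and the bracket is natural
under pullback. -/
theorem mlieBracket_chartFrame [CompleteSpace E] {p q : M} (hq : q ∈ (chartAt E p).source)
    (a b : E) :
    mlieBracket 𝓘(ℝ, E) (fun q ↦ chartFrame p q a) (fun q ↦ chartFrame p q b) q = 0 := by
  obtain ⟨x, hx, rfl⟩ := exists_eq_chartInv hq
  have : IsManifold 𝓘(ℝ, E) (minSmoothness ℝ 3) M :=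
    IsManifold.of_le (n := ∞) (by
      rw [minSmoothness_of_isRCLikeNormedField]
      exact WithTop.coe_le_coe.mpr le_top)
  have sm : ∀ a : E, MDiffAt (T% fun q : M ↦ chartFrame p q a) (chartInv p x) := fun a ↦
    (contMDiffAt_chartFrame hq contMDiffAt_const).mdifferentiableAt (by simp)
  have h := mpullback_mlieBracket (n := ∞) (sm a) (sm b) (contMDiffAt_chartInv hx)
    (by rw [minSmoothness_of_isRCLikeNormedField]; exact two_le_infty)
  have inv : ∀ y ∈ (extChartAt 𝓘(ℝ, E) p).target,
      (mfderiv 𝓘(ℝ, E) 𝓘(ℝ, E) (chartInv p) y).IsInvertible := fun y hy ↦ by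
    rw [(hasMFDerivAt_chartInv hy).mfderiv]
    exact ⟨(chartEquiv (chartInv_mem hy) :), rfl⟩
  let const (a : E) : Π x : E, TangentSpace 𝓘(ℝ, E) x := fun _ ↦ a
  have e : ∀ a : E, mpullback 𝓘(ℝ, E) 𝓘(ℝ, E) (chartInv p) (fun q : M ↦ chartFrame p q a)
      =ᶠ[nhds x] const a := fun a ↦ by
    filter_upwards [(isOpen_extChartAt_target p).mem_nhds hx] with y hy
    rw [mpullback_apply]
    apply (inv y hy).bijective.1
    rw [(inv y hy).self_apply_inverse, (hasMFDerivAt_chartInv hy).mfderiv]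
    rfl
  have h0 : mlieBracket 𝓘(ℝ, E) (const a) (const b) x = 0 := by
    rw [← mlieBracketWithin_univ, mlieBracketWithin_eq_lieBracketWithin, lieBracketWithin_univ]
    simp [lieBracket]
    rfl
  rw [(e a).mlieBracket_vectorField_eq (e b), mpullback_apply, h0] at h
  have h2 := congrArg (mfderiv 𝓘(ℝ, E) 𝓘(ℝ, E) (chartInv p) x) h
  rwa [(inv x hx).self_apply_inverse, map_zero] at h2

end Chart

end SkewTorsion

namespace SkewTorsion

/-! ### Christoffel symbols and their smoothness -/

section ChartConnection

set_option synthInstance.maxHeartbeats 200000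

universe u

theorem contDiffAt_clm_of_apply {D E G : Type*} [NormedAddCommGroup D] [NormedSpace ℝ D]
    [NormedAddCommGroup E] [NormedSpace ℝ E] [FiniteDimensional ℝ E]
    [NormedAddCommGroup G] [NormedSpace ℝ G] {f : D → E →L[ℝ] G} {x : D} {n : WithTop ℕ∞}
    (h : ∀ v, ContDiffAt ℝ n (fun y ↦ f y v) x) : ContDiffAt ℝ n f x := by
  let b := Module.finBasis ℝ E
  have e : f = fun y ↦ ∑ i, (LinearMap.toContinuousLinearMap (b.coord i)).smulRight (f y (b i)) := by
    ext y v
    conv_lhs => rw [← b.sum_repr v, map_sum]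
    simp [-Module.Basis.sum_repr]
  rw [e]
  exact ContDiffAt.sum fun i _ ↦ contDiffAt_const.smulRight (h (b i))

variable {E : Type u} [NormedAddCommGroup E] [NormedSpace ℝ E] [FiniteDimensional ℝ E]
  {M : Type*} [TopologicalSpace M] [ChartedSpace E M] [IsManifold 𝓘(ℝ, E) ∞ M]

section General

variable (D : CovariantDerivative 𝓘(ℝ, E) E (TangentSpace 𝓘(ℝ, E) : M → Type _))

omit [FiniteDimensional ℝ E] in
theorem covariantDerivative_sum {ι : Type*} (s : Finset ι) {Y : ι → Π q : M, TangentSpace 𝓘(ℝ, E) q}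
    {q : M} (hY : ∀ i, MDiffAt (T% (Y i)) q) :
    D (∑ i ∈ s, Y i) q = ∑ i ∈ s, D (Y i) q := by
  classical
  induction s using Finset.induction_on with
  | empty =>
    rw [Finset.sum_empty, Finset.sum_empty, D.zero]
    rfl
  | insert i s hi ih =>
    rw [Finset.sum_insert hi, Finset.sum_insert hi, ← ih]
    refine D.isCovariantDerivativeOnUniv.add (hY i) ?_
    have := MDifferentiableAt.sum_section (s := s) (fun i _ ↦ hY i)
    convert this using 3
    simp

/-- The Christoffel symbols of a connection in the chart at `p`. -/
def christoffel (p : M) (x : E) : E →L[ℝ] E →L[ℝ] E :=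
  (∑ i, (LinearMap.toContinuousLinearMap ((Module.finBasis ℝ E).coord i)).smulRight
    (chartCoord p (chartInv p x) ∘L D (fun q ↦ chartFrame p q (Module.finBasis ℝ E i))
      (chartInv p x) ∘L chartFrame p (chartInv p x))).flip

/-- Near the point, `Y` is a combination of coordinate fields; locality and the Leibniz rule reduce
the claim to these. -/
theorem covariantDerivative_chart {p : M} {x : E} (hx : x ∈ (extChartAt 𝓘(ℝ, E) p).target)
    {Y : Π q : M, TangentSpace 𝓘(ℝ, E) q} (hY : MDiffAt (T% Y) (chartInv p x)) (v : E) :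
    D Y (chartInv p x) (chartFrame p (chartInv p x) v) = chartFrame p (chartInv p x)
      (fderiv ℝ (fun x ↦ chartCoord p (chartInv p x) (Y (chartInv p x))) x v +
        christoffel D p x v (chartCoord p (chartInv p x) (Y (chartInv p x)))) := by
  have hq := chartInv_mem hx
  let b := Module.finBasis ℝ E
  let l : ∀ i, E →L[ℝ] ℝ := fun i ↦ LinearMap.toContinuousLinearMap (b.coord i)
  let f : Fin (Module.finrank ℝ E) → M → ℝ := fun i q ↦ l i (chartCoord p q (Y q))
  have hsum : ∀ w : E, ∑ i, l i w • b i = w := fun w ↦ b.sum_repr w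
  have hYd := (mdiffAt_section_iff_chart hq).mp hY
  rw [chart_chartInv hx] at hYd
  have hf : ∀ i, MDifferentiableAt 𝓘(ℝ, E) 𝓘(ℝ, ℝ) (f i) (chartInv p x) := fun i ↦ by
    rw [mdifferentiableAt_iff_chart hq, chart_chartInv hx]
    exact (l i).differentiableAt.comp x hYd
  have hfd : ∀ i, mvfderiv 𝓘(ℝ, E) (f i) (chartInv p x) (chartFrame p (chartInv p x) v) =
      l i (fderiv ℝ (fun x ↦ chartCoord p (chartInv p x) (Y (chartInv p x))) x v) := fun i ↦ by
    rw [mvfderiv_chartFrame hx (hf i)]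
    have := (l i).hasFDerivAt.comp x hYd.hasFDerivAt
    exact congrArg (fun T : E →L[ℝ] ℝ ↦ T v) this.fderiv
  have hC : ∀ i, MDiffAt (T% fun q : M ↦ chartFrame p q (b i)) (chartInv p x) := fun i ↦
    (contMDiffAt_chartFrame hq contMDiffAt_const).mdifferentiableAt (by simp)
  have hs : ∀ i, MDiffAt (T% (f i • fun q : M ↦ chartFrame p q (b i))) (chartInv p x) := fun i ↦
    (hf i).smul_section (hC i)
  have e1 : D Y (chartInv p x) = D (∑ i, f i • fun q : M ↦ chartFrame p q (b i)) (chartInv p x) := by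
    refine D.isCovariantDerivativeOnUniv.congr_of_eventuallyEq hY ?_ Filter.univ_mem ?_
    · have := MDifferentiableAt.sum_section (s := Finset.univ) (fun i _ ↦ hs i)
      convert this using 3
      simp
    · filter_upwards [(chartAt E p).open_source.mem_nhds hq] with q hq'
      rw [Finset.sum_apply]
      change _ = ∑ i, l i (chartCoord p q (Y q)) • chartFrame p q (b i)
      simp only [← map_smul, ← map_sum, hsum, chartFrame_coord hq']
  have e2 : ∀ i, D (f i • fun q : M ↦ chartFrame p q (b i)) (chartInv p x)
      (chartFrame p (chartInv p x) v) = l i (chartCoord p (chartInv p x) (Y (chartInv p x))) •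
        D (fun q : M ↦ chartFrame p q (b i)) (chartInv p x) (chartFrame p (chartInv p x) v) +
      l i (fderiv ℝ (fun x ↦ chartCoord p (chartInv p x) (Y (chartInv p x))) x v) •
        chartFrame p (chartInv p x) (b i) := fun i ↦ by
    have h := D.isCovariantDerivativeOnUniv.leibniz (hC i) (hf i)
    have h2 := congrArg (fun T ↦ T (chartFrame p (chartInv p x) v)) h
    rw [← hfd i]
    exact h2
  rw [e1, covariantDerivative_sum D _ hs, sum_apply]
  simp only [e2]
  rw [Finset.sum_add_distrib, add_comm, map_add]
  congr 1
  · simp only [← map_smul, ← map_sum, hsum]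
  · change _ = chartFrame p (chartInv p x) ((∑ i, (l i).smulRight
      (chartCoord p (chartInv p x) ∘L D (fun q ↦ chartFrame p q (b i))
      (chartInv p x) ∘L chartFrame p (chartInv p x))).flip v _)
    simp only [ContinuousLinearMap.flip_apply, sum_apply, ContinuousLinearMap.smulRight_apply,
      smul_apply, ContinuousLinearMap.comp_apply, map_sum, map_smul, chartFrame_coord hq]

theorem christoffel_apply {p : M} {x : E} (hx : x ∈ (extChartAt 𝓘(ℝ, E) p).target) (v a : E) :
    D (fun q ↦ chartFrame p q a) (chartInv p x) (chartFrame p (chartInv p x) v) =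
      chartFrame p (chartInv p x) (christoffel D p x v a) := by
  have hq := chartInv_mem hx
  rw [covariantDerivative_chart D hx
    ((contMDiffAt_chartFrame hq contMDiffAt_const).mdifferentiableAt (by simp)), chartCoord_frame hq]
  have e : (fun y ↦ chartCoord (E := E) p (chartInv p y) (chartFrame p (chartInv p y) a))
      =ᶠ[nhds x] fun _ ↦ a := by
    filter_upwards [(isOpen_extChartAt_target p).mem_nhds hx] with y hy
    exact chartCoord_frame (chartInv_mem hy) a
  rw [e.fderiv_eq]
  simp

end General

variable [RiemannianBundle (fun x : M ↦ TangentSpace 𝓘(ℝ, E) x)]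
  [IsContMDiffRiemannianBundle 𝓘(ℝ, E) ∞ E (fun x : M ↦ TangentSpace 𝓘(ℝ, E) x)]

omit [FiniteDimensional ℝ E] in
theorem contMDiffAt_inner {X Z : Π x : M, TangentSpace 𝓘(ℝ, E) x} {q : M}
    (hX : CMDiffAt ∞ (T% X) q) (hZ : CMDiffAt ∞ (T% Z) q) :
    CMDiffAt ∞ (fun y ↦ inner ℝ (X y) (Z y)) q :=
  ContMDiffAt.inner_bundle (E := fun x : M ↦ TangentSpace 𝓘(ℝ, E) x) (b := id) hX hZ

omit [IsContMDiffRiemannianBundle 𝓘(ℝ, E) ∞ E (fun x : M ↦ TangentSpace 𝓘(ℝ, E) x)]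
  [FiniteDimensional ℝ E] in
/-- The metric in the chart at `p`. -/
def gram (p : M) (x : E) : E →L[ℝ] E →L[ℝ] ℝ :=
  (innerSL ℝ (E := TangentSpace 𝓘(ℝ, E) (chartInv p x))).bilinearComp
    (chartFrame p (chartInv p x)) (chartFrame p (chartInv p x))

omit [IsContMDiffRiemannianBundle 𝓘(ℝ, E) ∞ E (fun x : M ↦ TangentSpace 𝓘(ℝ, E) x)]
  [FiniteDimensional ℝ E] in
theorem gram_apply (p : M) (x a b : E) : gram p x a b =
    inner ℝ (chartFrame p (chartInv p x) a) (chartFrame p (chartInv p x) b) := rfl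

theorem contDiffAt_gram {p : M} {x : E} (hx : x ∈ (extChartAt 𝓘(ℝ, E) p).target) :
    ContDiffAt ℝ ∞ (gram (M := M) p) x := by
  refine contDiffAt_clm_of_apply fun a ↦ contDiffAt_clm_of_apply fun b ↦ ?_
  have hq := chartInv_mem hx
  have h := contMDiffAt_inner
    (contMDiffAt_chartFrame hq (contMDiffAt_const (c := a)))
    (contMDiffAt_chartFrame hq (contMDiffAt_const (c := b)))
  rw [contMDiffAt_iff_chart le_rfl hq, chart_chartInv hx] at h
  exact h

omit [IsContMDiffRiemannianBundle 𝓘(ℝ, E) ∞ E (fun x : M ↦ TangentSpace 𝓘(ℝ, E) x)] in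
theorem exists_gramEquiv {p : M} {x : E} (hx : x ∈ (extChartAt 𝓘(ℝ, E) p).target) :
    ∃ e : E ≃L[ℝ] (E →L[ℝ] ℝ), (e : E →L[ℝ] E →L[ℝ] ℝ) = gram (M := M) p x := by
  have hinj : Function.Injective (gram (M := M) p x) := by
    rw [injective_iff_map_eq_zero]
    intro a ha
    have h := congrArg (fun T : E →L[ℝ] ℝ ↦ T a) ha
    rw [gram_apply] at h
    rw [← chartCoord_frame (chartInv_mem hx) a, inner_self_eq_zero.mp h, map_zero]
  have hd : Module.finrank ℝ E = Module.finrank ℝ (E →L[ℝ] ℝ) := by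
    rw [← LinearEquiv.finrank_eq (LinearMap.toContinuousLinearMap (𝕜 := ℝ) (E := E) (F' := ℝ))]
    exact (Subspace.dual_finrank_eq (K := ℝ) (V := E)).symm
  let e := LinearEquiv.ofInjectiveOfFinrankEq (gram (M := M) p x : E →ₗ[ℝ] E →L[ℝ] ℝ) hinj hd
  exact ⟨e.toContinuousLinearEquiv, by ext; rfl⟩

/-- A vector field is smooth if its inner products with the coordinate fields are. -/
theorem contMDiffAt_of_inner {p q : M} (hq : q ∈ (chartAt E p).source)
    {Z : Π x : M, TangentSpace 𝓘(ℝ, E) x}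
    (hZ : ∀ a : E, CMDiffAt ∞ (fun q ↦ inner ℝ (Z q) (chartFrame p q a)) q) :
    CMDiffAt ∞ (T% Z) q := by
  obtain ⟨x, hx, rfl⟩ := exists_eq_chartInv hq
  rw [contMDiffAt_section_iff_chart hq, chart_chartInv hx]
  simp only [contMDiffAt_iff_chart le_rfl hq, chart_chartInv hx] at hZ
  obtain ⟨e, he⟩ := exists_gramEquiv (M := M) hx
  let l : E → E →L[ℝ] ℝ := fun x ↦
    innerSL ℝ (Z (chartInv p x)) ∘L chartFrame p (chartInv p x)
  have hl : ContDiffAt ℝ ∞ l x := contDiffAt_clm_of_apply hZ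
  -- The coordinates of `Z` arise from its inner products by inverting the Gram operator, and
  -- inversion is smooth.
  have h1 : ContDiffAt ℝ ∞ (fun y ↦ (gram (M := M) p y).inverse) x :=
    ContDiffAt.comp (g := ContinuousLinearMap.inverse) x
      (by rw [← he]; exact contDiffAt_map_inverse e) (contDiffAt_gram hx)
  refine (h1.clm_apply hl).congr_of_eventuallyEq ?_
  filter_upwards [(isOpen_extChartAt_target p).mem_nhds hx] with y hy
  obtain ⟨e', he'⟩ := exists_gramEquiv (M := M) hy
  have hly : l y = gram p y (chartCoord p (chartInv p y) (Z (chartInv p y))) := by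
    ext a
    rw [gram_apply, chartFrame_coord (chartInv_mem hy)]
    rfl
  rw [hly, ← he', ContinuousLinearMap.inverse_equiv]
  simp

variable (τ : ThreeForm 𝓘(ℝ, E) M)

omit [FiniteDimensional ℝ E] [RiemannianBundle (fun x : M ↦ TangentSpace 𝓘(ℝ, E) x)]
  [IsContMDiffRiemannianBundle 𝓘(ℝ, E) ∞ E (fun x : M ↦ TangentSpace 𝓘(ℝ, E) x)] in
theorem ThreeForm.swap_left (q : M) (X Y Z : TangentSpace 𝓘(ℝ, E) q) :
    τ q X Y Z = - τ q Y X Z := by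
  have h := τ.alt_left q (X + Y) Z
  simp only [map_add, add_apply, τ.alt_left, zero_add, add_zero] at h
  linarith

omit [FiniteDimensional ℝ E] [RiemannianBundle (fun x : M ↦ TangentSpace 𝓘(ℝ, E) x)]
  [IsContMDiffRiemannianBundle 𝓘(ℝ, E) ∞ E (fun x : M ↦ TangentSpace 𝓘(ℝ, E) x)] in
theorem ThreeForm.swap_right (q : M) (X Y Z : TangentSpace 𝓘(ℝ, E) q) :
    τ q X Y Z = - τ q X Z Y := by
  have h := τ.alt_right q X (Y + Z)
  simp only [map_add, add_apply, τ.alt_right, zero_add, add_zero] at h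
  linarith

/-- The added term is skew in its last two arguments and cancels. -/
theorem skewConnection_metric {Y Z : Π x : M, TangentSpace 𝓘(ℝ, E) x} {q : M}
    (hY : MDiffAt (T% Y) q) (hZ : MDiffAt (T% Z) q) (v : TangentSpace 𝓘(ℝ, E) q) :
    mvfderiv 𝓘(ℝ, E) (fun y ↦ inner ℝ (Y y) (Z y)) q v =
      inner ℝ (skewConnection τ Y q v) (Z q) + inner ℝ (Y q) (skewConnection τ Z q v) := by
  have h := leviCivita_metric (X := FiberBundle.extend E v)
    (FiberBundle.mdifferentiableAt_extend ..) hY hZ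
  rw [FiberBundle.extend_apply_self] at h
  rw [h, real_inner_comm (skewConnection τ Z q v), inner_skewConnection, inner_skewConnection,
    τ.swap_right q v (Z q), real_inner_comm (Y q)]
  ring

/-- Antisymmetrizing the added term doubles it, which is the origin of the constant `2 * c` in
`IsCartanGauge`. -/
theorem skewConnection_torsion {X Y : Π x : M, TangentSpace 𝓘(ℝ, E) x} {q : M}
    (hX : MDiffAt (T% X) q) (hY : MDiffAt (T% Y) q) :
    skewConnection τ Y q (X q) - skewConnection τ X q (Y q) =
      mlieBracket 𝓘(ℝ, E) X Y q + (2 : ℝ) • sharp _ (τ q (X q) (Y q)) := by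
  rw [← ((CovariantDerivative.torsion_eq_zero_iff _).mp leviCivita_torsion hX hY)]
  apply ext_inner_right ℝ
  intro w
  rw [inner_sub_left, inner_add_left, inner_smul_left, inner_sharp, inner_sub_left,
    inner_skewConnection, inner_skewConnection, τ.swap_left q (Y q)]
  simp
  ring

theorem christoffel_torsion {p : M} {x : E} (hx : x ∈ (extChartAt 𝓘(ℝ, E) p).target) (u v : E) :
    chartFrame p (chartInv p x) (christoffel (skewConnection τ) p x u v -
      christoffel (skewConnection τ) p x v u) = (2 : ℝ) • sharp _ (τ (chartInv p x)
        (chartFrame p (chartInv p x) u) (chartFrame p (chartInv p x) v)) := by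
  have hq := chartInv_mem hx
  have hC : ∀ a : E, MDiffAt (T% fun q : M ↦ chartFrame p q a) (chartInv p x) := fun a ↦
    (contMDiffAt_chartFrame hq contMDiffAt_const).mdifferentiableAt (by simp)
  have h := skewConnection_torsion τ (hC u) (hC v)
  rw [mlieBracket_chartFrame hq, zero_add, christoffel_apply _ hx, christoffel_apply _ hx] at h
  rw [map_sub, h]

/-- Coordinate fields commute, so the Koszul formula expresses the inner products through
derivatives of the Gram matrix, to which the smooth form `τ` is added. -/
theorem contDiffAt_christoffel {p : M} {x : E} (hx : x ∈ (extChartAt 𝓘(ℝ, E) p).target) :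
    ContDiffAt ℝ ∞ (christoffel (skewConnection τ) p) x := by
  refine contDiffAt_clm_of_apply fun v ↦ contDiffAt_clm_of_apply fun a ↦ ?_
  have hq := chartInv_mem hx
  have hC : ∀ a : E, ∀ q ∈ (chartAt E p).source, CMDiffAt ∞ (T% fun q : M ↦ chartFrame p q a) q :=
    fun a q hq ↦ contMDiffAt_chartFrame hq contMDiffAt_const
  have hC1 : ∀ a : E, ∀ q ∈ (chartAt E p).source, MDiffAt (T% fun q : M ↦ chartFrame p q a) q :=
    fun a q hq ↦ (hC a q hq).mdifferentiableAt (by simp)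
  have key : CMDiffAt ∞ (T% fun q : M ↦ skewConnection τ (fun q ↦ chartFrame p q a) q
      (chartFrame p q v)) (chartInv p x) := by
    refine contMDiffAt_of_inner hq fun d ↦ ?_
    have hτ := τ.smooth _ _ _ _ (hC v _ hq) (hC a _ hq) (hC d _ hq)
    rw [contMDiffAt_iff_chart le_rfl hq, chart_chartInv hx] at hτ ⊢
    have hg := (contDiffAt_gram (M := M) hx).fderiv_right (m := ∞) (by simp)
    have hg' : ∀ a b d : E, ContDiffAt ℝ ∞ (fun y ↦ fderiv ℝ (gram (M := M) p) y a b d) x :=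
      fun a b d ↦ ((hg.clm_apply contDiffAt_const).clm_apply contDiffAt_const).clm_apply
        contDiffAt_const
    refine (((contDiffAt_const (c := (1 / 2 : ℝ))).mul
      (((hg' v a d).add (hg' a v d)).sub (hg' d v a))).add hτ).congr_of_eventuallyEq ?_
    filter_upwards [(isOpen_extChartAt_target p).mem_nhds hx] with y hy
    have hqy := chartInv_mem hy
    have hd : ∀ a b d : E, mvfderiv 𝓘(ℝ, E) (fun q : M ↦ inner ℝ (chartFrame p q a)
        (chartFrame p q b)) (chartInv p y) (chartFrame p (chartInv p y) d) =
        fderiv ℝ (gram (M := M) p) y d a b := fun a b d ↦ by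
      rw [mvfderiv_chartFrame hy (mdiffAt_inner (hC1 a _ hqy) (hC1 b _ hqy))]
      have h1 := (((contDiffAt_gram (M := M) hy).differentiableAt (by simp)).hasFDerivAt.clm_apply
        (hasFDerivAt_const (𝕜 := ℝ) a y)).clm_apply (hasFDerivAt_const (𝕜 := ℝ) b y)
      have h2 := congrArg (fun T : E →L[ℝ] ℝ ↦ T d) h1.fderiv
      simp only [add_apply, ContinuousLinearMap.flip_apply, ContinuousLinearMap.comp_apply,
        zero_apply, map_zero, zero_add] at h2
      exact h2
    have hk := inner_leviCivitaFun (hC1 a _ hqy) (hC1 v _ hqy) (hC1 d _ hqy)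
    rw [koszul, hd, hd, hd, mlieBracket_chartFrame hqy, mlieBracket_chartFrame hqy,
      mlieBracket_chartFrame hqy] at hk
    simp only [inner_zero_left, add_zero, sub_zero] at hk
    simp only [Function.comp_apply]
    rw [inner_skewConnection, ← hk]
    rfl
  rw [contMDiffAt_section_iff_chart hq, chart_chartInv hx] at key
  refine key.congr_of_eventuallyEq ?_
  filter_upwards [(isOpen_extChartAt_target p).mem_nhds hx] with y hy
  rw [christoffel_apply _ hy, chartCoord_frame (chartInv_mem hy)]

end ChartConnection

end SkewTorsion

namespace SkewTorsion

/-! ### The cross product of a `G₂`-form -/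

section G2CrossProduct

set_option synthInstance.maxHeartbeats 200000

variable {V : Type*} [NormedAddCommGroup V] [InnerProductSpace ℝ V] [FiniteDimensional ℝ V]

/-- The vector-valued product dual to a trilinear form. -/
def crossOf (φ : V →L[ℝ] V →L[ℝ] V →L[ℝ] ℝ) : V →L[ℝ] V →L[ℝ] V :=
  (ContinuousLinearMap.compL ℝ V (V →L[ℝ] ℝ) V (sharp V)) ∘L φ

theorem inner_crossOf (φ : V →L[ℝ] V →L[ℝ] V →L[ℝ] ℝ) (x y z : V) :
    inner ℝ (crossOf φ x y) z = φ x y z :=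
  inner_sharp V (φ x y) z

omit [FiniteDimensional ℝ V] in
theorem IsG2Form.finrank_eq {φ : V →L[ℝ] V →L[ℝ] V →L[ℝ] ℝ} (h : IsG2Form φ) :
    Module.finrank ℝ V = 7 := by
  obtain ⟨e, -⟩ := h
  rw [Module.finrank_eq_card_basis e.toBasis, Fintype.card_fin]

-- The first two axioms are sums of determinants with two equal columns. The third is a polynomial
-- identity in the coordinates of an adapted orthonormal basis.
set_option maxHeartbeats 1000000 in
theorem IsG2Form.isCrossProduct {φ : V →L[ℝ] V →L[ℝ] V →L[ℝ] ℝ} (h : IsG2Form φ) :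
    IsCrossProduct (crossOf φ) := by
  obtain ⟨e, he⟩ := h
  refine ⟨fun x ↦ ext_inner_right ℝ fun z ↦ ?_, fun x y ↦ ?_, fun x y ↦ ext_inner_right ℝ fun z ↦ ?_⟩
  · rw [inner_crossOf, he, inner_zero_left]
    refine Finset.sum_eq_zero fun i _ ↦ ?_
    rw [Matrix.det_fin_three]
    simp
  · rw [inner_crossOf, he]
    refine Finset.sum_eq_zero fun i _ ↦ ?_
    rw [Matrix.det_fin_three]
    simp
  · have hδ : ∀ i j, inner ℝ (e i) (e j) = if i = j then (1 : ℝ) else 0 :=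
      orthonormal_iff_ite.mp e.orthonormal
    have hc : ∀ i, inner ℝ (e i) (crossOf φ x y) = φ x y (e i) := fun i ↦ by
      rw [real_inner_comm, inner_crossOf]
    have hin : ∀ u v : V, inner ℝ u v = ∑ i, inner ℝ (e i) u * inner ℝ (e i) v := fun u v ↦ by
      rw [← e.sum_inner_mul_inner]
      exact Finset.sum_congr rfl fun i _ ↦ by rw [real_inner_comm u]
    rw [inner_crossOf, he, inner_sub_left, inner_smul_left, inner_smul_left, hin x y, hin x z,
      hin x x, hin y z]
    simp only [hc, he, hδ, Matrix.det_fin_three, Fin.sum_univ_seven]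
    simp [Fin.ext_iff]
    ring

end G2CrossProduct

end SkewTorsion

namespace SkewTorsion

/-! ### Frames parallel along rays -/

section RadialGauge

set_option synthInstance.maxHeartbeats 200000

universe u

variable {E : Type u} [NormedAddCommGroup E] [NormedSpace ℝ E] [FiniteDimensional ℝ E]
  {M : Type*} [TopologicalSpace M] [ChartedSpace E M] [IsManifold 𝓘(ℝ, E) ∞ M]
  (D : CovariantDerivative 𝓘(ℝ, E) E (TangentSpace 𝓘(ℝ, E) : M → Type _))

/-- The frame `k` is parallel along the rays from `x₀`, in the chart at `p`. -/
structure IsRadialGauge (p : M) (x₀ : E) (r : ℝ) (k : E → E →L[ℝ] E) : Prop where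
  pos : 0 < r
  subset : Metric.ball x₀ r ⊆ (extChartAt 𝓘(ℝ, E) p).target
  smooth : ContDiffOn ℝ ∞ k (Metric.ball x₀ r)
  center : k x₀ = 1
  isUnit : ∀ x ∈ Metric.ball x₀ r, IsUnit (k x)
  radial : ∀ x ∈ Metric.ball x₀ r,
    fderiv ℝ k x (x - x₀) = - (christoffel D p x (x - x₀) * k x)

/-- The vector field with constant coefficients `a` in the frame `k`. -/
def gaugeField (p : M) (k : E → E →L[ℝ] E) (a : E) (q : M) : TangentSpace 𝓘(ℝ, E) q :=
  chartFrame p q (k (extChartAt 𝓘(ℝ, E) p q) a)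

namespace IsRadialGauge

variable {D} {p : M} {x₀ : E} {r : ℝ} {k : E → E →L[ℝ] E} (h : IsRadialGauge D p x₀ r k)

include h

theorem mem_center : x₀ ∈ Metric.ball x₀ r := Metric.mem_ball_self h.pos

theorem contDiffAt {x : E} (hx : x ∈ Metric.ball x₀ r) : ContDiffAt ℝ ∞ k x :=
  h.smooth.contDiffAt (Metric.isOpen_ball.mem_nhds hx)

theorem hasFDerivAt {x : E} (hx : x ∈ Metric.ball x₀ r) : HasFDerivAt k (fderiv ℝ k x) x :=
  ((h.contDiffAt hx).differentiableAt (by simp)).hasFDerivAt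

theorem radial_line {x : E} (hx : x ∈ Metric.ball x₀ r) {t : ℝ} (ht : t ≠ 0) {v : E}
    (hv : x - x₀ = t • v) : fderiv ℝ k x v = - (christoffel D p x v * k x) := by
  have h1 := h.radial x hx
  rw [hv, map_smul, map_smul, smul_mul_assoc, ← smul_neg] at h1
  exact smul_right_injective _ ht h1

/-- At the centre the radial equation is void. Its homogeneous form `radial_line` holds at `x₀ + t •
v` for small `t ≠ 0`, and `t → 0` gives the claim. -/
theorem fderiv_center (hΓ : ContinuousAt (christoffel D p) x₀) (v : E) :
    fderiv ℝ k x₀ v = - christoffel D p x₀ v := by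
  have hl : Filter.Tendsto (fun t : ℝ ↦ x₀ + t • v) (nhdsWithin 0 {0}ᶜ) (nhds x₀) := by
    have : ContinuousAt (fun t : ℝ ↦ x₀ + t • v) 0 := by fun_prop
    have h0 := this.tendsto
    rw [zero_smul, add_zero] at h0
    exact h0.mono_left nhdsWithin_le_nhds
  have hk : ContinuousAt (fun x ↦ fderiv ℝ k x v) x₀ :=
    ((h.contDiffAt h.mem_center).fderiv_right (m := ∞) (by simp)).continuousAt.clm_apply
      continuousAt_const
  have hm : ContinuousAt (fun x ↦ - (christoffel D p x v * k x)) x₀ :=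
    ((hΓ.clm_apply continuousAt_const).mul (h.hasFDerivAt h.mem_center).continuousAt).neg
  have c1 := hk.tendsto.comp hl
  have c2 := hm.tendsto.comp hl
  have e : ((fun x ↦ fderiv ℝ k x v) ∘ fun t : ℝ ↦ x₀ + t • v) =ᶠ[nhdsWithin 0 {0}ᶜ]
      (fun x ↦ - (christoffel D p x v * k x)) ∘ fun t : ℝ ↦ x₀ + t • v := by
    filter_upwards [hl.eventually (Metric.isOpen_ball.mem_nhds h.mem_center),
      self_mem_nhdsWithin] with t ht ht0
    exact h.radial_line ht ht0 (by simp)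
  have := tendsto_nhds_unique (c1.congr' e) c2
  rw [h.center, mul_one] at this
  exact this

theorem contMDiffAt_gaugeField {x : E} (hx : x ∈ Metric.ball x₀ r) (a : E) :
    CMDiffAt ∞ (T% (gaugeField (M := M) p k a)) (chartInv p x) := by
  have ht := h.subset hx
  have hq := chartInv_mem ht
  refine contMDiffAt_chartFrame hq (f := fun q ↦ k (extChartAt 𝓘(ℝ, E) p q) a) ?_
  rw [contMDiffAt_iff_chart le_rfl hq, chart_chartInv ht]
  refine ((h.contDiffAt hx).clm_apply contDiffAt_const (g := fun _ ↦ a)).congr_of_eventuallyEq ?_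
  filter_upwards [(isOpen_extChartAt_target p).mem_nhds ht] with y hy
  simp only [Function.comp_apply, chart_chartInv hy]

omit h [FiniteDimensional ℝ E] in
theorem gaugeField_chartInv {p : M} {x : E} (hx : x ∈ (extChartAt 𝓘(ℝ, E) p).target)
    (k : E → E →L[ℝ] E) (a : E) :
    gaugeField p k a (chartInv p x) = chartFrame p (chartInv p x) (k x a) := by
  rw [gaugeField, chart_chartInv hx]

theorem covariantDerivative_gaugeField {x : E} (hx : x ∈ Metric.ball x₀ r) (a v : E) :
    D (gaugeField p k a) (chartInv p x) (chartFrame p (chartInv p x) v) =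
      chartFrame p (chartInv p x) ((fderiv ℝ k x v + christoffel D p x v * k x) a) := by
  have ht := h.subset hx
  rw [covariantDerivative_chart D ht ((h.contMDiffAt_gaugeField hx a).mdifferentiableAt (by simp)),
    gaugeField_chartInv ht, chartCoord_frame (chartInv_mem ht)]
  have e : (fun y ↦ chartCoord (E := E) p (chartInv p y) (gaugeField p k a (chartInv p y)))
      =ᶠ[nhds x] fun y ↦ k y a := by
    filter_upwards [(isOpen_extChartAt_target p).mem_nhds ht] with y hy
    rw [gaugeField_chartInv hy, chartCoord_frame (chartInv_mem hy)]
  have hd := ((h.hasFDerivAt hx).clm_apply (hasFDerivAt_const (𝕜 := ℝ) a x)).fderiv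
  rw [e.fderiv_eq, hd]
  simp

end IsRadialGauge

variable [RiemannianBundle (fun x : M ↦ TangentSpace 𝓘(ℝ, E) x)]
  [IsContMDiffRiemannianBundle 𝓘(ℝ, E) ∞ E (fun x : M ↦ TangentSpace 𝓘(ℝ, E) x)]

theorem exists_isRadialGauge (τ : ThreeForm 𝓘(ℝ, E) M) (p : M) {x₀ : E}
    (hx₀ : x₀ ∈ (extChartAt 𝓘(ℝ, E) p).target) :
    ∃ k r, IsRadialGauge (skewConnection τ) p x₀ r k := by
  obtain ⟨k, r, hr, hsub, hk, hk0, hk'⟩ := exists_radial_gauge (κ := christoffel (skewConnection τ) p)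
    (isOpen_extChartAt_target p)
    (fun x hx ↦ (contDiffAt_christoffel τ hx).contDiffWithinAt) hx₀
  exact ⟨k, r, hr, hsub, hk, hk0, fun x hx ↦ (hk' x hx).1, fun x hx ↦ (hk' x hx).2⟩

/-- The field with constant coefficients in a radial gauge is parallel along the rays. -/
theorem IsRadialGauge.isParallelAlong {τ : ThreeForm 𝓘(ℝ, E) M} {p : M} {x₀ : E} {r : ℝ}
    {k : E → E →L[ℝ] E} (h : IsRadialGauge (skewConnection τ) p x₀ r k) {v : E}
    {μ : ℝ → ℝ} (hμ : ContDiff ℝ ∞ μ) (hv : ∀ t, x₀ + μ t • v ∈ Metric.ball x₀ r) (a : E) :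
    ContMDiff 𝓘(ℝ, ℝ) 𝓘(ℝ, E) ∞ (fun t ↦ chartInv (M := M) p (x₀ + μ t • v)) ∧
    IsParallelAlong (skewConnection τ) (fun t ↦ chartInv p (x₀ + μ t • v))
      (fun t ↦ chartFrame p (chartInv p (x₀ + μ t • v)) (k (x₀ + μ t • v) a)) := by
  have hline : ContDiff ℝ ∞ (fun t ↦ x₀ + μ t • v) := contDiff_const.add (hμ.smul contDiff_const)
  refine ⟨fun t ↦ (contMDiffAt_chartInv (h.subset (hv t))).comp t hline.contMDiff.contMDiffAt, ?_⟩
  intro t Y hY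
  have hx := hv t
  have ht := h.subset hx
  set x := x₀ + μ t • v with hxdef
  have hμt : HasDerivAt (fun t ↦ x₀ + μ t • v) (deriv μ t • v) t :=
    ((hμ.differentiable (by simp) t).hasDerivAt.smul_const v).const_add x₀
  have hZ := (h.contMDiffAt_gaugeField hx a).mdifferentiableAt (by simp)
  have hY1 : MDiffAt (T% Y) (chartInv p x) := hY.mdifferentiableAt (by simp)
  have hf := mdiffAt_inner hZ hY1
  have hfd : DifferentiableAt ℝ ((fun q ↦ inner ℝ (gaugeField p k a q) (Y q)) ∘ chartInv p) x := by
    have := (mdifferentiableAt_iff_chart (chartInv_mem ht)).mp hf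
    rwa [chart_chartInv ht] at this
  have hder := hfd.hasFDerivAt.comp_hasDerivAt t hμt
  have hγ : mfderiv 𝓘(ℝ, ℝ) 𝓘(ℝ, E) (fun t ↦ chartInv (M := M) p (x₀ + μ t • v)) t (1 : ℝ) =
      chartFrame p (chartInv p x) (deriv μ t • v) := by
    have h1 := (hasMFDerivAt_chartInv ht).comp t hμt.hasFDerivAt.hasMFDerivAt
    have h2 := congrArg (fun T ↦ T (1 : ℝ)) h1.mfderiv
    refine h2.trans ?_
    change chartFrame p (chartInv p x) ((1 : ℝ) • deriv μ t • v) = _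
    rw [one_smul]
  have hrad : skewConnection τ (gaugeField p k a) (chartInv p x)
      (chartFrame p (chartInv p x) (deriv μ t • v)) = 0 := by
    rw [h.covariantDerivative_gaugeField hx]
    -- Where the path passes through the centre, `fderiv_center` replaces the radial equation.
    have : fderiv ℝ k x v = - (christoffel (skewConnection τ) p x v * k x) := by
      by_cases h0 : μ t = 0
      · have e : x = x₀ := by rw [hxdef, h0, zero_smul, add_zero]
        rw [e, h.fderiv_center (contDiffAt_christoffel τ (h.subset h.mem_center)).continuousAt,
          h.center, mul_one]
      · exact h.radial_line hx h0 (by rw [hxdef]; abel)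
    rw [map_smul, map_smul, this]
    simp
  have hval : inner ℝ (chartFrame p (chartInv p x) (k x a)) (skewConnection τ Y (chartInv p x)
      (mfderiv 𝓘(ℝ, ℝ) 𝓘(ℝ, E) (fun t ↦ chartInv (M := M) p (x₀ + μ t • v)) t (1 : ℝ))) =
      fderiv ℝ ((fun q ↦ inner ℝ (gaugeField p k a q) (Y q)) ∘ chartInv p) x (deriv μ t • v) := by
    rw [← mvfderiv_chartFrame ht hf, skewConnection_metric τ hZ hY1, hrad, inner_zero_left, zero_add,
      hγ, IsRadialGauge.gaugeField_chartInv ht]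
  change HasDerivAt _ (inner ℝ (chartFrame p (chartInv p x) (k x a))
    (skewConnection τ Y (chartInv p x) _)) t
  rw [hval]
  refine hder.congr_of_eventuallyEq (Filter.Eventually.of_forall fun s ↦ ?_)
  simp only [Function.comp_apply, IsRadialGauge.gaugeField_chartInv (h.subset (hv s))]

end RadialGauge

end SkewTorsion

namespace SkewTorsion

/-! ### The connection form lies in the holonomy algebra -/

section RadialHolonomy

set_option synthInstance.maxHeartbeats 200000

universe u

variable {E : Type u} [NormedAddCommGroup E] [NormedSpace ℝ E] [FiniteDimensional ℝ E]
  {M : Type*} [TopologicalSpace M] [ChartedSpace E M] [IsManifold 𝓘(ℝ, E) ∞ M]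
  [RiemannianBundle (fun x : M ↦ TangentSpace 𝓘(ℝ, E) x)]
  [IsContMDiffRiemannianBundle 𝓘(ℝ, E) ∞ E (fun x : M ↦ TangentSpace 𝓘(ℝ, E) x)]
  {τ : ThreeForm 𝓘(ℝ, E) M} {p : M} {x₀ : E} {r : ℝ} {k : E → E →L[ℝ] E}

namespace IsRadialGauge

variable (h : IsRadialGauge (skewConnection τ) p x₀ r k)

include h

theorem apply_inverse {x : E} (hx : x ∈ Metric.ball x₀ r) (v : E) :
    k x (Ring.inverse (k x) v) = v := by
  have := Ring.mul_inverse_cancel _ (h.isUnit x hx)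
  exact congrArg (fun T : E →L[ℝ] E ↦ T v) this

theorem inverse_apply {x : E} (hx : x ∈ Metric.ball x₀ r) (v : E) :
    Ring.inverse (k x) (k x v) = v := by
  have := Ring.inverse_mul_cancel _ (h.isUnit x hx)
  exact congrArg (fun T : E →L[ℝ] E ↦ T v) this

theorem isParallelTransport_ray {v : E} {μ : ℝ → ℝ} (hμ : ContDiff ℝ ∞ μ)
    (hv : ∀ t, x₀ + μ t • v ∈ Metric.ball x₀ r) {y z : E} (hy : x₀ + μ 0 • v = y)
    (hz : x₀ + μ 1 • v = z) :
    IsParallelTransport (skewConnection τ) (chartInv p y) (chartInv p z)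
      (chartFrame p (chartInv p z) ∘L (k z * Ring.inverse (k y)) ∘L chartCoord p (chartInv p y)) := by
  subst hy hz
  refine IsParallelTransport.smooth (fun t ↦ chartInv p (x₀ + μ t • v))
    (h.isParallelAlong hμ hv 0).1 _ fun w ↦ ?_
  refine ⟨_, (h.isParallelAlong hμ hv (Ring.inverse (k (x₀ + μ 0 • v))
    (chartCoord p (chartInv p (x₀ + μ 0 • v)) w))).2, ?_, rfl⟩
  rw [h.apply_inverse (hv 0), chartFrame_coord (chartInv_mem (h.subset (hv 0)))]

-- Parallel transport is defined with curves on all of `ℝ`. `Real.smoothTransition` has values in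
-- `[0, 1]`, so the reparametrized ray never leaves the ball.
omit h [FiniteDimensional ℝ E] in
theorem ray_mem_ball {x₀ y : E} {r : ℝ} (hy : y ∈ Metric.ball x₀ r) (t : ℝ) :
    x₀ + Real.smoothTransition t • (y - x₀) ∈ Metric.ball x₀ r := by
  have h0 := Real.smoothTransition.nonneg t
  have h1 := Real.smoothTransition.le_one t
  rw [mem_ball_iff_norm] at hy ⊢
  rw [add_sub_cancel_left, norm_smul, Real.norm_of_nonneg h0]
  calc _ ≤ 1 * ‖y - x₀‖ := by gcongr
    _ < r := by rwa [one_mul]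

theorem isParallelTransport_out {y : E} (hy : y ∈ Metric.ball x₀ r) :
    IsParallelTransport (skewConnection τ) (chartInv p x₀) (chartInv p y)
      (chartFrame p (chartInv p y) ∘L k y ∘L chartCoord p (chartInv p x₀)) := by
  have := h.isParallelTransport_ray (v := y - x₀) Real.smoothTransition.contDiff
    (ray_mem_ball hy) (y := x₀) (z := y) (by simp) (by simp)
  rwa [h.center, Ring.inverse_one, mul_one] at this

theorem isParallelTransport_back {y : E} (hy : y ∈ Metric.ball x₀ r) :
    IsParallelTransport (skewConnection τ) (chartInv p y) (chartInv p x₀)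
      (chartFrame p (chartInv p x₀) ∘L Ring.inverse (k y) ∘L chartCoord p (chartInv p y)) := by
  have := h.isParallelTransport_ray (v := y - x₀) (μ := fun t ↦ Real.smoothTransition (1 - t))
    (Real.smoothTransition.contDiff.comp (contDiff_const.sub contDiff_id))
    (fun t ↦ ray_mem_ball hy (1 - t)) (y := y) (z := x₀) (by simp) (by simp)
  rwa [h.center, one_mul] at this

/-- The loop runs from `x₀` to `y` and back from `z` to `x₀` along rays of the first gauge, and from
`y` to `z` along a ray of a second gauge centred at `y`. -/
theorem isParallelTransport_triangle {y z : E} (hy : y ∈ Metric.ball x₀ r)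
    (hz : z ∈ Metric.ball x₀ r) {r' : ℝ} {k' : E → E →L[ℝ] E}
    (h' : IsRadialGauge (skewConnection τ) p y r' k') (hz' : z ∈ Metric.ball y r') :
    IsParallelTransport (skewConnection τ) (chartInv p x₀) (chartInv p x₀)
      (chartFrame p (chartInv p x₀) ∘L (Ring.inverse (k z) * k' z * k y) ∘L
        chartCoord p (chartInv p x₀)) := by
  have := ((h.isParallelTransport_out hy).comp (h'.isParallelTransport_out hz')).comp
    (h.isParallelTransport_back hz)
  convert this using 1
  ext w
  simp [chartCoord_frame (chartInv_mem (h.subset hz)), chartCoord_frame (chartInv_mem (h.subset hy))]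

theorem hasFDerivAt_inverse {x : E} (hx : x ∈ Metric.ball x₀ r) (v : E) :
    fderiv ℝ (fun y ↦ Ring.inverse (k y)) x v =
      - (Ring.inverse (k x) * fderiv ℝ k x v * Ring.inverse (k x)) ∧
      ContDiffAt ℝ ∞ (fun y ↦ Ring.inverse (k y)) x := by
  obtain ⟨u, hu⟩ := h.isUnit x hx
  have h1 : HasFDerivAt Ring.inverse
      (- ContinuousLinearMap.mulLeftRight ℝ (E →L[ℝ] E) ↑u⁻¹ ↑u⁻¹) (k x) :=
    hu ▸ hasFDerivAt_ringInverse (𝕜 := ℝ) u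
  have h2 := (h1.comp x (h.hasFDerivAt hx)).fderiv
  have h3 : ContDiffAt ℝ ∞ Ring.inverse (k x) := hu ▸ contDiffAt_ringInverse ℝ u
  refine ⟨?_, h3.comp x (h.contDiffAt hx)⟩
  have h4 := congrArg (fun T : E →L[ℝ] E →L[ℝ] E ↦ T v) h2
  rw [← hu, Ring.inverse_unit]
  exact h4

end IsRadialGauge

/-- The holonomy algebra contains the values of the connection form in a radial gauge. -/
theorem IsRadialGauge.exists_mem_holonomyAlgebra
    (h : IsRadialGauge (skewConnection τ) p (extChartAt 𝓘(ℝ, E) p p) r k) {x : E}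
    (hx : x ∈ Metric.ball (extChartAt 𝓘(ℝ, E) p p) r) (v : E) :
    ∃ ε : ℝ, ε ≠ 0 ∧ ε • (chartFrame p p ∘L (Ring.inverse (k x) *
      (fderiv ℝ k x v + christoffel (skewConnection τ) p x v * k x)) ∘L chartCoord p p) ∈
        holonomyAlgebra (skewConnection τ) p := by
  obtain ⟨k', r', h'⟩ := exists_isRadialGauge τ p (h.subset hx)
  have hp : p ∈ (chartAt E p).source := mem_chart_source E p
  have hev : ∀ᶠ b : ℝ in nhds 0, x + b • v ∈ Metric.ball (extChartAt 𝓘(ℝ, E) p p) r ∩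
      Metric.ball x r' := by
    have hc : ContinuousAt (fun b : ℝ ↦ x + b • v) 0 := by fun_prop
    refine hc.eventually ((Metric.isOpen_ball.inter Metric.isOpen_ball).mem_nhds ?_)
    simpa using ⟨hx, h'.pos⟩
  obtain ⟨δ, hδ, hball⟩ := Metric.eventually_nhds_iff.mp hev
  let ε := δ / 2
  have hε : 0 < ε := half_pos hδ
  -- The sine keeps the third vertex within reach for all `t`, while `l` still has velocity `ε • v`
  -- at `0`.
  let l : ℝ → E := fun t ↦ x + (ε * Real.sin t) • v
  have hl : ∀ t, l t ∈ Metric.ball (extChartAt 𝓘(ℝ, E) p p) r ∩ Metric.ball x r' := fun t ↦ by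
    refine hball ?_
    rw [dist_zero_right, norm_mul, Real.norm_of_nonneg hε.le]
    calc ε * ‖Real.sin t‖ ≤ ε * 1 := by gcongr; exact Real.abs_sin_le_one t
      _ < δ := by rw [mul_one]; exact half_lt_self hδ
  have hl0 : l 0 = x := by simp [l]
  have hlc : ContDiff ℝ ∞ l :=
    contDiff_const.add ((contDiff_const.mul (Real.contDiff_sin)).smul contDiff_const)
  have hld : HasDerivAt l (ε • v) 0 := by
    have := (((Real.hasDerivAt_sin 0).const_mul ε).smul_const v).const_add x
    exact this.congr_deriv (by simp)
  let n : ℝ → E →L[ℝ] E := fun t ↦ Ring.inverse (k (l t)) * k' (l t) * k x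
  have hn : ContDiff ℝ ∞ n := contDiff_iff_contDiffAt.mpr fun t ↦
    ((((h.hasFDerivAt_inverse (hl t).1 0).2.comp t hlc.contDiffAt).mul
      ((h'.contDiffAt (hl t).2).comp t hlc.contDiffAt)).mul contDiffAt_const)
  -- Differentiating `(k l)⁻¹` produces the derivative of `k`; differentiating `k'` at its own
  -- centre produces the Christoffel symbol by `fderiv_center`. Together they form the connection
  -- form of the gauge.
  have hnd : HasDerivAt n (- ε • (Ring.inverse (k x) *
      (fderiv ℝ k x v + christoffel (skewConnection τ) p x v * k x))) 0 := by
    have hx' : l 0 ∈ Metric.ball (extChartAt 𝓘(ℝ, E) p p) r := by rwa [hl0]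
    have h1 := (((h.hasFDerivAt_inverse hx' 0).2.differentiableAt
      (by simp)).hasFDerivAt.comp_hasDerivAt 0 hld)
    have h2 := (h'.hasFDerivAt (x := l 0) (by rw [hl0]; exact h'.mem_center)).comp_hasDerivAt 0 hld
    have h3 := (h1.mul h2).mul_const (k x)
    refine h3.congr_deriv ?_
    simp only [Function.comp_apply]
    rw [(h.hasFDerivAt_inverse hx' _).1]
    simp only [hl0, h'.center, map_smul]
    rw [h'.fderiv_center (contDiffAt_christoffel τ (h.subset hx)).continuousAt]
    have hk : Ring.inverse (k x) * k x = 1 := Ring.inverse_mul_cancel _ (h.isUnit x hx)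
    simp only [mul_one, add_mul, mul_add, smul_add, neg_mul, mul_neg, smul_mul_assoc,
      mul_smul_comm, neg_smul, smul_neg, mul_assoc, hk]
  refine ⟨- ε, neg_ne_zero.mpr hε.ne', ?_⟩
  refine ⟨fun t ↦ chartFrame p p ∘L n t ∘L chartCoord p p, ?_, ?_, fun t ↦ ?_, ?_⟩
  · exact (contDiff_const.clm_comp (hn.clm_comp contDiff_const)).of_le
      (WithTop.coe_le_coe.mpr (le_top : (1 : ℕ∞) ≤ ⊤))
  · have : n 0 = 1 := by
      simp only [n, hl0, h'.center, mul_one]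
      exact Ring.inverse_mul_cancel _ (h.isUnit x hx)
    ext w
    simp [this, chartFrame_coord hp]
  · have := h.isParallelTransport_triangle hx (hl t).1 h' (hl t).2
    rw [chartInv_chart hp] at this
    exact this
  · have := (hasDerivAt_const (0 : ℝ) (chartFrame (E := E) p p)).clm_comp
      (hnd.clm_comp (hasDerivAt_const (0 : ℝ) (chartCoord (E := E) p p)))
    refine this.congr_deriv ?_
    ext w
    simp

end RadialHolonomy

end SkewTorsion

namespace SkewTorsion

/-! ### A radial gauge solves the structure equations -/

section CartanGauge

set_option synthInstance.maxHeartbeats 200000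

universe u

variable {E : Type u} [NormedAddCommGroup E] [NormedSpace ℝ E] [FiniteDimensional ℝ E]
  {M : Type*} [TopologicalSpace M] [ChartedSpace E M] [IsManifold 𝓘(ℝ, E) ∞ M]

theorem contDiffAt_conjugate {E F : Type*} [NormedAddCommGroup E] [NormedSpace ℝ E]
    [FiniteDimensional ℝ E] [NormedAddCommGroup F] [NormedSpace ℝ F] {S : E → E →L[ℝ] F} {x : E}
    (hS : ContDiffAt ℝ ∞ S x) (C : F →L[ℝ] E) {N : E → E →L[ℝ] E →L[ℝ] E}
    (hN : ContDiffAt ℝ ∞ N x) :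
    ContDiffAt ℝ ∞ (fun x ↦ (ContinuousLinearMap.compL ℝ F E F (S x)) ∘L
      ((ContinuousLinearMap.compL ℝ F E E).flip C) ∘L N x) x :=
  contDiffAt_clm_of_apply fun _ ↦
    hS.clm_comp ((hN.clm_apply contDiffAt_const).clm_comp contDiffAt_const)

section Defs

variable [RiemannianBundle (fun x : M ↦ TangentSpace 𝓘(ℝ, E) x)]
  (D : CovariantDerivative 𝓘(ℝ, E) E (TangentSpace 𝓘(ℝ, E) : M → Type _))
  (p : M) (k : E → E →L[ℝ] E) (x : E)

omit [FiniteDimensional ℝ E] [RiemannianBundle (fun x : M ↦ TangentSpace 𝓘(ℝ, E) x)] in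
/-- The frame of a gauge, in coordinates, modelled on the tangent space at `p`. -/
def gaugeFrame : TangentSpace 𝓘(ℝ, E) p →L[ℝ] E := k x ∘L chartCoord p p

omit [FiniteDimensional ℝ E] [RiemannianBundle (fun x : M ↦ TangentSpace 𝓘(ℝ, E) x)] in
/-- The soldering form of a gauge. -/
def gaugeSolder : E →L[ℝ] TangentSpace 𝓘(ℝ, E) p := chartFrame p p ∘L Ring.inverse (k x)

/-- The connection form of a gauge. -/
def gaugeConn : E →L[ℝ] TangentSpace 𝓘(ℝ, E) p →L[ℝ] TangentSpace 𝓘(ℝ, E) p :=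
  (ContinuousLinearMap.compL ℝ (TangentSpace 𝓘(ℝ, E) p) E (TangentSpace 𝓘(ℝ, E) p)
    (gaugeSolder p k x)) ∘L
  ((ContinuousLinearMap.compL ℝ (TangentSpace 𝓘(ℝ, E) p) E E).flip (chartCoord p p)) ∘L
  (fderiv ℝ k x + (ContinuousLinearMap.compL ℝ E E E).flip (k x) ∘L christoffel D p x)

theorem gaugeConn_apply (v : E) (a : TangentSpace 𝓘(ℝ, E) p) : gaugeConn D p k x v a =
    chartFrame p p (Ring.inverse (k x) ((fderiv ℝ k x v + christoffel D p x v * k x)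
      (chartCoord p p a))) := rfl

end Defs

variable [RiemannianBundle (fun x : M ↦ TangentSpace 𝓘(ℝ, E) x)]
  [IsContMDiffRiemannianBundle 𝓘(ℝ, E) ∞ E (fun x : M ↦ TangentSpace 𝓘(ℝ, E) x)]
  {τ : ThreeForm 𝓘(ℝ, E) M} {p : M} {r : ℝ} {k : E → E →L[ℝ] E}

-- The mean value theorem on the ray from `x₀` to `x`.
omit [FiniteDimensional ℝ E] in
theorem eq_center_of_radial {x₀ : E} {f : E → ℝ} (hf : ∀ x ∈ Metric.ball x₀ r, DifferentiableAt ℝ f x)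
    (hrad : ∀ x ∈ Metric.ball x₀ r, fderiv ℝ f x (x - x₀) = 0) {x : E}
    (hx : x ∈ Metric.ball x₀ r) : f x = f x₀ := by
  have hmem : ∀ t ∈ Set.Icc (0 : ℝ) 1, x₀ + t • (x - x₀) ∈ Metric.ball x₀ r := by
    intro t ht
    rw [mem_ball_iff_norm] at hx ⊢
    rw [add_sub_cancel_left, norm_smul, Real.norm_of_nonneg ht.1]
    calc _ ≤ 1 * ‖x - x₀‖ := by gcongr; exact ht.2
      _ < r := by rwa [one_mul]
  have hd : ∀ t ∈ Set.Icc (0 : ℝ) 1, HasDerivAt (fun t : ℝ ↦ f (x₀ + t • (x - x₀)))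
      (fderiv ℝ f (x₀ + t • (x - x₀)) (x - x₀)) t := by
    intro t ht
    have h1 : HasDerivAt (fun t : ℝ ↦ x₀ + t • (x - x₀)) ((1 : ℝ) • (x - x₀)) t :=
      ((hasDerivAt_id t).smul_const (x - x₀)).const_add x₀
    rw [one_smul] at h1
    exact (hf _ (hmem t ht)).hasFDerivAt.comp_hasDerivAt t h1
  obtain ⟨t, ht, h1⟩ := exists_hasDerivAt_eq_slope _ _ zero_lt_one
    (fun t ht ↦ (hd t ht).continuousAt.continuousWithinAt)
    (fun t ht ↦ hd t ⟨ht.1.le, ht.2.le⟩)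
  have h2 := hrad _ (hmem t ⟨ht.1.le, ht.2.le⟩)
  rw [add_sub_cancel_left, map_smul, smul_eq_mul] at h2
  rw [(mul_eq_zero.mp h2).resolve_left ht.1.ne'] at h1
  simp only [one_smul, zero_smul, add_zero, add_sub_cancel, sub_zero, div_one] at h1
  linarith

namespace IsRadialGauge

variable (h : IsRadialGauge (skewConnection τ) p (extChartAt 𝓘(ℝ, E) p p) r k)

include h

theorem covariantDerivative_gaugeField' {x : E} (hx : x ∈ Metric.ball (extChartAt 𝓘(ℝ, E) p p) r)
    (a : TangentSpace 𝓘(ℝ, E) p) (v : E) :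
    skewConnection τ (gaugeField p k (chartCoord p p a)) (chartInv p x)
      (chartFrame p (chartInv p x) v) = gaugeField p k (chartCoord p p
        (gaugeConn (skewConnection τ) p k x v a)) (chartInv p x) := by
  rw [h.covariantDerivative_gaugeField hx, gaugeField_chartInv (h.subset hx), gaugeConn_apply,
    chartCoord_frame (mem_chart_source E p), h.apply_inverse hx]

theorem gaugeConn_radial {x : E} (hx : x ∈ Metric.ball (extChartAt 𝓘(ℝ, E) p p) r) :
    gaugeConn (skewConnection τ) p k x (x - extChartAt 𝓘(ℝ, E) p p) = 0 := by
  ext a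
  rw [gaugeConn_apply, h.radial x hx]
  simp

theorem gaugeField_center (a : TangentSpace 𝓘(ℝ, E) p) :
    gaugeField p k (chartCoord p p a) p = a := by
  rw [gaugeField, h.center]
  exact chartFrame_coord (mem_chart_source E p) a

theorem fderiv_inner_gaugeField {x : E} (hx : x ∈ Metric.ball (extChartAt 𝓘(ℝ, E) p p) r)
    (a b : TangentSpace 𝓘(ℝ, E) p) :
    DifferentiableAt ℝ ((fun q ↦ inner ℝ (gaugeField p k (chartCoord p p a) q)
        (gaugeField p k (chartCoord p p b) q)) ∘ chartInv p) x ∧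
    ∀ v, fderiv ℝ ((fun q ↦ inner ℝ (gaugeField p k (chartCoord p p a) q)
        (gaugeField p k (chartCoord p p b) q)) ∘ chartInv p) x v =
      inner ℝ (gaugeField p k (chartCoord p p (gaugeConn (skewConnection τ) p k x v a))
          (chartInv p x)) (gaugeField p k (chartCoord p p b) (chartInv p x)) +
        inner ℝ (gaugeField p k (chartCoord p p a) (chartInv p x))
          (gaugeField p k (chartCoord p p (gaugeConn (skewConnection τ) p k x v b))
            (chartInv p x)) := by
  have hm : ∀ a, MDiffAt (T% (gaugeField (M := M) p k a)) (chartInv p x) := fun a ↦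
    (h.contMDiffAt_gaugeField hx a).mdifferentiableAt (by simp)
  have hd := mdiffAt_inner (hm (chartCoord p p a)) (hm (chartCoord p p b))
  refine ⟨?_, fun v ↦ ?_⟩
  · have := (mdifferentiableAt_iff_chart (chartInv_mem (h.subset hx))).mp hd
    rwa [chart_chartInv (h.subset hx)] at this
  · rw [← mvfderiv_chartFrame (h.subset hx) hd, skewConnection_metric τ (hm _) (hm _),
      h.covariantDerivative_gaugeField' hx, h.covariantDerivative_gaugeField' hx]

/-- The connection is metric and its form vanishes radially, so inner products of gauge fields are
constant along rays. -/
theorem inner_gaugeField {x : E} (hx : x ∈ Metric.ball (extChartAt 𝓘(ℝ, E) p p) r)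
    (a b : TangentSpace 𝓘(ℝ, E) p) :
    inner ℝ (gaugeField p k (chartCoord p p a) (chartInv p x))
      (gaugeField p k (chartCoord p p b) (chartInv p x)) = inner ℝ a b := by
  have := eq_center_of_radial (fun x hx ↦ (h.fderiv_inner_gaugeField hx a b).1)
    (fun x hx ↦ by
      rw [(h.fderiv_inner_gaugeField hx a b).2, h.gaugeConn_radial hx]
      simp [gaugeField]) hx
  simp only [Function.comp_apply] at this
  rw [chartInv_chart (mem_chart_source E p)] at this
  simpa only [h.gaugeField_center] using this

theorem gaugeConn_skew {x : E} (hx : x ∈ Metric.ball (extChartAt 𝓘(ℝ, E) p p) r) (v : E)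
    (a b : TangentSpace 𝓘(ℝ, E) p) :
    inner ℝ (gaugeConn (skewConnection τ) p k x v a) b =
      - inner ℝ a (gaugeConn (skewConnection τ) p k x v b) := by
  have h1 := (h.fderiv_inner_gaugeField hx a b).2 v
  have e : ((fun q ↦ inner ℝ (gaugeField p k (chartCoord p p a) q)
        (gaugeField p k (chartCoord p p b) q)) ∘ chartInv p) =ᶠ[nhds x] fun _ ↦ inner ℝ a b := by
    filter_upwards [Metric.isOpen_ball.mem_nhds hx] with y hy
    exact h.inner_gaugeField hy a b
  rw [h.inner_gaugeField hx, h.inner_gaugeField hx, e.fderiv_eq] at h1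
  simp at h1
  linarith

variable {φ : ThreeForm 𝓘(ℝ, E) M} {c : ℝ} (hc : c ≠ 0) (hpar : HasParallelSkewTorsion τ)
  (hφ : ∀ (q : M) (X Y Z : TangentSpace 𝓘(ℝ, E) q), τ q X Y Z = c * φ q X Y Z)

include hpar in
theorem fderiv_torsion_gaugeField {x : E} (hx : x ∈ Metric.ball (extChartAt 𝓘(ℝ, E) p p) r)
    (a b d : TangentSpace 𝓘(ℝ, E) p) :
    DifferentiableAt ℝ ((fun q ↦ τ q (gaugeField p k (chartCoord p p a) q)
        (gaugeField p k (chartCoord p p b) q) (gaugeField p k (chartCoord p p d) q)) ∘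
          chartInv p) x ∧
    ∀ v, fderiv ℝ ((fun q ↦ τ q (gaugeField p k (chartCoord p p a) q)
        (gaugeField p k (chartCoord p p b) q) (gaugeField p k (chartCoord p p d) q)) ∘
          chartInv p) x v =
      τ (chartInv p x) (gaugeField p k (chartCoord p p (gaugeConn (skewConnection τ) p k x v a))
          (chartInv p x)) (gaugeField p k (chartCoord p p b) (chartInv p x))
          (gaugeField p k (chartCoord p p d) (chartInv p x)) +
      τ (chartInv p x) (gaugeField p k (chartCoord p p a) (chartInv p x))
          (gaugeField p k (chartCoord p p (gaugeConn (skewConnection τ) p k x v b))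
          (chartInv p x)) (gaugeField p k (chartCoord p p d) (chartInv p x)) +
      τ (chartInv p x) (gaugeField p k (chartCoord p p a) (chartInv p x))
          (gaugeField p k (chartCoord p p b) (chartInv p x))
          (gaugeField p k (chartCoord p p (gaugeConn (skewConnection τ) p k x v d))
          (chartInv p x)) := by
  have hs : ∀ a, CMDiffAt ∞ (T% (gaugeField (M := M) p k a)) (chartInv p x) :=
    h.contMDiffAt_gaugeField hx
  have hm : ∀ a, MDiffAt (T% (gaugeField (M := M) p k a)) (chartInv p x) := fun a ↦
    (hs a).mdifferentiableAt (by simp)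
  have hd := (τ.smooth _ _ _ _ (hs (chartCoord p p a)) (hs (chartCoord p p b))
    (hs (chartCoord p p d))).mdifferentiableAt (by simp)
  refine ⟨?_, fun v ↦ ?_⟩
  · have := (mdifferentiableAt_iff_chart (chartInv_mem (h.subset hx))).mp hd
    rwa [chart_chartInv (h.subset hx)] at this
  · rw [← mvfderiv_chartFrame (h.subset hx) hd, hpar _ _ _ _ (hm _) (hm _) (hm _),
      h.covariantDerivative_gaugeField' hx, h.covariantDerivative_gaugeField' hx,
      h.covariantDerivative_gaugeField' hx]

-- The same argument for `τ`; here `∇^τ τ = 0` enters.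
include hpar in
theorem torsion_gaugeField {x : E} (hx : x ∈ Metric.ball (extChartAt 𝓘(ℝ, E) p p) r)
    (a b d : TangentSpace 𝓘(ℝ, E) p) :
    τ (chartInv p x) (gaugeField p k (chartCoord p p a) (chartInv p x))
      (gaugeField p k (chartCoord p p b) (chartInv p x))
      (gaugeField p k (chartCoord p p d) (chartInv p x)) = τ p a b d := by
  have := eq_center_of_radial (fun x hx ↦ (h.fderiv_torsion_gaugeField hpar hx a b d).1)
    (fun x hx ↦ by
      rw [(h.fderiv_torsion_gaugeField hpar hx a b d).2, h.gaugeConn_radial hx]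
      simp [gaugeField]) hx
  simp only [Function.comp_apply] at this
  rw [chartInv_chart (mem_chart_source E p)] at this
  simpa only [h.gaugeField_center] using this

include hpar in
theorem gaugeConn_torsion {x : E} (hx : x ∈ Metric.ball (extChartAt 𝓘(ℝ, E) p p) r) (v : E)
    (a b d : TangentSpace 𝓘(ℝ, E) p) :
    τ p (gaugeConn (skewConnection τ) p k x v a) b d +
      τ p a (gaugeConn (skewConnection τ) p k x v b) d +
      τ p a b (gaugeConn (skewConnection τ) p k x v d) = 0 := by
  have h1 := (h.fderiv_torsion_gaugeField hpar hx a b d).2 v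
  have e : ((fun q ↦ τ q (gaugeField p k (chartCoord p p a) q)
        (gaugeField p k (chartCoord p p b) q) (gaugeField p k (chartCoord p p d) q)) ∘
        chartInv p) =ᶠ[nhds x] fun _ ↦ τ p a b d := by
    filter_upwards [Metric.isOpen_ball.mem_nhds hx] with y hy
    exact h.torsion_gaugeField hpar hy a b d
  rw [h.torsion_gaugeField hpar hx, h.torsion_gaugeField hpar hx, h.torsion_gaugeField hpar hx,
    e.fderiv_eq] at h1
  rw [← h1]
  simp

-- The derivation property is the derivative of the constancy of `τ` in the gauge, divided by `c`.
include hc hpar hφ in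
theorem gaugeConn_skewDer {x : E} (hx : x ∈ Metric.ball (extChartAt 𝓘(ℝ, E) p p) r) (v : E) :
    IsSkewDerivation (crossOf (φ p)) (gaugeConn (skewConnection τ) p k x v) where
  skew := h.gaugeConn_skew hx v
  leibniz a b := by
    refine ext_inner_right ℝ fun d ↦ ?_
    rw [h.gaugeConn_skew hx, inner_add_left, inner_crossOf, inner_crossOf, inner_crossOf]
    have h1 := h.gaugeConn_torsion hpar hx v a b d
    rw [hφ, hφ, hφ, ← mul_add, ← mul_add] at h1
    have h2 := (mul_eq_zero.mp h1).resolve_left hc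
    linarith

theorem contDiffAt_solder {x : E} (hx : x ∈ Metric.ball (extChartAt 𝓘(ℝ, E) p p) r) :
    ContDiffAt ℝ ∞ (gaugeSolder (M := M) p k) x :=
  contDiffAt_const.clm_comp (h.hasFDerivAt_inverse hx 0).2

theorem fderiv_solder {x : E} (hx : x ∈ Metric.ball (extChartAt 𝓘(ℝ, E) p p) r) (u v : E) :
    fderiv ℝ (gaugeSolder (M := M) p k) x u v =
      - gaugeSolder p k x (fderiv ℝ k x u (Ring.inverse (k x) v)) := by
  have h1 := (hasFDerivAt_const (𝕜 := ℝ) (chartFrame (E := E) p p) x).clm_comp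
    ((h.hasFDerivAt_inverse hx 0).2.differentiableAt (by simp)).hasFDerivAt
  have h2 : fderiv ℝ (gaugeSolder (M := M) p k) x = _ := h1.fderiv
  rw [h2]
  have h3 := (h.hasFDerivAt_inverse hx u).1
  simp [h3, gaugeSolder]

/-- The derivatives of `k` cancel. The torsion of the gauge is thus the antisymmetrized Christoffel
symbol. -/
theorem solder_christoffel {x : E} (hx : x ∈ Metric.ball (extChartAt 𝓘(ℝ, E) p p) r) (u v : E) :
    fderiv ℝ (gaugeSolder (M := M) p k) x u v +
      gaugeConn (skewConnection τ) p k x u (gaugeSolder p k x v) =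
      gaugeSolder p k x (christoffel (skewConnection τ) p x u v) := by
  have e : chartCoord p p (gaugeSolder (M := M) p k x v) = Ring.inverse (k x) v :=
    chartCoord_frame (mem_chart_source E p) _
  have hs : ∀ w, gaugeSolder (M := M) p k x w = chartFrame p p (Ring.inverse (k x) w) :=
    fun _ ↦ rfl
  rw [h.fderiv_solder hx, gaugeConn_apply, e, ← hs, add_apply, mul_apply_eq_comp,
    h.apply_inverse hx, map_add, neg_add_cancel_left]

theorem gaugeField_solder {x : E} (hx : x ∈ Metric.ball (extChartAt 𝓘(ℝ, E) p p) r) (v : E) :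
    gaugeField p k (chartCoord p p (gaugeSolder p k x v)) (chartInv p x) =
      chartFrame p (chartInv p x) v := by
  have e : chartCoord p p (gaugeSolder (M := M) p k x v) = Ring.inverse (k x) v :=
    chartCoord_frame (mem_chart_source E p) _
  rw [gaugeField_chartInv (h.subset hx), e, h.apply_inverse hx]

include hc hpar hφ in
/-- A radial gauge centred at `p` solves Cartan's structure equations. -/
theorem isCartanGauge : IsCartanGauge (crossOf (φ p)) c (Metric.ball (extChartAt 𝓘(ℝ, E) p p) r)
    (gaugeFrame p k) (gaugeSolder p k) (gaugeConn (skewConnection τ) p k) where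
  isOpen := Metric.isOpen_ball
  smooth_solder := fun x hx ↦ (h.contDiffAt_solder hx).contDiffWithinAt
  smooth_conn := fun x hx ↦ by
    exact (contDiffAt_conjugate (h.contDiffAt_solder hx) (chartCoord p p)
      (((h.contDiffAt hx).fderiv_right (m := ∞) (by simp)).add
        (contDiffAt_clm_of_apply fun _ ↦ ((contDiffAt_christoffel τ (h.subset hx)).clm_apply
          contDiffAt_const).clm_comp (h.contDiffAt hx)))).contDiffWithinAt
  solder_frame x hx a := by
    change chartFrame p p (Ring.inverse (k x) (k x (chartCoord p p a))) = a
    rw [h.inverse_apply hx, chartFrame_coord (mem_chart_source E p)]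
  frame_solder x hx v := by
    change k x (chartCoord p p (chartFrame p p (Ring.inverse (k x) v))) = v
    rw [chartCoord_frame (mem_chart_source E p), h.apply_inverse hx]
  skewDer x hx v := h.gaugeConn_skewDer hc hpar hφ hx v
  torsion x hx u v := by
    have e2 : fderiv ℝ (gaugeSolder (M := M) p k) x u v - fderiv ℝ (gaugeSolder (M := M) p k) x v u +
        gaugeConn (skewConnection τ) p k x u (gaugeSolder p k x v) -
        gaugeConn (skewConnection τ) p k x v (gaugeSolder p k x u) =
        gaugeSolder p k x (christoffel (skewConnection τ) p x u v -
          christoffel (skewConnection τ) p x v u) := by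
      rw [map_sub, ← h.solder_christoffel hx, ← h.solder_christoffel hx]
      abel
    rw [e2]
    refine ext_inner_right ℝ fun d ↦ ?_
    -- The gauge carries the claim isometrically to the point with coordinates `x`, where the
    -- torsion is `2τ`; constancy of `τ` in the gauge brings it back to `p`.
    rw [← h.inner_gaugeField hx, h.gaugeField_solder hx, christoffel_torsion τ (h.subset hx),
      inner_smul_left, inner_sharp, inner_smul_left, inner_crossOf, ← h.gaugeField_solder hx u,
      ← h.gaugeField_solder hx v, h.torsion_gaugeField hpar hx, hφ]
    simp
    ring

omit h in
/-- The connection form of a radial gauge preserves subspaces invariant under the holonomy. -/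
theorem gaugeConn_mem (h : IsRadialGauge (skewConnection τ) p (extChartAt 𝓘(ℝ, E) p p) r k)
    {W : Submodule ℝ (TangentSpace 𝓘(ℝ, E) p)}
    (hW : ∀ A ∈ holonomyAlgebra (skewConnection τ) p, ∀ w ∈ W, A w ∈ W) {x : E}
    (hx : x ∈ Metric.ball (extChartAt 𝓘(ℝ, E) p p) r) (v : E) {w : TangentSpace 𝓘(ℝ, E) p}
    (hw : w ∈ W) : gaugeConn (skewConnection τ) p k x v w ∈ W := by
  obtain ⟨ε, hε, hA⟩ := h.exists_mem_holonomyAlgebra hx v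
  exact (W.smul_mem_iff hε).mp (hW _ hA w hw)

end IsRadialGauge

end CartanGauge

end SkewTorsion

namespace SkewTorsion

/-! ### Flat frames on the manifold -/

section FlatFrame

set_option synthInstance.maxHeartbeats 200000

universe u

theorem map_frameRotation {F F' : Type*} [NormedAddCommGroup F] [InnerProductSpace ℝ F]
    [NormedAddCommGroup F'] [InnerProductSpace ℝ F'] (L : F →L[ℝ] F')
    (hL : ∀ a b, inner ℝ (L a) (L b) = inner ℝ a b) (s : Fin 3 → F) (i : Fin 3) (v : F) :
    L (frameRotation s i v) = frameRotation (fun j ↦ L (s j)) i (L v) := by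
  simp only [frameRotation, map_sub, map_smul, hL]

variable {E : Type u} [NormedAddCommGroup E] [NormedSpace ℝ E] [FiniteDimensional ℝ E]
  {M : Type*} [TopologicalSpace M] [ChartedSpace E M] [IsManifold 𝓘(ℝ, E) ∞ M]
  [RiemannianBundle (fun x : M ↦ TangentSpace 𝓘(ℝ, E) x)]

/-- An orthonormal frame of an associative distribution on `U` that satisfies
`∇_v ξ = 6 c π(v) × ξ`. -/
structure IsFlatFrameOn (D : CovariantDerivative 𝓘(ℝ, E) E (TangentSpace 𝓘(ℝ, E) : M → Type _))
    (φ : ThreeForm 𝓘(ℝ, E) M) (c : ℝ) (U : Set M)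
    (ξ : Fin 3 → Π q : M, TangentSpace 𝓘(ℝ, E) q) : Prop where
  isOpen : IsOpen U
  smooth : ∀ i, ∀ q ∈ U, CMDiffAt ∞ (T% (ξ i)) q
  frame : ∀ q ∈ U, IsAssociativeFrame (crossOf (φ q)) fun i ↦ ξ i q
  flat : ∀ i, ∀ q ∈ U, ∀ v, D (ξ i) q v = (6 * c) • frameRotation (fun j ↦ ξ j q) i v

omit [FiniteDimensional ℝ E] [RiemannianBundle (fun x : M ↦ TangentSpace 𝓘(ℝ, E) x)] in
/-- The identification of the tangent spaces at `p` and at the point with coordinates `x` given by a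
gauge. -/
def gaugeMap (p : M) (k : E → E →L[ℝ] E) (x : E) :
    TangentSpace 𝓘(ℝ, E) p →L[ℝ] TangentSpace 𝓘(ℝ, E) (chartInv p x) :=
  chartFrame p (chartInv p x) ∘L k x ∘L chartCoord p p

variable [IsContMDiffRiemannianBundle 𝓘(ℝ, E) ∞ E (fun x : M ↦ TangentSpace 𝓘(ℝ, E) x)]
  {τ φ : ThreeForm 𝓘(ℝ, E) M} {c : ℝ} {p : M} {r : ℝ} {k : E → E →L[ℝ] E}

namespace IsRadialGauge

variable (h : IsRadialGauge (skewConnection τ) p (extChartAt 𝓘(ℝ, E) p p) r k)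

include h

theorem gaugeMap_eq {x : E} (hx : x ∈ Metric.ball (extChartAt 𝓘(ℝ, E) p p) r)
    (a : TangentSpace 𝓘(ℝ, E) p) :
    gaugeMap p k x a = gaugeField p k (chartCoord p p a) (chartInv p x) :=
  (gaugeField_chartInv (h.subset hx) k _).symm

theorem inner_gaugeMap {x : E} (hx : x ∈ Metric.ball (extChartAt 𝓘(ℝ, E) p p) r)
    (a b : TangentSpace 𝓘(ℝ, E) p) :
    inner ℝ (gaugeMap p k x a) (gaugeMap p k x b) = inner ℝ a b := by
  rw [h.gaugeMap_eq hx, h.gaugeMap_eq hx, h.inner_gaugeField hx]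

theorem gaugeMap_solder {x : E} (hx : x ∈ Metric.ball (extChartAt 𝓘(ℝ, E) p p) r) (v : E) :
    gaugeMap p k x (gaugeSolder p k x v) = chartFrame p (chartInv p x) v := by
  rw [h.gaugeMap_eq hx, h.gaugeField_solder hx]

theorem gaugeMap_surjective {x : E} (hx : x ∈ Metric.ball (extChartAt 𝓘(ℝ, E) p p) r)
    (w : TangentSpace 𝓘(ℝ, E) (chartInv p x)) :
    gaugeMap p k x (gaugeSolder p k x (chartCoord p (chartInv p x) w)) = w := by
  rw [h.gaugeMap_solder hx, chartFrame_coord (chartInv_mem (h.subset hx))]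

theorem gaugeMap_injective {x : E} (hx : x ∈ Metric.ball (extChartAt 𝓘(ℝ, E) p p) r) :
    Function.Injective (gaugeMap (M := M) p k x) := by
  rw [injective_iff_map_eq_zero]
  intro a ha
  rw [← inner_self_eq_zero (𝕜 := ℝ), ← h.inner_gaugeMap hx, ha, inner_zero_left]

theorem cross_gaugeMap (hc : c ≠ 0) (hpar : HasParallelSkewTorsion τ)
    (hφ : ∀ (q : M) (X Y Z : TangentSpace 𝓘(ℝ, E) q), τ q X Y Z = c * φ q X Y Z)
    {x : E} (hx : x ∈ Metric.ball (extChartAt 𝓘(ℝ, E) p p) r) (a b : TangentSpace 𝓘(ℝ, E) p) :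
    crossOf (φ (chartInv p x)) (gaugeMap p k x a) (gaugeMap p k x b) =
      gaugeMap p k x (crossOf (φ p) a b) := by
  refine ext_inner_right ℝ fun w ↦ ?_
  rw [← h.gaugeMap_surjective hx w, h.inner_gaugeMap hx, inner_crossOf, inner_crossOf]
  have h1 := h.torsion_gaugeField hpar hx a b (gaugeSolder p k x (chartCoord p (chartInv p x) w))
  rw [hφ, hφ, ← h.gaugeMap_eq hx, ← h.gaugeMap_eq hx, ← h.gaugeMap_eq hx] at h1
  exact mul_left_cancel₀ hc h1

theorem covariantDerivative_gaugeMap {x : E} (hx : x ∈ Metric.ball (extChartAt 𝓘(ℝ, E) p p) r)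
    {s : E → TangentSpace 𝓘(ℝ, E) p} (hs : DifferentiableAt ℝ s x)
    {ξ : Π q : M, TangentSpace 𝓘(ℝ, E) q} (hξ : MDiffAt (T% ξ) (chartInv p x))
    (e : ∀ᶠ y in nhds x, ξ (chartInv p y) = gaugeMap p k y (s y)) (v : E) :
    skewConnection τ ξ (chartInv p x) (chartFrame p (chartInv p x) v) =
      gaugeMap p k x (fderiv ℝ s x v + gaugeConn (skewConnection τ) p k x v (s x)) := by
  have ht := h.subset hx
  rw [covariantDerivative_chart _ ht hξ, e.self_of_nhds]
  have e' : (fun y ↦ chartCoord (E := E) p (chartInv p y) (ξ (chartInv p y)))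
      =ᶠ[nhds x] fun y ↦ k y (chartCoord p p (s y)) := by
    filter_upwards [(isOpen_extChartAt_target p).mem_nhds ht, e] with y hy he
    rw [he]
    exact chartCoord_frame (chartInv_mem hy) _
  have hd := ((h.hasFDerivAt hx).clm_apply
    ((chartCoord (E := E) p p).hasFDerivAt.comp x hs.hasFDerivAt)).fderiv
  have e2 : chartCoord (E := E) p (chartInv p x) (gaugeMap p k x (s x)) =
      k x (chartCoord p p (s x)) := chartCoord_frame (chartInv_mem ht) _
  have e3 : ∀ a, gaugeMap (M := M) p k x a = chartFrame p (chartInv p x) (k x (chartCoord p p a)) :=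
    fun _ ↦ rfl
  rw [e'.fderiv_eq, e2, e3]
  congr 1
  refine (congrArg (fun T : E →L[ℝ] E ↦ T v + christoffel (skewConnection τ) p x v
    (k x (chartCoord p p (s x)))) hd).trans ?_
  rw [map_add, map_add, gaugeConn_apply, chartCoord_frame (mem_chart_source E p),
    h.apply_inverse hx]
  simp
  abel

end IsRadialGauge

variable (hc : c ≠ 0) (hpar : HasParallelSkewTorsion τ)
  (hφ : ∀ (q : M) (X Y Z : TangentSpace 𝓘(ℝ, E) q), τ q X Y Z = c * φ q X Y Z)
  (hG : ∀ q, IsG2Form (φ q))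

-- The invariant subspace at `p` is preserved by the connection form of a radial gauge, so
-- `exists_flatCoordFrame` applies in the chart. The gauge map is isometric and compatible with the
-- products, and carries the frame to `M`.
include hc hpar hφ hG in
theorem exists_isFlatFrameOn (hred : HasReducibleHolonomy (skewConnection τ)) (p : M) :
    ∃ U ξ, p ∈ U ∧ IsFlatFrameOn (skewConnection τ) φ c U ξ := by
  obtain ⟨k, r, h⟩ := exists_isRadialGauge τ p (chart_mem (mem_chart_source E p))
  obtain ⟨W, hW, hW', hinv⟩ := hred p
  have hC := h.isCartanGauge hc hpar hφ
  obtain ⟨s, r', hr', hsub, hs, hfr⟩ := hC.exists_flatCoordFrame (hG p).isCrossProduct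
    (hG p).finrank_eq hc hW hW' (fun x hx v w hw ↦ h.gaugeConn_mem hinv hx v hw) h.mem_center
  let ξ : Fin 3 → Π q : M, TangentSpace 𝓘(ℝ, E) q := fun i q ↦
    chartFrame p q (k (extChartAt 𝓘(ℝ, E) p q) (chartCoord p p (s i (extChartAt 𝓘(ℝ, E) p q))))
  have hξ : ∀ i, ∀ y ∈ (extChartAt 𝓘(ℝ, E) p).target,
      ξ i (chartInv p y) = gaugeMap p k y (s i y) := fun i y hy ↦ by
    simp only [ξ, chart_chartInv hy]
    rfl
  let U := (extChartAt 𝓘(ℝ, E) p).source ∩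
    extChartAt 𝓘(ℝ, E) p ⁻¹' Metric.ball (extChartAt 𝓘(ℝ, E) p p) r'
  have hU : ∀ q ∈ U, ∃ x ∈ Metric.ball (extChartAt 𝓘(ℝ, E) p p) r', chartInv p x = q := by
    intro q hq
    refine ⟨_, hq.2, chartInv_chart ?_⟩
    rw [← extChartAt_source 𝓘(ℝ, E)]
    exact hq.1
  have hsm : ∀ i, ∀ q ∈ U, CMDiffAt ∞ (T% (ξ i)) q := by
    intro i q hq
    obtain ⟨x, hx, rfl⟩ := hU q hq
    have ht := h.subset (hsub hx)
    rw [contMDiffAt_section_iff_chart (chartInv_mem ht), chart_chartInv ht]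
    refine ((h.contDiffAt (hsub hx)).clm_apply ((contDiffAt_const (c := chartCoord (E := E) p p)).clm_apply
      ((hs i).contDiffAt (Metric.isOpen_ball.mem_nhds hx)))).congr_of_eventuallyEq ?_
    filter_upwards [(isOpen_extChartAt_target p).mem_nhds ht] with y hy
    rw [hξ i y hy]
    exact chartCoord_frame (chartInv_mem hy) _
  refine ⟨U, ξ, ⟨mem_extChartAt_source p, Metric.mem_ball_self hr'⟩, ?_, hsm, ?_, ?_⟩
  · exact (continuousOn_extChartAt p).isOpen_inter_preimage (isOpen_extChartAt_source p)
      Metric.isOpen_ball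
  · intro q hq
    obtain ⟨x, hx, rfl⟩ := hU q hq
    simp only [hξ _ x (h.subset (hsub hx))]
    refine ⟨?_, fun i ↦ ?_⟩
    · rw [orthonormal_iff_ite]
      intro i j
      rw [h.inner_gaugeMap (hsub hx), (hfr x hx).1.inner_eq]
    · rw [h.cross_gaugeMap hc hpar hφ (hsub hx), (hfr x hx).1.cross]
  · intro i q hq v
    have hm := (hsm i q hq).mdifferentiableAt (by simp)
    obtain ⟨x, hx, rfl⟩ := hU q hq
    have ht := h.subset (hsub hx)
    rw [← chartFrame_coord (chartInv_mem ht) v, h.covariantDerivative_gaugeMap (hsub hx)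
      (s := s i) (((hs i).contDiffAt (Metric.isOpen_ball.mem_nhds hx)).differentiableAt (by simp)) hm
      (by filter_upwards [(isOpen_extChartAt_target p).mem_nhds ht] with y hy using hξ i y hy)]
    rw [(hfr x hx).2, map_smul, map_frameRotation _ (h.inner_gaugeMap (hsub hx)),
      h.gaugeMap_solder (hsub hx)]
    simp only [hξ _ x ht]

namespace IsFlatFrameOn

variable {U U' : Set M} {ξ ξ' : Fin 3 → Π q : M, TangentSpace 𝓘(ℝ, E) q}
  (hξ : IsFlatFrameOn (skewConnection τ) φ c U ξ) (hξ' : IsFlatFrameOn (skewConnection τ) φ c U' ξ')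

-- The opposite passage, from `M` to the gauge, which makes the uniqueness result in coordinates
-- available.
include hξ in
theorem exists_coordFrame (h : IsRadialGauge (skewConnection τ) p (extChartAt 𝓘(ℝ, E) p p) r k)
    (hp : p ∈ U) : ∃ s : Fin 3 → E → TangentSpace 𝓘(ℝ, E) p,
      (∀ i, ContDiffAt ℝ ∞ (s i) (extChartAt 𝓘(ℝ, E) p p)) ∧
      (∀ᶠ x in nhds (extChartAt 𝓘(ℝ, E) p p),
        IsFlatCoordFrameAt c (gaugeSolder p k) (gaugeConn (skewConnection τ) p k) s x) ∧
      ∀ i, s i (extChartAt 𝓘(ℝ, E) p p) = ξ i p := by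
  let s : Fin 3 → E → TangentSpace 𝓘(ℝ, E) p := fun i x ↦
    gaugeSolder p k x (chartCoord p (chartInv p x) (ξ i (chartInv p x)))
  have hps := mem_chart_source E p
  have hcont : ContinuousAt (chartInv (M := M) p) (extChartAt 𝓘(ℝ, E) p p) :=
    (contMDiffAt_chartInv (chart_mem hps)).continuousAt
  have hUn : ∀ᶠ x in nhds (extChartAt 𝓘(ℝ, E) p p), chartInv p x ∈ U :=
    hcont.eventually (by rw [chartInv_chart hps]; exact hξ.isOpen.mem_nhds hp)
  have hb : ∀ᶠ x in nhds (extChartAt 𝓘(ℝ, E) p p), x ∈ Metric.ball (extChartAt 𝓘(ℝ, E) p p) r :=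
    Metric.isOpen_ball.mem_nhds h.mem_center
  have hs : ∀ᶠ x in nhds (extChartAt 𝓘(ℝ, E) p p), ∀ i, ContDiffAt ℝ ∞ (s i) x := by
    filter_upwards [hUn, hb] with x hxU hx i
    have h1 := hξ.smooth i _ hxU
    rw [contMDiffAt_section_iff_chart (chartInv_mem (h.subset hx)), chart_chartInv (h.subset hx)] at h1
    exact (h.contDiffAt_solder hx).clm_apply h1
  refine ⟨s, hs.self_of_nhds, ?_, fun i ↦ ?_⟩
  · filter_upwards [hUn, hb, hs] with x hxU hx hsx i v
    have e : ∀ j, ∀ y ∈ Metric.ball (extChartAt 𝓘(ℝ, E) p p) r,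
        ξ j (chartInv p y) = gaugeMap p k y (s j y) := fun j y hy ↦
      (h.gaugeMap_surjective hy _).symm
    have h1 := h.covariantDerivative_gaugeMap hx ((hsx i).differentiableAt (by simp))
      ((hξ.smooth i _ hxU).mdifferentiableAt (by simp))
      (by filter_upwards [Metric.isOpen_ball.mem_nhds hx] with y hy using e i y hy) v
    rw [hξ.flat i _ hxU] at h1
    refine h.gaugeMap_injective hx (h1.symm.trans ?_)
    simp only [e _ x hx, ← h.gaugeMap_solder hx v]
    rw [map_smul, map_frameRotation _ (h.inner_gaugeMap hx)]
  · have h1 : ∀ q, q = p → chartFrame p p (Ring.inverse (k (extChartAt 𝓘(ℝ, E) p p))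
        (chartCoord p q (ξ i q))) = ξ i p := by
      rintro q rfl
      rw [h.center, Ring.inverse_one]
      exact chartFrame_coord hps _
    exact h1 _ (chartInv_chart hps)

include hξ hξ' hc hpar hφ hG in
theorem span_eq {q : M} (hq : q ∈ U) (hq' : q ∈ U') :
    Submodule.span ℝ (Set.range fun j ↦ ξ j q) = Submodule.span ℝ (Set.range fun j ↦ ξ' j q) := by
  obtain ⟨k, r, h⟩ := exists_isRadialGauge τ q (chart_mem (mem_chart_source E q))
  obtain ⟨s, hs, hf, he⟩ := hξ.exists_coordFrame h hq
  obtain ⟨s', hs', hf', he'⟩ := hξ'.exists_coordFrame h hq'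
  have := (h.isCartanGauge hc hpar hφ).flatFrame_span_unique (hG q).isCrossProduct
    (hG q).finrank_eq hc h.mem_center hs hs' hf hf'
    (by simpa only [he] using (hξ.frame q hq).orthonormal)
    (by simpa only [he'] using (hξ'.frame q hq').orthonormal)
  simpa only [he, he'] using this

include hξ hξ' hc hpar hφ hG in
/-- The transition functions of two flat frames are locally constant. -/
theorem mvfderiv_inner {q : M} (hq : q ∈ U) (hq' : q ∈ U') (i j : Fin 3) :
    mvfderiv 𝓘(ℝ, E) (fun q ↦ inner ℝ (ξ i q) (ξ' j q)) q = 0 := by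
  ext v
  rw [skewConnection_metric τ ((hξ.smooth i q hq).mdifferentiableAt (by simp))
    ((hξ'.smooth j q hq').mdifferentiableAt (by simp)), hξ.flat i q hq, hξ'.flat j q hq']
  have hB := (hG q).isCrossProduct
  have hsp := span_eq hc hpar hφ hG hξ hξ' hq hq'
  have hf := hξ.frame q hq
  have hf' := hξ'.frame q hq'
  have h3 : Module.finrank ℝ (Submodule.span ℝ (Set.range fun j ↦ ξ j q)) = 3 := by
    rw [finrank_span_eq_card hf.orthonormal.linearIndependent, Fintype.card_fin]
  -- The frames have the same span, hence the same `π`. Both covariant derivatives are then given by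
  -- the single skew map `6c π(v) ×`, and the two terms cancel.
  rw [← hf.sum_cross hB, ← hf'.sum_cross hB,
    ← starProjection_eq_sum h3 hf.orthonormal (fun i ↦ Submodule.subset_span ⟨i, rfl⟩),
    ← starProjection_eq_sum h3 hf'.orthonormal (fun i ↦ by
      rw [hsp]; exact Submodule.subset_span ⟨i, rfl⟩), inner_smul_left, inner_smul_right,
    hB.anti _ (ξ i q), inner_neg_left, hB.inner_rotate, real_inner_comm (ξ i q)]
  simp

end IsFlatFrameOn

end FlatFrame

end SkewTorsion

namespace SkewTorsion

/-! ### The endomorphisms `Φᵢ` and their algebraic identities -/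

section FrameEndomorphism

variable {F : Type*} [NormedAddCommGroup F] [InnerProductSpace ℝ F]

/-- The endomorphism `X ↦ s i × X - 2 s i × π X` of an associative frame. -/
def frameEndo (B : F →L[ℝ] F →L[ℝ] F) (s : Fin 3 → F) (i : Fin 3) : F →L[ℝ] F :=
  B (s i) + (2 : ℝ) • ((innerSL ℝ (s (i + 2))).smulRight (s (i + 1)) -
    (innerSL ℝ (s (i + 1))).smulRight (s (i + 2)))

theorem frameEndo_apply (B : F →L[ℝ] F →L[ℝ] F) (s : Fin 3 → F) (i : Fin 3) (x : F) :
    frameEndo B s i x = B (s i) x + (2 : ℝ) • frameRotation s i x := rfl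

theorem inner_frameRotation (s : Fin 3 → F) (i : Fin 3) (x y : F) :
    inner ℝ (frameRotation s i x) y = inner ℝ (s (i + 2)) x * inner ℝ (s (i + 1)) y -
      inner ℝ (s (i + 1)) x * inner ℝ (s (i + 2)) y := by
  simp [frameRotation, inner_sub_left, inner_smul_left]

/-- The multiplication table of an associative frame. -/
structure IsAssociativeTriple (B : F →L[ℝ] F →L[ℝ] F) (a b d : F) : Prop where
  aa : inner ℝ a a = (1 : ℝ)
  bb : inner ℝ b b = (1 : ℝ)
  dd : inner ℝ d d = (1 : ℝ)
  ab : inner ℝ a b = (0 : ℝ)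
  ba : inner ℝ b a = (0 : ℝ)
  ad : inner ℝ a d = (0 : ℝ)
  da : inner ℝ d a = (0 : ℝ)
  bd : inner ℝ b d = (0 : ℝ)
  db : inner ℝ d b = (0 : ℝ)
  cab : B a b = d
  cba : B b a = - d
  cbd : B b d = a
  cdb : B d b = - a
  cda : B d a = b
  cad : B a d = - b

theorem IsCrossProduct.inner_cross_right {B : F →L[ℝ] F →L[ℝ] F} (hB : IsCrossProduct B)
    (u v w : F) : inner ℝ u (B v w) = inner ℝ (B u v) w := by
  rw [real_inner_comm, ← hB.inner_rotate]

namespace IsAssociativeFrame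

variable {B : F →L[ℝ] F →L[ℝ] F} {s : Fin 3 → F} (hs : IsAssociativeFrame B s)
  (hB : IsCrossProduct B)

include hB in
theorem frameEndo_skew (s : Fin 3 → F) (i : Fin 3) (x y : F) :
    inner ℝ (frameEndo B s i x) y = - inner ℝ x (frameEndo B s i y) := by
  rw [real_inner_comm (frameEndo B s i y), frameEndo_apply, frameEndo_apply, inner_add_left,
    inner_add_left, inner_smul_left, inner_smul_left, inner_frameRotation, inner_frameRotation,
    hB.inner_rotate (s i) x y, hB.anti x y, inner_neg_left, hB.inner_rotate y x,
    hB.inner_rotate x (s i) y, hB.inner_rotate (s i) y x]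
  simp
  ring

include hs in
theorem inner_add_eq_zero (i : Fin 3) {j l : Fin 3} (h : j ≠ l) :
    inner ℝ (s (i + j)) (s (i + l)) = (0 : ℝ) := by
  rw [hs.inner_eq, if_neg fun e ↦ h (add_left_cancel e)]

include hs hB in
theorem triple (i : Fin 3) : IsAssociativeTriple B (s i) (s (i + 1)) (s (i + 2)) where
  aa := by rw [hs.inner_eq, if_pos rfl]
  bb := by rw [hs.inner_eq, if_pos rfl]
  dd := by rw [hs.inner_eq, if_pos rfl]
  ab := by simpa using hs.inner_add_eq_zero i (show (0 : Fin 3) ≠ 1 by decide)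
  ba := by simpa using hs.inner_add_eq_zero i (show (1 : Fin 3) ≠ 0 by decide)
  ad := by simpa using hs.inner_add_eq_zero i (show (0 : Fin 3) ≠ 2 by decide)
  da := by simpa using hs.inner_add_eq_zero i (show (2 : Fin 3) ≠ 0 by decide)
  bd := hs.inner_add_eq_zero i (by decide)
  db := hs.inner_add_eq_zero i (by decide)
  cab := hs.cross i
  cba := by rw [hB.anti, hs.cross]
  cbd := by simpa [add_assoc] using hs.cross (i + 1)
  cdb := by rw [hB.anti]; simpa [add_assoc] using hs.cross (i + 1)
  cda := by simpa [add_assoc] using hs.cross (i + 2)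
  cad := hs.cross_two hB i

include hs hB

/-- The endomorphism is `- sᵢ ×` on the span of the frame and `sᵢ ×` on its complement. The sign
change on the span makes the composition rules agree on both parts, up to the terms involving the
frame. -/
theorem frameEndo_succ (i : Fin 3) : s (i + 2) = - frameEndo B s i (s (i + 1)) := by
  have t := hs.triple hB i
  rw [frameEndo_apply, frameRotation, t.cab, t.bb, t.db]
  module

theorem frameEndo_pred (i : Fin 3) : s (i + 2) = frameEndo B s (i + 1) (s i) := by
  have t := hs.triple hB i
  rw [frameEndo_apply, frameRotation, show i + 1 + 1 = i + 2 by omega, show i + 1 + 2 = i by omega,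
    t.cba, t.aa, t.da]
  module

theorem frameEndo_sq (i : Fin 3) (x : F) :
    frameEndo B s i (frameEndo B s i x) = - x + inner ℝ (s i) x • s i := by
  have t := hs.triple hB i
  have key := hB.cross_cross_self (s i) x
  rw [t.aa] at key
  simp only [frameEndo_apply, frameRotation]
  generalize s i = a at *
  generalize s (i + 1) = b at *
  generalize s (i + 2) = d at *
  obtain ⟨aa, bb, dd, ab, ba, ad, da, bd, db, cab, cba, cbd, cdb, cda, cad⟩ := t
  simp only [map_add, map_sub, map_smul, inner_add_right, inner_sub_right, inner_smul_right,
    hB.inner_cross_right, bb, dd, bd, db, cab, cba, cda, cad, inner_neg_left]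
  linear_combination (norm := module) key

/-- The content is `cross_cross` for `x, a, b` with `a × b = d`; all other terms are products within
the frame. -/
theorem frameEndo_comp (i : Fin 3) (x : F) :
    frameEndo B s (i + 2) x =
      - frameEndo B s i (frameEndo B s (i + 1) x) + inner ℝ (s (i + 1)) x • s i := by
  have t := hs.triple hB i
  simp only [frameEndo_apply, frameRotation, show i + 1 + 1 = i + 2 by omega,
    show i + 1 + 2 = i by omega, show i + 2 + 2 = i + 1 by omega, show i + 2 + 1 = i by omega]
  generalize s i = a at *
  generalize s (i + 1) = b at *
  generalize s (i + 2) = d at *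
  obtain ⟨aa, bb, dd, ab, ba, ad, da, bd, db, cab, cba, cbd, cdb, cda, cad⟩ := t
  have key := hB.cross_cross x a b
  rw [cab, hB.anti x d, hB.anti x b, map_neg, neg_neg, real_inner_comm b x, real_inner_comm a x,
    ab] at key
  simp only [map_add, map_sub, map_smul, inner_add_right, inner_sub_right, inner_smul_right,
    hB.inner_cross_right, dd, ba, da, bd, cdb, cad, inner_neg_left, hB.self, inner_zero_left]
  linear_combination (norm := module) - key

theorem frameEndo_comp_swap (i : Fin 3) (x : F) :
    frameEndo B s (i + 2) x =
      frameEndo B s (i + 1) (frameEndo B s i x) - inner ℝ (s i) x • s (i + 1) := by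
  have t := hs.triple hB i
  simp only [frameEndo_apply, frameRotation, show i + 1 + 1 = i + 2 by omega,
    show i + 1 + 2 = i by omega, show i + 2 + 2 = i + 1 by omega, show i + 2 + 1 = i by omega]
  generalize s i = a at *
  generalize s (i + 1) = b at *
  generalize s (i + 2) = d at *
  obtain ⟨aa, bb, dd, ab, ba, ad, da, bd, db, cab, cba, cbd, cdb, cda, cad⟩ := t
  have key := hB.cross_cross x b a
  rw [cba, map_neg, hB.anti x d, hB.anti x a, map_neg, neg_neg, real_inner_comm b x,
    real_inner_comm a x, ba] at key
  simp only [map_add, map_sub, map_smul, inner_add_right, inner_sub_right, inner_smul_right,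
    hB.inner_cross_right, dd, ab, ad, db, cda, cbd, hB.self, inner_zero_left]
  linear_combination (norm := module) key

end IsAssociativeFrame

end FrameEndomorphism

/-! ### Flat frames are 3-(α,δ)-Sasaki structures -/

section Sasaki

set_option synthInstance.maxHeartbeats 200000

universe u

variable {E : Type u} [NormedAddCommGroup E] [NormedSpace ℝ E] [FiniteDimensional ℝ E]
  {M : Type*} [TopologicalSpace M] [ChartedSpace E M] [IsManifold 𝓘(ℝ, E) ∞ M]
  [RiemannianBundle (fun x : M ↦ TangentSpace 𝓘(ℝ, E) x)]
  [IsContMDiffRiemannianBundle 𝓘(ℝ, E) ∞ E (fun x : M ↦ TangentSpace 𝓘(ℝ, E) x)]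
  {τ φ : ThreeForm 𝓘(ℝ, E) M} {c : ℝ}

theorem contMDiffAt_crossOf {q : M} {X Y : Π q : M, TangentSpace 𝓘(ℝ, E) q}
    (hX : CMDiffAt ∞ (T% X) q) (hY : CMDiffAt ∞ (T% Y) q) :
    CMDiffAt ∞ (T% fun q ↦ crossOf (φ q) (X q) (Y q)) q := by
  have hq := mem_chart_source E q
  refine contMDiffAt_of_inner hq fun a ↦ ?_
  simp only [inner_crossOf]
  exact φ.smooth q X Y _ hX hY (contMDiffAt_chartFrame hq contMDiffAt_const)

/-- A flat frame is a 3-(α,δ)-Sasaki structure with `δ = 5 α`. -/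
theorem IsFlatFrameOn.isThreeAlphaDeltaSasakiOn (hc : c ≠ 0)
    (hφ : ∀ (q : M) (X Y Z : TangentSpace 𝓘(ℝ, E) q), τ q X Y Z = c * φ q X Y Z)
    (hG : ∀ q, IsG2Form (φ q)) {U : Set M} {ξ : Fin 3 → Π q : M, TangentSpace 𝓘(ℝ, E) q}
    (hξ : IsFlatFrameOn (skewConnection τ) φ c U ξ) :
    IsThreeAlphaDeltaSasakiOn U c (5 * c) ξ
      (fun i q ↦ frameEndo (crossOf (φ q)) (fun j ↦ ξ j q) i) := by
  have hB : ∀ q, IsCrossProduct (crossOf (φ q)) := fun q ↦ (hG q).isCrossProduct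
  have hm : ∀ i, ∀ q ∈ U, MDiffAt (T% (ξ i)) q := fun i q hq ↦
    (hξ.smooth i q hq).mdifferentiableAt (by simp)
  -- Brackets are expressed through `∇^τ` and its torsion, so that flatness of the frame can be
  -- used.
  have hbr : ∀ (q : M) (X Y : Π q : M, TangentSpace 𝓘(ℝ, E) q), MDiffAt (T% X) q →
      MDiffAt (T% Y) q → ∀ w, inner ℝ (mlieBracket 𝓘(ℝ, E) X Y q) w =
        inner ℝ (skewConnection τ Y q (X q)) w - inner ℝ (skewConnection τ X q (Y q)) w -
          2 * c * inner ℝ (crossOf (φ q) (X q) (Y q)) w := by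
    intro q X Y hX hY w
    have h := congrArg (fun z ↦ inner ℝ z w) (skewConnection_torsion τ hX hY)
    simp only [inner_sub_left, inner_add_left, inner_smul_left, inner_sharp, hφ] at h
    rw [inner_crossOf, h]
    simp
    ring
  refine ⟨hc, hξ.smooth, ?_, ?_, ?_, ?_, ?_, ?_, ?_, ?_⟩
  · intro i q hq X hX
    have hr : ∀ j, CMDiffAt ∞ (fun q ↦ inner ℝ (ξ j q) (X q)) q := fun j ↦
      contMDiffAt_inner (hξ.smooth j q hq) hX
    have h1 := ((hr (i + 2)).smul_section (hξ.smooth (i + 1) q hq))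
    have h2 := ((hr (i + 1)).smul_section (hξ.smooth (i + 2) q hq))
    have h3 := (contMDiffAt_crossOf (φ := φ) (hξ.smooth i q hq) hX).add_section
      ((contMDiffAt_const (c := (2 : ℝ))).smul_section (h1.sub_section h2))
    exact h3
  · intro i q hq
    exact (hξ.frame q hq).orthonormal.1 i
  · intro i q hq X Y hX hY
    -- Both the torsion term and `frameRotation` are skew in `X, Y`, hence the field is Killing.
    rw [lieDerivMetric, skewConnection_metric τ hX hY, real_inner_comm _ (X q),
      real_inner_comm _ (X q), hbr q _ _ (hm i q hq) hX, hbr q _ _ (hm i q hq) hY,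
      hξ.flat i q hq, hξ.flat i q hq, inner_smul_left, inner_smul_left, inner_frameRotation,
      inner_frameRotation, (hB q).inner_rotate (ξ i q) (X q) (Y q),
      (hB q).inner_swap (ξ i q) (Y q) (X q), (hB q).anti (X q) (Y q), inner_neg_left]
    simp
    ring
  · intro i q hq X Y
    exact IsAssociativeFrame.frameEndo_skew (hB q) _ i X Y
  · intro i q hq
    exact ⟨(hξ.frame q hq).frameEndo_succ (hB q) i, (hξ.frame q hq).frameEndo_pred (hB q) i⟩
  · intro i q hq X
    exact ⟨(hξ.frame q hq).frameEndo_comp (hB q) i X,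
      (hξ.frame q hq).frameEndo_comp_swap (hB q) i X⟩
  · intro i q hq X
    exact (hξ.frame q hq).frameEndo_sq (hB q) i X
  · intro i q hq X Y hX hY
    -- The left side is `2c ξᵢ ×` plus `12c` times `frameRotation`. On the right the latter has
    -- coefficient `4α - 2(α - δ)`; with `α = c` this forces `δ = 5c`.
    rw [extDerivDual, skewConnection_metric τ (hm i q hq) hY, skewConnection_metric τ (hm i q hq) hX,
      real_inner_comm (mlieBracket 𝓘(ℝ, E) X Y q), hbr q _ _ hX hY, hξ.flat i q hq, hξ.flat i q hq,
      inner_smul_left, inner_smul_left, frameEndo_apply, inner_add_left, inner_smul_left,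
      inner_frameRotation, inner_frameRotation,
      (hB q).inner_rotate (ξ i q) (X q) (Y q), real_inner_comm (ξ i q) (skewConnection τ Y q (X q)),
      real_inner_comm (ξ i q) (skewConnection τ X q (Y q))]
    simp
    ring

end Sasaki

end SkewTorsion

namespace SkewTorsion

/-! ### Sections of local systems -/

section LocalSystem

/-- On a simply connected space, a local system, given by locally constant transition functions, has
a section with prescribed value at a point. -/
theorem exists_locallyConstant_section {M ι X : Type*} [TopologicalSpace M] [SimplyConnectedSpace M]
    [LocallyPathConnectedSpace M] (U : ι → Set M) (hU : ∀ i, IsOpen (U i)) (k : M → ι)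
    (hk : ∀ x, x ∈ U (k x)) (g : ι → ι → M → X → X)
    (hself : ∀ i, ∀ x ∈ U i, ∀ v, g i i x v = v)
    (hcomp : ∀ i j l, ∀ x ∈ U i ∩ U j ∩ U l, ∀ v, g j l x (g i j x v) = g i l x v)
    (hconst : ∀ i j, ∀ x ∈ U i ∩ U j, ∀ᶠ y in nhds x, ∀ v, g i j y v = g i j x v)
    (x₀ : M) (v₀ : X) :
    ∃ A : ι → M → X, (∀ i j, ∀ x ∈ U i ∩ U j, g i j x (A i x) = A j x) ∧
      (∀ i, ∀ x ∈ U i, ∀ᶠ y in nhds x, A i y = A i x) ∧ A (k x₀) x₀ = v₀ := by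
  -- With a discrete fibre, locally constant transition functions are continuous and the bundle is a
  -- covering.
  let _ : TopologicalSpace X := ⊥
  have : DiscreteTopology X := ⟨rfl⟩
  let Z : FiberBundleCore ι M X :=
    { baseSet := U
      isOpen_baseSet := hU
      indexAt := k
      mem_baseSet_at := hk
      coordChange := g
      coordChange_self := hself
      continuousOn_coordChange := by
        rintro i j ⟨x, v⟩ ⟨hx, -⟩
        refine ContinuousAt.continuousWithinAt ?_
        have h : ∀ᶠ y : M × X in nhds (x, v), g i j y.1 y.2 = g i j x v := by
          have h1 := (continuousAt_fst (p := (x, v))).eventually (hconst i j x hx)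
          have h2 : ∀ᶠ y : M × X in nhds (x, v), y.2 = v :=
            (continuousAt_snd (p := (x, v))).eventually (isOpen_discrete {v} |>.mem_nhds rfl)
          filter_upwards [h1, h2] with y h1 h2
          rw [h1, h2]
        exact (continuousAt_const (y := g i j x v)).congr (h.mono fun y hy ↦ hy.symm)
      coordChange_comp := hcomp }
  have hcov : IsCoveringMap (Bundle.TotalSpace.proj : Bundle.TotalSpace X Z.Fiber → M) :=
    FiberBundle.isCoveringMap
  -- A section is a lift of the identity map, which exists over a simply connected base.
  obtain ⟨s, ⟨hs₀, hs⟩, -⟩ := hcov.existsUnique_continuousMap_lifts (ContinuousMap.id M) x₀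
    (⟨x₀, v₀⟩ : Bundle.TotalSpace X Z.Fiber) rfl
  have hs' : ∀ x, (s x).1 = x := fun x ↦ congrFun hs x
  let A : ι → M → X := fun i x ↦ (Z.localTriv i (s x)).2
  let a : M → X := fun x ↦ (s x).2
  have hA : ∀ i x, A i x = g (k x) i x (a x) := fun i x ↦ by
    change g (k (s x).1) i (s x).1 (a x) = _
    rw [hs']
  refine ⟨A, fun i j x hx ↦ ?_, fun i x hx ↦ ?_, ?_⟩
  · rw [hA, hA, hcomp _ _ _ x ⟨⟨hk x, hx.1⟩, hx.2⟩]
  · have hsrc : s x ∈ (Z.localTriv i).source := by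
      rw [FiberBundleCore.mem_localTriv_source, ← FiberBundleCore.baseSet_at, hs']
      exact hx
    have hc : ContinuousAt (A i) x :=
      continuous_snd.continuousAt.comp
        (((Z.localTriv i).toOpenPartialHomeomorph.continuousAt hsrc).comp s.continuous.continuousAt)
    exact hc.eventually (IsOpen.mem_nhds (isOpen_discrete {A i x}) rfl)
  · have ha : a x₀ = v₀ := by
      change (s x₀).2 = _
      rw [hs₀]
    rw [hA, hself _ _ (hk x₀), ha]

end LocalSystem

/-! ### Linear combinations of associative frames -/

section FrameCombination

variable {F F' : Type*} [NormedAddCommGroup F] [InnerProductSpace ℝ F]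
  [NormedAddCommGroup F'] [InnerProductSpace ℝ F'] {B : F →L[ℝ] F →L[ℝ] F}
  {B' : F' →L[ℝ] F' →L[ℝ] F'} {s : Fin 3 → F} {s' : Fin 3 → F'}

namespace IsAssociativeFrame

theorem cross_combination (hs : IsAssociativeFrame B s) (hB : IsCrossProduct B)
    (a b : Fin 3 → ℝ) : B (∑ j, a j • s j) (∑ j, b j • s j) =
      ∑ j, (a (j + 1) * b (j + 2) - a (j + 2) * b (j + 1)) • s j := by
  have c01 : B (s 0) (s 1) = s 2 := hs.cross 0
  have c12 : B (s 1) (s 2) = s 0 := hs.cross 1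
  have c20 : B (s 2) (s 0) = s 1 := hs.cross 2
  have c10 : B (s 1) (s 0) = - s 2 := by rw [hB.anti, c01]
  have c21 : B (s 2) (s 1) = - s 0 := by rw [hB.anti, c12]
  have c02 : B (s 0) (s 2) = - s 1 := by rw [hB.anti, c20]
  simp only [Fin.sum_univ_three, map_add, map_smul, add_apply, smul_apply, c01, c12, c20, c10, c21,
    c02, hB.self, zero_add, Fin.isValue, show (1 : Fin 3) + 1 = 2 by decide,
    show (1 : Fin 3) + 2 = 0 by decide, show (2 : Fin 3) + 1 = 0 by decide,
    show (2 : Fin 3) + 2 = 1 by decide]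
  module

/-- Whether a linear combination of an associative frame is associative depends only on the
coefficients. -/
theorem combination (hs : IsAssociativeFrame B s) (hB : IsCrossProduct B)
    (hs' : IsAssociativeFrame B' s') (hB' : IsCrossProduct B') {A : Fin 3 → Fin 3 → ℝ}
    (h : IsAssociativeFrame B fun i ↦ ∑ j, A i j • s j) :
    IsAssociativeFrame B' fun i ↦ ∑ j, A i j • s' j := by
  refine ⟨?_, fun i ↦ ?_⟩
  · rw [orthonormal_iff_ite]
    intro i l
    have h1 := h.inner_eq i l
    rw [hs.orthonormal.inner_sum] at h1
    rw [hs'.orthonormal.inner_sum, h1]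
  · have h1 := h.cross i
    rw [hs.cross_combination hB] at h1
    rw [hs'.cross_combination hB']
    refine Finset.sum_congr rfl fun j _ ↦ ?_
    have h2 := congrArg (inner ℝ (s j)) h1
    rw [hs.orthonormal.inner_right_fintype, hs.orthonormal.inner_right_fintype] at h2
    rw [h2]

/-- `frameRotation` is equivariant under a change of associative frame. -/
theorem sum_frameRotation (hs : IsAssociativeFrame B s) (hB : IsCrossProduct B)
    {A : Fin 3 → Fin 3 → ℝ} {t : Fin 3 → F} (ht : IsAssociativeFrame B t)
    (hA : ∀ i, t i = ∑ j, A i j • s j) (i : Fin 3) (v : F) :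
    ∑ j, A i j • frameRotation s j v = frameRotation t i v := by
  have h3 : Module.finrank ℝ (Submodule.span ℝ (Set.range s)) = 3 := by
    rw [finrank_span_eq_card hs.orthonormal.linearIndependent, Fintype.card_fin]
  have : FiniteDimensional ℝ (Submodule.span ℝ (Set.range s)) :=
    FiniteDimensional.span_of_finite ℝ (Set.finite_range s)
  rw [← ht.sum_cross hB, ← starProjection_eq_sum h3 ht.orthonormal (fun i ↦ by
      rw [hA]
      exact Submodule.sum_mem _ fun j _ ↦ Submodule.smul_mem _ _ (Submodule.subset_span ⟨j, rfl⟩)),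
    starProjection_eq_sum h3 hs.orthonormal (fun i ↦ Submodule.subset_span ⟨i, rfl⟩), hA i, map_sum]
  refine Finset.sum_congr rfl fun j _ ↦ ?_
  rw [map_smul, hs.sum_cross hB]

end IsAssociativeFrame

end FrameCombination

/-! ### Gluing flat frames -/

section Global

set_option synthInstance.maxHeartbeats 200000

universe u

variable {E : Type u} [NormedAddCommGroup E] [NormedSpace ℝ E]
  {M : Type*} [TopologicalSpace M] [ChartedSpace E M] [IsManifold 𝓘(ℝ, E) ∞ M]

theorem eventually_eq_of_mvfderiv_eq_zero {f : M → ℝ} {p : M}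
    (hf : ∀ᶠ q in nhds p, MDifferentiableAt 𝓘(ℝ, E) 𝓘(ℝ, ℝ) f q ∧ mvfderiv 𝓘(ℝ, E) f q = 0) :
    ∀ᶠ q in nhds p, f q = f p := by
  have hps := mem_chart_source E p
  have hcont : ContinuousAt (chartInv (M := M) p) (extChartAt 𝓘(ℝ, E) p p) :=
    (contMDiffAt_chartInv (chart_mem hps)).continuousAt
  have h1 : ∀ᶠ x in nhds (extChartAt 𝓘(ℝ, E) p p),
      (MDifferentiableAt 𝓘(ℝ, E) 𝓘(ℝ, ℝ) f (chartInv p x) ∧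
        mvfderiv 𝓘(ℝ, E) f (chartInv p x) = 0) ∧ x ∈ (extChartAt 𝓘(ℝ, E) p).target :=
    (hcont.eventually (by rw [chartInv_chart hps]; exact hf)).and
      ((isOpen_extChartAt_target p).mem_nhds (chart_mem hps))
  obtain ⟨r, hr, hball⟩ := Metric.eventually_nhds_iff_ball.mp h1
  have hd : ∀ x ∈ Metric.ball (extChartAt 𝓘(ℝ, E) p p) r,
      DifferentiableAt ℝ (f ∘ chartInv p) x ∧ fderiv ℝ (f ∘ chartInv p) x = 0 := fun x hx ↦ by
    obtain ⟨⟨hm, h0⟩, ht⟩ := hball x hx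
    refine ⟨?_, ?_⟩
    · have := (mdifferentiableAt_iff_chart (chartInv_mem ht)).mp hm
      rwa [chart_chartInv ht] at this
    · ext v
      rw [← mvfderiv_chartFrame ht hm, h0]
      simp
  have hconst : ∀ x ∈ Metric.ball (extChartAt 𝓘(ℝ, E) p p) r,
      f (chartInv p x) = f p := fun x hx ↦ by
    have := Metric.isOpen_ball.is_const_of_fderiv_eq_zero
      (convex_ball (extChartAt 𝓘(ℝ, E) p p) r).isPreconnected
      (fun x hx ↦ (hd x hx).1.differentiableWithinAt) (fun x hx ↦ (hd x hx).2) hx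
      (Metric.mem_ball_self hr)
    rwa [Function.comp_apply, Function.comp_apply, chartInv_chart hps] at this
  filter_upwards [(continuousAt_extChartAt (I := 𝓘(ℝ, E)) p).eventually
    (Metric.ball_mem_nhds _ hr), (chartAt E p).open_source.mem_nhds hps] with q hq hqs
  rw [← hconst _ hq, chartInv_chart hqs]

variable [FiniteDimensional ℝ E] [RiemannianBundle (fun x : M ↦ TangentSpace 𝓘(ℝ, E) x)]
  [IsContMDiffRiemannianBundle 𝓘(ℝ, E) ∞ E (fun x : M ↦ TangentSpace 𝓘(ℝ, E) x)]
  {τ φ : ThreeForm 𝓘(ℝ, E) M} {c : ℝ}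

omit [IsContMDiffRiemannianBundle 𝓘(ℝ, E) ∞ E (fun x : M ↦ TangentSpace 𝓘(ℝ, E) x)] in
/-- A field of associative frames that is locally a constant combination of flat frames is flat. -/
theorem isFlatFrameOn_of_combination
    {D : CovariantDerivative 𝓘(ℝ, E) E (TangentSpace 𝓘(ℝ, E) : M → Type _)}
    (hB : ∀ q, IsCrossProduct (crossOf (φ q))) {V : Set M} (hV : IsOpen V)
    {η : Fin 3 → Π q : M, TangentSpace 𝓘(ℝ, E) q}
    (hη : ∀ q ∈ V, IsAssociativeFrame (crossOf (φ q)) fun i ↦ η i q)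
    (h : ∀ q ∈ V, ∃ U ξ, q ∈ U ∧ IsFlatFrameOn D φ c U ξ ∧ ∃ A : Fin 3 → Fin 3 → ℝ,
      ∀ᶠ y in nhds q, ∀ i, η i y = ∑ j, A i j • ξ j y) : IsFlatFrameOn D φ c V η := by
  have hsm : ∀ i, ∀ q ∈ V, CMDiffAt ∞ (T% (η i)) q := fun i q hq ↦ by
    obtain ⟨U, ξ, hqU, hξ, A, hA⟩ := h q hq
    have h1 : CMDiffAt ∞ (T% (fun y ↦ ∑ j, A i j • ξ j y)) q :=
      ContMDiffAt.sum_section fun j _ ↦ contMDiffAt_const.smul_section (hξ.smooth j q hqU)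
    refine h1.congr_of_eventuallyEq ?_
    filter_upwards [hA] with y hy
    rw [hy i]
  refine ⟨hV, hsm, hη, fun i q hq v ↦ ?_⟩
  obtain ⟨U, ξ, hqU, hξ, A, hA⟩ := h q hq
  have hm : ∀ j, MDiffAt (T% (A i j • ξ j)) q := fun j ↦
    (contMDiffAt_const.smul_section (hξ.smooth j q hqU)).mdifferentiableAt (by simp)
  have hms : MDiffAt (T% (∑ j, A i j • ξ j)) q := by
    have := MDifferentiableAt.sum_section (s := Finset.univ) (fun j _ ↦ hm j)
    convert this using 3
    simp
  rw [D.isCovariantDerivativeOnUniv.congr_of_eventuallyEq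
    ((hsm i q hq).mdifferentiableAt (by simp)) hms Filter.univ_mem
    (hA.mono fun y hy ↦ by simp [hy i]), covariantDerivative_sum D _ hm,
    ← (hξ.frame q hqU).sum_frameRotation (hB q) (hη q hq) hA.self_of_nhds, Finset.smul_sum]
  rw [sum_apply]
  refine Finset.sum_congr rfl fun j _ ↦ ?_
  rw [D.isCovariantDerivativeOnUniv.smul_const _ ((hξ.smooth j q hqU).mdifferentiableAt (by simp)),
    smul_apply, hξ.flat j q hqU, smul_comm]

/-- On a simply connected manifold there is a global flat frame. -/
theorem exists_isFlatFrameOn_univ [SimplyConnectedSpace M] (hc : c ≠ 0)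
    (hpar : HasParallelSkewTorsion τ)
    (hφ : ∀ (q : M) (X Y Z : TangentSpace 𝓘(ℝ, E) q), τ q X Y Z = c * φ q X Y Z)
    (hG : ∀ q, IsG2Form (φ q)) (hred : HasReducibleHolonomy (skewConnection τ)) :
    ∃ ξ, IsFlatFrameOn (skewConnection τ) φ c Set.univ ξ := by
  have hB : ∀ q, IsCrossProduct (crossOf (φ q)) := fun q ↦ (hG q).isCrossProduct
  have : LocallyPathConnectedSpace M := ChartedSpace.locallyPathConnectedSpace E M
  choose U ξ hU hξ using exists_isFlatFrameOn hc hpar hφ hG hred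
  have hex : ∀ p q x, x ∈ U p → x ∈ U q → ∀ j,
      ξ p j x = ∑ l, inner ℝ (ξ p j x) (ξ q l x) • ξ q l x := fun p q x hp hq j ↦ by
    have h1 := eq_sum_of_mem_span ((hξ q).frame x hq).orthonormal
      (x := ξ p j x) (by
        rw [IsFlatFrameOn.span_eq hc hpar hφ hG (hξ q) (hξ p) hq hp]
        exact Submodule.subset_span ⟨j, rfl⟩)
    simpa only [real_inner_comm] using h1
  -- The fibre of the local system consists of all coefficient matrices; no restriction to rotations
  -- is needed. The transition re-expresses a combination of one flat frame in another.
  let g : M → M → M → (Fin 3 → Fin 3 → ℝ) → (Fin 3 → Fin 3 → ℝ) := fun p q x A i l ↦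
    ∑ j, A i j * inner ℝ (ξ p j x) (ξ q l x)
  have hg : ∀ p q x, x ∈ U p → x ∈ U q → ∀ A i,
      ∑ l, g p q x A i l • ξ q l x = ∑ j, A i j • ξ p j x := fun p q x hp hq A i ↦ by
    simp only [g, Finset.sum_smul, mul_smul]
    rw [Finset.sum_comm]
    refine Finset.sum_congr rfl fun j _ ↦ ?_
    rw [← Finset.smul_sum, ← hex p q x hp hq j]
  have huniq : ∀ p x, x ∈ U p → ∀ A A' : Fin 3 → Fin 3 → ℝ,
      (∀ i, ∑ j, A i j • ξ p j x = ∑ j, A' i j • ξ p j x) → A = A' := fun p x hp A A' h ↦ by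
    ext i j
    have h2 := congrArg (inner ℝ (ξ p j x)) (h i)
    rwa [((hξ p).frame x hp).orthonormal.inner_right_fintype (A i),
      ((hξ p).frame x hp).orthonormal.inner_right_fintype (A' i)] at h2
  obtain ⟨x₀⟩ : Nonempty M := inferInstance
  obtain ⟨A, hA, hconst, hA₀⟩ := exists_locallyConstant_section U (fun p ↦ (hξ p).isOpen) id hU g
    (fun p x hp v ↦ huniq p x hp _ _ fun i ↦ hg p p x hp hp v i)
    (fun p q r x hx v ↦ huniq r x hx.2 _ _ fun i ↦ by
      rw [hg q r x hx.1.2 hx.2, hg p q x hx.1.1 hx.1.2, hg p r x hx.1.1 hx.2])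
    (fun p q x hx ↦ by
      have h1 : ∀ j l, ∀ᶠ y in nhds x,
          inner ℝ (ξ p j y) (ξ q l y) = inner ℝ (ξ p j x) (ξ q l x) := fun j l ↦ by
        refine eventually_eq_of_mvfderiv_eq_zero (E := E) (f := fun y ↦ inner ℝ (ξ p j y) (ξ q l y)) ?_
        filter_upwards [(hξ p).isOpen.mem_nhds hx.1, (hξ q).isOpen.mem_nhds hx.2] with y hp hq
        exact ⟨(contMDiffAt_inner ((hξ p).smooth j y hp)
          ((hξ q).smooth l y hq)).mdifferentiableAt (by simp),
          IsFlatFrameOn.mvfderiv_inner hc hpar hφ hG (hξ p) (hξ q) hp hq j l⟩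
      filter_upwards [Filter.eventually_all.mpr fun j ↦ Filter.eventually_all.mpr (h1 j)]
        with y hy v
      simp only [g, hy]) x₀ (fun i j ↦ if i = j then 1 else 0)
  let η : Fin 3 → Π q : M, TangentSpace 𝓘(ℝ, E) q := fun i q ↦ ∑ j, A q q i j • ξ q j q
  have hη : ∀ p q, q ∈ U p → ∀ i, η i q = ∑ j, A p q i j • ξ p j q := fun p q hq i ↦ by
    rw [← hA q p q ⟨hU q, hq⟩, hg q p q (hU q) hq]
  have hloc : ∀ p, ∀ᶠ y in nhds p, ∀ i, η i y = ∑ j, A p p i j • ξ p j y := fun p ↦ by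
    filter_upwards [hconst p p (hU p), (hξ p).isOpen.mem_nhds (hU p)] with y h1 h2 i
    rw [hη p y h2, h1]
  have hframe : ∀ q, IsAssociativeFrame (crossOf (φ q)) fun i ↦ η i q := by
    -- With locally constant coefficients, being an associative frame is an open and closed
    -- condition. It holds at `x₀`, where the matrix is the identity, hence everywhere on the
    -- connected `M`.
    have hiff : ∀ p, ∀ᶠ y in nhds p, ((IsAssociativeFrame (crossOf (φ y)) fun i ↦ η i y) ↔
        IsAssociativeFrame (crossOf (φ p)) fun i ↦ η i p) := fun p ↦ by
      filter_upwards [hloc p, (hξ p).isOpen.mem_nhds (hU p)] with y h1 h2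
      have h3 := (hloc p).self_of_nhds
      simp only [h1, h3]
      exact ⟨((hξ p).frame y h2).combination (hB y) ((hξ p).frame p (hU p)) (hB p),
        ((hξ p).frame p (hU p)).combination (hB p) ((hξ p).frame y h2) (hB y)⟩
    have hclopen : IsClopen {q : M | IsAssociativeFrame (crossOf (φ q)) fun i ↦ η i q} := by
      refine ⟨isOpen_compl_iff.mp (isOpen_iff_mem_nhds.mpr fun p hp ↦ ?_),
        isOpen_iff_mem_nhds.mpr fun p hp ↦ ?_⟩
      · filter_upwards [hiff p] with y hy using fun h ↦ hp (hy.mp h)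
      · filter_upwards [hiff p] with y hy using hy.mpr hp
    have h0 : IsAssociativeFrame (crossOf (φ x₀)) fun i ↦ η i x₀ := by
      have h1 : ∀ i, η i x₀ = ξ x₀ i x₀ := fun i ↦ by
        have h2 : A x₀ x₀ = fun i j ↦ if i = j then 1 else 0 := hA₀
        simp [η, h2]
      simp only [h1]
      exact (hξ x₀).frame x₀ (hU x₀)
    intro q
    exact (Set.ext_iff.mp (hclopen.eq_univ ⟨x₀, h0⟩) q).mpr (Set.mem_univ q)
  exact ⟨η, isFlatFrameOn_of_combination hB isOpen_univ (fun q _ ↦ hframe q) fun q _ ↦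
    ⟨U q, ξ q, hU q, hξ q, A q q, hloc q⟩⟩

end Global

end SkewTorsion

end

theorem mainTheorem3 {M : Type*} [TopologicalSpace M] [T2Space M] [SecondCountableTopology M]
    [ChartedSpace (EuclideanSpace ℝ (Fin 7)) M] [IsManifold (𝓡 7) ∞ M]
    [RiemannianBundle (fun x : M ↦ TangentSpace (𝓡 7) x)]
    [IsContMDiffRiemannianBundle (𝓡 7) ∞ (EuclideanSpace ℝ (Fin 7))
      (fun x : M ↦ TangentSpace (𝓡 7) x)]
    (τ : SkewTorsion.ThreeForm (𝓡 7) M)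
    (hτ : SkewTorsion.IsStrictlyNearlyParallelG2 τ)
    (hred : SkewTorsion.HasReducibleHolonomy (SkewTorsion.skewConnection τ)) :
    ∃ α : ℝ,
      (∀ p : M, ∃ U : Set M, IsOpen U ∧ p ∈ U ∧
        ∃ (ξ : Fin 3 → Π q : M, TangentSpace (𝓡 7) q)
          (Φ : Fin 3 → Π q : M, TangentSpace (𝓡 7) q →L[ℝ] TangentSpace (𝓡 7) q),
          SkewTorsion.IsThreeAlphaDeltaSasakiOn U α (5 * α) ξ Φ) ∧
      (SimplyConnectedSpace M →
        ∃ (ξ : Fin 3 → Π q : M, TangentSpace (𝓡 7) q)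
          (Φ : Fin 3 → Π q : M, TangentSpace (𝓡 7) q →L[ℝ] TangentSpace (𝓡 7) q),
          SkewTorsion.IsThreeAlphaDeltaSasakiOn Set.univ α (5 * α) ξ Φ) := by
  obtain ⟨hpar, φ, τ₀, hτ₀, hG, hφ⟩ := hτ
  have hc : τ₀ / 12 ≠ 0 := div_ne_zero hτ₀ (by norm_num)
  -- The constant `α` is the factor relating `τ` to `φ`.
  refine ⟨τ₀ / 12, fun p ↦ ?_, fun _ ↦ ?_⟩
  · obtain ⟨U, ξ, hpU, hξ⟩ := SkewTorsion.exists_isFlatFrameOn hc hpar hφ hG hred p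
    exact ⟨U, hξ.isOpen, hpU, ξ, _, hξ.isThreeAlphaDeltaSasakiOn hc hφ hG⟩
  · obtain ⟨ξ, hξ⟩ := SkewTorsion.exists_isFlatFrameOn_univ hc hpar hφ hG hred
    exact ⟨ξ, _, hξ.isThreeAlphaDeltaSasakiOn hc hφ hG⟩
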